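/- **Submodular optimization with small probabilities (SOSP).** Fix $\delta>0$ and a constant budget $k>0$. An instance consists of a ground set $[n]$, a normalized ($f(\emptyset)=0$) monotone submodular function $f:2^{[n]}\to\mathbb{Q}_{\ge 0}$ given by a value oracle, and rational probabilities $p_i\in[0,1]$ with $\max_i p_i\le\delta$. The goal is to choose $q\in\mathbb{R}^n$ with $0\le q_i\le p_i$ for all $i$ and $\sum_i q_i\le k$ so as to maximize $$F(q)=\mathbb{E}[f(T)]=\sum_{T\subseteq[n]}\Big(\prod_{i\in T}q_i\prod_{i\notin T}(1-q_i)\Big)f(T).$$ A (randomized) polynomial-time $c$-approximation algorithm always halts in time polynomial in $n$, the bit lengths of the $p_i$ and the maximal bit length of a value of $f$, and on every instance it outputs, with probability at least $2/3$ over its coins, a feasible $q$ with $F(q)\ge c\cdot F(q')$ for every feasible $q'$. (Deterministic algorithms are a special case.) **Planted clique.** Draw a graph from $G(n,1/2)$ and a uniformly random set $C$ of $\lfloor n^{\beta}\rfloor$ of its vertices, and make $C$ a clique. Planted-Clique with exponent $\beta$ is solved in polynomial time with high probability if a randomized algorithm, which always halts in time polynomial in $n$, outputs $C$ with probability tending to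 $1$ as $n\to\infty$ (over the graph, $C$, and the coins of the algorithm). **Theorem.** Let $k>0$ and $$\rho(k)=\frac{1-e^{-k/2}}{1-\left(\frac k2+1\right)e^{-k}}.$$ If for some $\delta>0$ and some constant $c>\rho(k)$ there is a polynomial-time $c$-approximation algorithm for SOSP with probabilities at most $\delta$ and budget $k$, then for every $\beta\in(0,1/2)$ Planted-Clique with exponent $\beta$ can be solved in polynomial time with high probability. In particular, for $k=1.7$ the threshold is $\rho(1.7)\approx 0.865$, that is, $|\rho(1.7)-0.865|<0.0005$. -/

import Mathlib

open Filter Topology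

/-! ### Random access machines with a value oracle

A structured random access machine.  It has registers `reg 0, reg 1, …` and arrays
`arr 0, arr 1, …`, all of whose cells hold natural numbers.  A program mentions finitely many
registers and arrays; cells of an array are addressed through a register.  The arithmetic is
addition, truncated subtraction and halving, each at unit cost, so that (as numbers grow by at most
one bit per step) polynomial time on this machine is polynomial time on a Turing machine. -/

namespace RAM

/-- The state of the machine. -/
structure State where
  reg : ℕ → ℕ
  arr : ℕ → ℕ → ℕ

/-- `reg a := v`. -/
def State.setReg (s : State) (a v : ℕ) : State :=
  { s with reg := Function.update s.reg a v }

/-- `arr A [i] := v`. -/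
def State.setArr (s : State) (A i v : ℕ) : State :=
  { s with arr := Function.update s.arr A (Function.update (s.arr A) i v) }

/-- Programs. The meaning of each command is given by `Exec` below. -/
inductive Prog : Type
  | skip : Prog
  | const (a c : ℕ) : Prog
  | plus (a b c : ℕ) : Prog
  | monus (a b c : ℕ) : Prog
  | half (a b : ℕ) : Prog
  | load (a A b : ℕ) : Prog
  | store (A a b : ℕ) : Prog
  | query (a b A : ℕ) : Prog
  | seq (P Q : Prog) : Prog
  | cond (a : ℕ) (P Q : Prog) : Prog
  | loop (a : ℕ) (P : Prog) : Prog

/-- An oracle is asked by presenting the content of an array; it answers with a nonnegative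
rational number, which the machine receives as numerator and denominator. -/
abbrev Oracle : Type := (ℕ → ℕ) → ℚ≥0

/-- `Exec O P s t s'`: with oracle `O`, the program `P` started in the state `s` halts after
exactly `t` steps in the state `s'`. Every primitive command, every oracle query and every test
takes one step. -/
inductive Exec (O : Oracle) : Prog → State → ℕ → State → Prop
  | skip (s : State) : Exec O .skip s 1 s
  | const (s : State) (a c : ℕ) : Exec O (.const a c) s 1 (s.setReg a c)
  | plus (s : State) (a b c : ℕ) :
      Exec O (.plus a b c) s 1 (s.setReg a (s.reg b + s.reg c))
  | monus (s : State) (a b c : ℕ) :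
      Exec O (.monus a b c) s 1 (s.setReg a (s.reg b - s.reg c))
  | half (s : State) (a b : ℕ) : Exec O (.half a b) s 1 (s.setReg a (s.reg b / 2))
  | load (s : State) (a A b : ℕ) :
      Exec O (.load a A b) s 1 (s.setReg a (s.arr A (s.reg b)))
  | store (s : State) (A a b : ℕ) :
      Exec O (.store A a b) s 1 (s.setArr A (s.reg a) (s.reg b))
  | query (s : State) (a b A : ℕ) :
      Exec O (.query a b A) s 1
        ((s.setReg a (O (s.arr A)).num).setReg b (O (s.arr A)).den)
  | seq {P Q : Prog} {s s' s'' : State} {t t' : ℕ} :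
      Exec O P s t s' → Exec O Q s' t' s'' → Exec O (.seq P Q) s (t + t') s''
  | cond_true {a : ℕ} {P : Prog} (Q : Prog) {s s' : State} {t : ℕ} :
      s.reg a ≠ 0 → Exec O P s t s' → Exec O (.cond a P Q) s (t + 1) s'
  | cond_false {a : ℕ} (P : Prog) {Q : Prog} {s s' : State} {t : ℕ} :
      s.reg a = 0 → Exec O Q s t s' → Exec O (.cond a P Q) s (t + 1) s'
  | loop_stop {a : ℕ} (P : Prog) {s : State} :
      s.reg a = 0 → Exec O (.loop a P) s 1 s
  | loop_step {a : ℕ} {P : Prog} {s s' s'' : State} {t t' : ℕ} :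
      s.reg a ≠ 0 → Exec O P s t s' → Exec O (.loop a P) s' t' s'' →
        Exec O (.loop a P) s (t + t' + 1) s''

/-- The oracle that carries no information (it always answers `0`): with it, the machine is an
ordinary random access machine. -/
def noOracle : Oracle := fun _ => 0

/-- The start state of a randomized program on an input consisting of a number `n` (in
register `0`) and two arrays (arrays `0` and `1`); array `2` holds the random bits `r`.
Everything else is `0`. -/
def start (n : ℕ) (x y : ℕ → ℕ) {m : ℕ} (r : Fin m → Bool) : State where
  reg a := if a = 0 then n else 0
  arr A :=
    match A with
    | 0 => x
    | 1 => y
    | 2 => fun i => if h : i < m then (r ⟨i, h⟩).toNat else 0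
    | _ => fun _ => 0

end RAM

/-! ### Submodular optimization with small probabilities -/

/-- An instance of the problem with probabilities at most `δ`: a ground set `{0, …, n-1}`, a
normalized monotone submodular function on its subsets, and the probabilities of the elements. -/
structure SOSPInstance (δ : ℝ) where
  n : ℕ
  f : Finset (Fin n) → ℚ≥0
  f_empty : f ∅ = 0
  f_mono : Monotone f
  f_submodular : ∀ S T : Finset (Fin n), f (S ∪ T) + f (S ∩ T) ≤ f S + f T
  p : Fin n → ℚ≥0
  p_le_one : ∀ i, p i ≤ 1
  p_le : ∀ i, (p i : ℝ) ≤ δ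

namespace SOSPInstance

variable {δ : ℝ} (I : SOSPInstance δ)

/-- The expected value of `f` on the random set that contains each element `i` independently with
probability `q i`. -/
noncomputable def expectedValue (q : Fin I.n → ℝ) : ℝ :=
  ∑ T : Finset (Fin I.n), ((∏ i ∈ T, q i) * ∏ i ∈ Tᶜ, (1 - q i)) * (I.f T : ℝ)

/-- `q` is a feasible solution for the budget `k`. -/
def Feasible (k : ℝ) (q : Fin I.n → ℝ) : Prop :=
  (∀ i, 0 ≤ q i ∧ q i ≤ (I.p i : ℝ)) ∧ ∑ i, q i ≤ k

/-- `q` is feasible, and its value is at least `c` times that of every feasible solution. -/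
def IsApprox (k c : ℝ) (q : Fin I.n → ℝ) : Prop :=
  I.Feasible k q ∧ ∀ q' : Fin I.n → ℝ, I.Feasible k q' →
    c * I.expectedValue q' ≤ I.expectedValue q

/-- The value oracle of the instance: the set `{i | x i ≠ 0}` is answered with its value. -/
def oracle : RAM.Oracle := fun x => I.f {i : Fin I.n | x i ≠ 0}

/-- The number of bits of a nonnegative rational number. -/
def bits (x : ℚ≥0) : ℕ := Nat.size x.num + Nat.size x.den

/-- The size of the instance: the number of elements, plus the number of bits of the
probabilities, plus the largest number of bits of a value of `f`. -/
def size : ℕ :=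
  I.n + ∑ i, bits (I.p i) + Finset.univ.sup fun S : Finset (Fin I.n) => bits (I.f S)

/-- The start state: the number of elements, the numerators of the probabilities (array `0`),
their denominators (array `1`), and the random bits. The function is accessible only through the
oracle. -/
def start {m : ℕ} (r : Fin m → Bool) : RAM.State :=
  RAM.start I.n (fun i => if h : i < I.n then (I.p ⟨i, h⟩).num else 0)
    (fun i => if h : i < I.n then (I.p ⟨i, h⟩).den else 0) r

/-- The vector of rational numbers with numerators in array `3` and denominators in array `4`. -/
noncomputable def output (s : RAM.State) : Fin I.n → ℝ :=
  fun i => (s.arr 3 i : ℝ) / (s.arr 4 i : ℝ)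

end SOSPInstance

/-- Submodular optimization with probabilities at most `δ` and budget `k` has a randomized
polynomial time `c`-approximation algorithm in the value oracle model: a program `P` and a
polynomial `T` such that on every instance, with `m = T(size)` uniform random bits, `P` always
halts within `m` steps and returns a `c`-approximate solution with probability at least `2/3`. -/
def SOSPApproximable (k δ c : ℝ) : Prop :=
  ∃ (P : RAM.Prog) (T : Polynomial ℕ), ∀ I : SOSPInstance δ,
    (∀ r : Fin (T.eval I.size) → Bool, ∃ (t : ℕ) (s : RAM.State),
      RAM.Exec I.oracle P (I.start r) t s ∧ t ≤ T.eval I.size) ∧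
    (2 / 3 : ℝ) * 2 ^ (T.eval I.size) ≤
      Nat.card {r : Fin (T.eval I.size) → Bool // ∃ (t : ℕ) (s : RAM.State),
        RAM.Exec I.oracle P (I.start r) t s ∧ I.IsApprox k c (I.output s)}

/-! ### Planted cliques -/

namespace PlantedClique

/-- The graph `G` with a clique planted on the vertex set `C`. -/
def plant {n : ℕ} (G : SimpleGraph (Fin n)) (C : Finset (Fin n)) : SimpleGraph (Fin n) where
  Adj u v := G.Adj u v ∨ (u ≠ v ∧ u ∈ C ∧ v ∈ C)
  symm := ⟨fun _ _ h => h.imp (fun e => e.symm) fun e => ⟨e.1.symm, e.2.2, e.2.1⟩⟩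
  loopless := ⟨fun _ h => h.elim (fun e => e.ne rfl) fun e => e.1 rfl⟩

open Classical in
/-- The start state for a graph: the number `n` of vertices, the adjacency matrix (in array `0`,
row by row), and the random bits. -/
noncomputable def start {n : ℕ} (G : SimpleGraph (Fin n)) {m : ℕ} (r : Fin m → Bool) : RAM.State :=
  RAM.start n (fun x => if ∃ i j : Fin n, x = i * n + j ∧ G.Adj i j then 1 else 0) (fun _ => 0) r

/-- The vertex set whose indicator is in array `3`. -/
def output (n : ℕ) (s : RAM.State) : Finset (Fin n) := {i : Fin n | s.arr 3 i ≠ 0}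

/-- The probability that the program `P`, with `m` uniform random bits, returns the planted clique
`C`, where `C` is a uniform set of `κ` out of `n` vertices, planted in a graph `G` distributed as
`G(n, 1/2)`, that is, uniform among the graphs on the `n` vertices. -/
noncomputable def successProb (P : RAM.Prog) (n κ m : ℕ) : ℝ :=
  (Nat.card {x : {C : Finset (Fin n) // C.card = κ} × SimpleGraph (Fin n) × (Fin m → Bool) //
      ∃ (t : ℕ) (s : RAM.State),
        RAM.Exec RAM.noOracle P (start (plant x.2.1 x.1) x.2.2) t s ∧ output n s = x.1} : ℝ) /
    Nat.card ({C : Finset (Fin n) // C.card = κ} × SimpleGraph (Fin n) × (Fin m → Bool))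

/-- There is a randomized polynomial time algorithm that with high probability (tending to `1`
as `n → ∞`) finds a planted clique of size `κ n` in `G(n, 1/2)`. The algorithm always halts within
a polynomial number of steps. -/
def Solvable (κ : ℕ → ℕ) : Prop :=
  ∃ (P : RAM.Prog) (T : Polynomial ℕ),
    (∀ (n : ℕ) (G : SimpleGraph (Fin n)) (r : Fin (T.eval n) → Bool),
      ∃ (t : ℕ) (s : RAM.State),
        RAM.Exec RAM.noOracle P (start G r) t s ∧ t ≤ T.eval n) ∧
    Tendsto (fun n : ℕ => successProb P n (κ n) (T.eval n)) atTop (𝓝 1)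

end PlantedClique

/-- The hardness threshold for the budget `k`. -/
noncomputable def hardnessRatio (k : ℝ) : ℝ :=
  (1 - Real.exp (-k / 2)) / (1 - (k / 2 + 1) * Real.exp (-k))

/-!
A program for the submodular problem is turned into a test that tells the vertices of a planted
clique `C` from the others.

Given a vertex `v`, keep only the edges between vertices that are not adjacent to `v`, and pass to a
power of this graph: its elements are the `l`-tuples of vertices, and two tuples are adjacent if
every vertex of one is adjacent to every vertex of the other. The function of this graph has the
value `1 - 2⁻ᶜ` on independent sets with `c` elements, and `1` on sets that contain an edge (and, in
order that its values have few bits, on sets with at least `K` elements). It is monotone and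
submodular (`graphFun_submodular`). All probabilities are `1 / n ^ e`.

* If `v ∉ C`, then about half of `C` is not adjacent to `v`, so the tuples of these `m` vertices are
  almost all adjacent to each other (`powAdj_hasCore`). The uniform vector on them, which is feasible
  as soon as `k * n ^ e ≤ m ^ l`, picks a Poisson number of elements, and two of them suffice for the
  value `1`. Hence its value tends to `1 - (k / 2 + 1) * exp (-k)`
  (`le_sum_setProb_graphFun_core`). Without edges, no vector has a value above `1 - exp (-k / 2)`, up
  to small errors. As `c` exceeds the ratio of these numbers, a `c`-approximate solution `q` must have
  weight `∑ q x * q y` at least `1 / E` on the pairs of adjacent elements, for a constant `E`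
  (`passes_of_isApprox`); this also survives the rounding of `q`.
* If `v ∈ C`, then the non-neighbours of `v` other than `v` lie outside of `C`, so the restricted
  graph is contained in the original random graph, which has no complete bipartite subgraph with
  `3 log n` vertices on both sides (`unifProb_not_bicliqueFree_le`). Then no feasible vector has such
  a weight (`not_passes_of_bicliqueFree`). By the power mean inequality the weight to the power `s`,
  where `s` is about `log n`, is bounded by a sum over `s`-tuples of elements of the weight of their
  common neighbours. If the `s` elements involve at least `3 log n` vertices, then the common
  neighbours involve fewer, so they are few elements of tiny weight; and there are few `s`-tuples of
  elements that involve fewer vertices (`adjWeight_pow_le`).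

The test is repeated `n` times for each vertex, with the same `n` blocks of random bits for all
vertices, so that a vertex outside of `C` escapes with probability at most `3⁻ⁿ`. The vertices for
which no test succeeds are returned.

The reduction is carried out on the machine itself: `RAM.cliqueP` computes the table of the power,
simulates the given program in a separate zone of the memory, with every oracle query replaced by a
computation of the value, and evaluates the test. Its correctness and its running time are
`RAM.Runs.cliqueP`; that the running time is polynomial is `RAM.polyBounded_cliqueTime`.
-/

/-! ### Reasoning about programs -/

namespace RAM

-- sequential composition of programs
infixr:67 " ⨾ " => RAM.Prog.seq

@[simp] theorem State.reg_setReg (s : State) (a v b : ℕ) :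
    (s.setReg a v).reg b = if b = a then v else s.reg b := by
  simp [State.setReg, Function.update_apply]

@[simp] theorem State.arr_setReg (s : State) (a v : ℕ) : (s.setReg a v).arr = s.arr := rfl

@[simp] theorem State.reg_setArr (s : State) (A i v : ℕ) : (s.setArr A i v).reg = s.reg := rfl

@[simp] theorem State.arr_setArr (s : State) (A i v B : ℕ) :
    (s.setArr A i v).arr B = if B = A then Function.update (s.arr A) i v else s.arr B := by
  simp [State.setArr, Function.update_apply]

/-- The machine is deterministic. -/
theorem Exec.unique {O : Oracle} {P : Prog} {s s' : State} {t : ℕ} (h : Exec O P s t s') :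
    ∀ {t₂ : ℕ} {s₂ : State}, Exec O P s t₂ s₂ → t = t₂ ∧ s' = s₂ := by
  induction h with
  | seq _ _ ih ih' =>
    intro t₂ s₂ h₂
    cases h₂ with
    | seq h₃ h₄ =>
      obtain ⟨rfl, rfl⟩ := ih h₃
      obtain ⟨rfl, rfl⟩ := ih' h₄
      exact ⟨rfl, rfl⟩
  | cond_true Q hr _ ih =>
    intro t₂ s₂ h₂
    cases h₂ with
    | cond_true _ _ h₃ =>
      obtain ⟨rfl, rfl⟩ := ih h₃
      exact ⟨rfl, rfl⟩
    | cond_false _ h => exact absurd h hr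
  | cond_false Q hr _ ih =>
    intro t₂ s₂ h₂
    cases h₂ with
    | cond_true _ h _ => exact absurd hr h
    | cond_false _ _ h₃ =>
      obtain ⟨rfl, rfl⟩ := ih h₃
      exact ⟨rfl, rfl⟩
  | loop_stop P hr =>
    intro t₂ s₂ h₂
    cases h₂ with
    | loop_stop _ _ => exact ⟨rfl, rfl⟩
    | loop_step h _ _ => exact absurd hr h
  | loop_step hr _ _ ih ih' =>
    intro t₂ s₂ h₂
    cases h₂ with
    | loop_stop _ h => exact absurd h hr
    | loop_step _ h₃ h₄ =>
      obtain ⟨rfl, rfl⟩ := ih h₃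
      obtain ⟨rfl, rfl⟩ := ih' h₄
      exact ⟨rfl, rfl⟩
  | _ => intro t₂ s₂ h₂; cases h₂; exact ⟨rfl, rfl⟩

/-- `P.wr a` holds if the text of `P` has a command that writes to register `a`. -/
def Prog.wr : Prog → ℕ → Bool
  | .skip, _ => false
  | .const a _, x => x == a
  | .plus a _ _, x => x == a
  | .monus a _ _, x => x == a
  | .half a _, x => x == a
  | .load a _ _, x => x == a
  | .store _ _ _, _ => false
  | .query a b _, x => x == a || x == b
  | .seq P Q, x => P.wr x || Q.wr x
  | .cond _ P Q, x => P.wr x || Q.wr x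
  | .loop _ P, x => P.wr x

/-- `P.wa A` holds if the text of `P` has a command that writes to array `A`. -/
def Prog.wa : Prog → ℕ → Bool
  | .store A _ _, x => x == A
  | .seq P Q, x => P.wa x || Q.wa x
  | .cond _ P Q, x => P.wa x || Q.wa x
  | .loop _ P, x => P.wa x
  | _, _ => false

/-- The states `s` and `s'` agree on everything that the text of `P` does not write to. -/
def Frame (P : Prog) (s s' : State) : Prop :=
  (∀ a, P.wr a = false → s'.reg a = s.reg a) ∧ ∀ A, P.wa A = false → s'.arr A = s.arr A

theorem Frame.refl (P : Prog) (s : State) : Frame P s s := ⟨fun _ _ => rfl, fun _ _ => rfl⟩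

theorem Frame.trans {P : Prog} {s s' s'' : State} (h : Frame P s s') (h' : Frame P s' s'') :
    Frame P s s'' :=
  ⟨fun a ha => (h'.1 a ha).trans (h.1 a ha), fun A hA => (h'.2 A hA).trans (h.2 A hA)⟩

theorem Frame.mono {P Q : Prog} {s s' : State} (h : Frame P s s')
    (hr : ∀ a, Q.wr a = false → P.wr a = false) (ha : ∀ a, Q.wa a = false → P.wa a = false) :
    Frame Q s s' :=
  ⟨fun a h' => h.1 a (hr a h'), fun A h' => h.2 A (ha A h')⟩

theorem Exec.frame {O : Oracle} {P : Prog} {s s' : State} {t : ℕ} (h : Exec O P s t s') :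
    Frame P s s' := by
  induction h with
  | seq _ _ ih ih' =>
    exact (ih.mono (by simp +contextual [Prog.wr]) (by simp +contextual [Prog.wa])).trans
      (ih'.mono (by simp +contextual [Prog.wr]) (by simp +contextual [Prog.wa]))
  | cond_true Q hr _ ih =>
    exact ih.mono (by simp +contextual [Prog.wr]) (by simp +contextual [Prog.wa])
  | cond_false Q hr _ ih =>
    exact ih.mono (by simp +contextual [Prog.wr]) (by simp +contextual [Prog.wa])
  | loop_stop P hr => exact Frame.refl _ _
  | loop_step hr _ _ ih ih' =>
    exact (ih.mono (by simp [Prog.wr]) (by simp [Prog.wa])).trans ih'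
  | _ => constructor <;> simp +contextual [Prog.wr, Prog.wa]

/-- The ordinary machine, running `P` from `s`, halts within `τ` steps in a state satisfying `Q`. -/
def Runs (P : Prog) (s : State) (τ : ℕ) (Q : State → Prop) : Prop :=
  ∃ t s', Exec noOracle P s t s' ∧ t ≤ τ ∧ Q s'

/-- An upper bound for the running time of a program whose loops run for at most `B` rounds. -/
def Prog.cost (B : ℕ) : Prog → ℕ
  | .seq P Q => P.cost B + Q.cost B
  | .cond _ P Q => P.cost B + Q.cost B + 1
  | .loop _ P => B * (P.cost B + 1) + 1
  | _ => 1

/-- `P` halts in a state satisfying `Q`, within the time for at most `B` rounds in each loop. -/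
abbrev RunsB (B : ℕ) (P : Prog) (s : State) (Q : State → Prop) : Prop := Runs P s (P.cost B) Q

namespace Runs

variable {P P' : Prog} {s : State} {τ τ' B : ℕ} {Q R : State → Prop}

theorem mono (h : Runs P s τ Q) (hτ : τ ≤ τ') (hQ : ∀ s', Q s' → R s') : Runs P s τ' R := by
  obtain ⟨t, s', h₁, h₂, h₃⟩ := h
  exact ⟨t, s', h₁, h₂.trans hτ, hQ s' h₃⟩

theorem imp (h : Runs P s τ Q) (hQ : ∀ s', Q s' → R s') : Runs P s τ R := h.mono le_rfl hQ

theorem frame (h : Runs P s τ Q) : Runs P s τ fun s' => Q s' ∧ Frame P s s' := by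
  obtain ⟨t, s', h₁, h₂, h₃⟩ := h
  exact ⟨t, s', h₁, h₂, h₃, h₁.frame⟩

theorem seq (h : Runs P s τ fun s' => Runs P' s' τ' R) : Runs (.seq P P') s (τ + τ') R := by
  obtain ⟨t, s', h₁, h₂, t', s'', h₃, h₄, h₅⟩ := h
  exact ⟨t + t', s'', h₁.seq h₃, by omega, h₅⟩

theorem seqB (h : RunsB B P s fun s' => RunsB B P' s' R) : RunsB B (.seq P P') s R := h.seq

/-- Sequential composition, where the intermediate states are known to satisfy `Q` and to differ
from the initial state only where the first program writes. -/
theorem bind (h : RunsB B P s Q) (h' : ∀ s', Q s' → Frame P s s' → RunsB B P' s' R) :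
    RunsB B (.seq P P') s R :=
  seqB (h.frame.imp fun s' hs => h' s' hs.1 hs.2)

theorem skip (h : Q s) : RunsB B .skip s Q := ⟨1, _, .skip s, le_rfl, h⟩

theorem const {a c : ℕ} (h : Q (s.setReg a c)) : RunsB B (.const a c) s Q :=
  ⟨1, _, .const s a c, le_rfl, h⟩

theorem plus {a b c : ℕ} (h : Q (s.setReg a (s.reg b + s.reg c))) : RunsB B (.plus a b c) s Q :=
  ⟨1, _, .plus s a b c, le_rfl, h⟩

theorem monus {a b c : ℕ} (h : Q (s.setReg a (s.reg b - s.reg c))) :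
    RunsB B (.monus a b c) s Q :=
  ⟨1, _, .monus s a b c, le_rfl, h⟩

theorem half {a b : ℕ} (h : Q (s.setReg a (s.reg b / 2))) : RunsB B (.half a b) s Q :=
  ⟨1, _, .half s a b, le_rfl, h⟩

theorem load {a A b : ℕ} (h : Q (s.setReg a (s.arr A (s.reg b)))) : RunsB B (.load a A b) s Q :=
  ⟨1, _, .load s a A b, le_rfl, h⟩

theorem store {A a b : ℕ} (h : Q (s.setArr A (s.reg a) (s.reg b))) :
    RunsB B (.store A a b) s Q :=
  ⟨1, _, .store s A a b, le_rfl, h⟩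

theorem cond {a : ℕ} (h₁ : s.reg a ≠ 0 → RunsB B P s Q) (h₀ : s.reg a = 0 → RunsB B P' s Q) :
    RunsB B (.cond a P P') s Q := by
  by_cases h : s.reg a = 0
  · obtain ⟨t, s', e, ht, hs⟩ := h₀ h
    exact ⟨_, s', .cond_false P h e, by simp only [Prog.cost]; omega, hs⟩
  · obtain ⟨t, s', e, ht, hs⟩ := h₁ h
    exact ⟨_, s', .cond_true P' h e, by simp only [Prog.cost]; omega, hs⟩

end Runs

/-- `for i := 0, …, reg n - 1 do body`, where `c` is a scratch register, and register `1` is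
supposed to hold `1`. -/
def forTo (i c n : ℕ) (body : Prog) : Prog :=
  .seq (.const i 0) (.seq (.monus c n i)
    (.loop c (.seq body (.seq (.plus i i 1) (.monus c n i)))))

/-- The rule for loops with a loop invariant `Inv`, which must not depend on the two registers of the
loop. -/
theorem Runs.forTo' {i c n : ℕ} {body : Prog} {s₀ : State} {τ m : ℕ} (Inv : ℕ → State → Prop)
    (hone : s₀.reg 1 = 1) (hm : s₀.reg n = m)
    (hd : i ≠ c ∧ n ≠ i ∧ n ≠ c ∧ 1 ≠ i ∧ 1 ≠ c)
    (hw : body.wr i = false ∧ body.wr n = false ∧ body.wr 1 = false)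
    (hInv : ∀ j s v w, Inv j s → Inv j ((s.setReg i v).setReg c w)) (h0 : Inv 0 s₀)
    (hb : ∀ j s, j < m → Frame (forTo i c n body) s₀ s → s.reg i = j → Inv j s →
      Runs body s τ (Inv (j + 1))) :
    Runs (forTo i c n body) s₀ (m * (τ + 3) + 3) (Inv m) := by
  obtain ⟨hic, hni, hnc, h1i, h1c⟩ := hd
  obtain ⟨hwi, hwn, hw1⟩ := hw
  have hfr1 : ∀ s, Frame (RAM.forTo i c n body) s₀ s → s.reg 1 = 1 := fun s h => by
    rw [h.1 1 (by simp [RAM.forTo, Prog.wr, h1i, h1c, hw1]), hone]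
  have hfrn : ∀ s, Frame (RAM.forTo i c n body) s₀ s → s.reg n = m := fun s h => by
    rw [h.1 n (by simp [RAM.forTo, Prog.wr, hni, hnc, hwn]), hm]
  have key : ∀ l j s, l + j = m → s.reg i = j → s.reg c = l → Inv j s →
      Frame (RAM.forTo i c n body) s₀ s →
      Runs (.loop c (.seq body (.seq (.plus i i 1) (.monus c n i)))) s (l * (τ + 3) + 1)
        (Inv m) := by
    intro l
    induction l with
    | zero =>
      intro j s hl hi hc hI hF
      obtain rfl : j = m := by omega
      exact ⟨1, s, Exec.loop_stop _ hc, by omega, hI⟩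
    | succ l ih =>
      intro j s hl hi hc hI hF
      obtain ⟨t, s', he, ht, hI'⟩ := hb j s (by omega) hF hi hI
      have hF' : Frame (RAM.forTo i c n body) s₀ s' := hF.trans (he.frame.mono
        (fun a h => by simp [RAM.forTo, Prog.wr] at h; tauto)
        (fun a h => by simp [RAM.forTo, Prog.wa] at h; tauto))
      have hi' : s'.reg i = j := by rw [he.frame.1 i hwi, hi]
      have hF'' : Frame (RAM.forTo i c n body) s₀
          ((s'.setReg i (s'.reg i + s'.reg 1)).setReg c
            ((s'.setReg i (s'.reg i + s'.reg 1)).reg n -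
              (s'.setReg i (s'.reg i + s'.reg 1)).reg i)) := by
        refine hF'.trans ⟨fun a h => ?_, fun A _ => rfl⟩
        simp [RAM.forTo, Prog.wr] at h
        simp [h]
      obtain ⟨t', s'', he', ht', hQ⟩ := ih (j + 1) _ (by omega)
        (by simp [hic, hi', hfr1 s' hF'])
        (by simp [hi', hfr1 s' hF', hfrn s' hF', hni]; omega)
        (hInv _ _ _ _ hI') hF''
      refine ⟨_, s'', .loop_step (by omega) (he.seq ((Exec.plus _ _ _ _).seq
        (Exec.monus _ _ _ _))) he', ?_, hQ⟩
      have : (l + 1) * (τ + 3) = l * (τ + 3) + (τ + 3) := by ring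
      omega
  obtain ⟨t, s', he, ht, hQ⟩ := key m 0
    ((s₀.setReg i 0).setReg c ((s₀.setReg i 0).reg n - (s₀.setReg i 0).reg i)) (by omega)
    (by simp [hic]) (by simp [hni, hm]) (hInv _ _ _ _ h0)
    ⟨fun a h => by simp [RAM.forTo, Prog.wr] at h; simp [h], fun A _ => rfl⟩
  exact ⟨_, s', (Exec.const _ _ _).seq ((Exec.monus _ _ _ _).seq he), by omega, hQ⟩

theorem Runs.forTo {B i c n : ℕ} {body : Prog} {s₀ : State} {m : ℕ} (Inv : ℕ → State → Prop)
    (hone : s₀.reg 1 = 1) (hm : s₀.reg n = m) (hB : m ≤ B)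
    (hd : i ≠ c ∧ n ≠ i ∧ n ≠ c ∧ 1 ≠ i ∧ 1 ≠ c)
    (hw : body.wr i = false ∧ body.wr n = false ∧ body.wr 1 = false)
    (hInv : ∀ j s v w, Inv j s → Inv j ((s.setReg i v).setReg c w)) (h0 : Inv 0 s₀)
    (hb : ∀ j s, j < m → Frame (forTo i c n body) s₀ s → s.reg i = j → Inv j s →
      RunsB B body s (Inv (j + 1))) :
    RunsB B (RAM.forTo i c n body) s₀ (Inv m) := by
  refine (Runs.forTo' Inv hone hm hd hw hInv h0 hb).mono ?_ fun _ h => h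
  simp only [RAM.forTo, Prog.cost]
  have : m * (body.cost B + 3) ≤ B * (body.cost B + (1 + 1) + 1) := Nat.mul_le_mul hB (by omega)
  omega

/-! ### Arithmetic subroutines -/

/-- `reg d := reg x * reg y`. -/
def mulP (d x y : ℕ) : Prog := .seq (.const d 0) (forTo 30 31 y (.plus d d x))

theorem Runs.mulP {B d x y : ℕ} {s : State} (hone : s.reg 1 = 1) (hy : s.reg y ≤ B)
    (h : d ≠ 30 ∧ d ≠ 31 ∧ d ≠ 1 ∧ d ≠ x ∧ d ≠ y ∧ x ≠ 30 ∧ x ≠ 31 ∧ y ≠ 30 ∧ y ≠ 31) :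
    RunsB B (mulP d x y) s fun s' => s'.reg d = s.reg x * s.reg y := by
  obtain ⟨h1, h2, h3, h4, h5, h6, h7, h8, h9⟩ := h
  refine Runs.seqB (Runs.const ?_)
  refine (Runs.forTo (m := s.reg y) (fun j s' => s'.reg d = s.reg x * j) ?_ ?_ hy ?_ ?_ ?_ ?_ ?_)
  · simp [hone, Ne.symm h3]
  · simp [Ne.symm h5]
  · exact ⟨by decide, h8, h9, by decide, by decide⟩
  · simp [Prog.wr, Ne.symm h1, Ne.symm h5, Ne.symm h3]
  · intro j s' v w hs'
    simp [h1, h2, hs']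
  · simp
  · intro j s' hj hF hi hI
    refine Runs.plus ?_
    have := hF.1 x (by simp [RAM.forTo, Prog.wr, h6, h7, Ne.symm h4])
    simp [Ne.symm h4] at this
    simp [hI, this]
    ring

/-- Division with remainder of `reg x` by `reg y`: the quotient goes to register `32`, the
remainder to register `33`. -/
def divmodP (x y : ℕ) : Prog :=
  .seq (.const 32 0) (.seq (.const 33 0) (forTo 30 31 x
    (.seq (.plus 33 33 1) (.seq (.monus 34 y 33)
      (.cond 34 .skip (.seq (.plus 32 32 1) (.const 33 0)))))))

theorem succ_div_mod_of_lt {j n : ℕ} (h : j % n + 1 < n) :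
    (j + 1) / n = j / n ∧ (j + 1) % n = j % n + 1 := by
  have h1 := Nat.div_add_mod j n
  have hn : 0 < n := by omega
  have : j + 1 = (j % n + 1) + n * (j / n) := by omega
  constructor
  · rw [this, Nat.add_mul_div_left _ _ hn, Nat.div_eq_of_lt h]; simp
  · rw [this, Nat.add_mul_mod_self_left, Nat.mod_eq_of_lt h]

theorem succ_div_mod_of_eq {j n : ℕ} (h : j % n + 1 = n) :
    (j + 1) / n = j / n + 1 ∧ (j + 1) % n = 0 := by
  have h1 := Nat.div_add_mod j n
  have hn : 0 < n := by omega
  have : j + 1 = n * (j / n + 1) := by rw [mul_add]; omega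
  constructor
  · rw [this, Nat.mul_div_cancel_left _ hn]
  · rw [this, Nat.mul_mod_right]

theorem Runs.divmodP {B x y : ℕ} {s : State} (hone : s.reg 1 = 1) (hx : s.reg x ≤ B)
    (hy : 0 < s.reg y) (h : (x < 30 ∨ 34 < x) ∧ (y < 30 ∨ 34 < y)) :
    RunsB B (divmodP x y) s fun s' =>
      s'.reg 32 = s.reg x / s.reg y ∧ s'.reg 33 = s.reg x % s.reg y := by
  obtain ⟨h1, h2⟩ := h
  refine Runs.seqB (Runs.const (Runs.seqB (Runs.const ?_)))
  refine (Runs.forTo (m := s.reg x)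
    (fun j s' => s'.reg 32 = j / s.reg y ∧ s'.reg 33 = j % s.reg y) ?_ ?_ hx ?_ ?_ ?_ ?_ ?_)
  · simp [hone]
  · simp [show x ≠ 33 by omega, show x ≠ 32 by omega]
  · omega
  · simp [Prog.wr]; omega
  · intro j s' v w hs'
    simpa using hs'
  · simp
  · intro j s' hj hF hi ⟨hI, hI'⟩
    have e1 := hF.1 1 rfl
    have e2 := hF.1 y (by simp [RAM.forTo, Prog.wr]; omega)
    simp [hone] at e1
    simp [show y ≠ 33 by omega, show y ≠ 32 by omega] at e2
    have hlt := Nat.mod_lt j hy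
    refine Runs.seqB (Runs.plus (Runs.seqB (Runs.monus (Runs.cond (fun h => Runs.skip ?_)
      fun h => Runs.seqB (Runs.plus (Runs.const ?_))))))
    · simp [e1, e2, hI', show y ≠ 33 by omega] at h
      have := succ_div_mod_of_lt (j := j) (n := s.reg y) (by omega)
      simp [e1, hI, hI', this]
    · simp [e1, e2, hI', show y ≠ 33 by omega] at h
      have := succ_div_mod_of_eq (j := j) (n := s.reg y) (by omega)
      simp [e1, hI, this]

end RAM

/-! ### Tables for the powers of a graph -/

/-- Number of elements at level `d`: an element of level `d + 1` is a pair of elements of level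
`d`, coded as `x * N + y`, so an element of level `d` is a tuple of `2 ^ d` numbers below `n`. -/
def lvl (n : ℕ) : ℕ → ℕ
  | 0 => n
  | d + 1 => lvl n d * lvl n d

/-- The table of the graph with adjacency matrix `a`, restricted to the vertices that are not
adjacent to `v`. In all tables the entry of the pair `x, y` has the index `x * n + y`, and it is `0`
if and only if `x` and `y` are adjacent. -/
def baseTab (n v : ℕ) (a : ℕ → ℕ) (w : ℕ) : ℕ :=
  1 - a w + a (v * n + w / n) + a (v * n + w % n)

/-- From the table `t` of a graph on `N` elements, the table of the graph on the `N * N` pairs of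
elements, in which two pairs are adjacent if both elements of one are adjacent to both elements of
the other. -/
def dblTab (N : ℕ) (t : ℕ → ℕ) (w : ℕ) : ℕ :=
  t ((w / (N * N) / N) * N + w % (N * N) / N) + t ((w / (N * N) / N) * N + w % (N * N) % N) +
  t ((w / (N * N) % N) * N + w % (N * N) / N) + t ((w / (N * N) % N) * N + w % (N * N) % N)

/-- The table at level `d`: two tuples of `2 ^ d` vertices are adjacent if every vertex of one is
adjacent to every vertex of the other. -/
def powTab (n v : ℕ) (a : ℕ → ℕ) : ℕ → ℕ → ℕ
  | 0 => baseTab n v a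
  | d + 1 => dblTab (lvl n d) (powTab n v a d)

theorem lvl_eq (n d : ℕ) : lvl n d = n ^ 2 ^ d := by
  induction d with
  | zero => simp [lvl]
  | succ d ih => rw [lvl, ih, ← pow_add, pow_succ]; congr 1; ring

theorem lvl_pos {n : ℕ} (h : 0 < n) (d : ℕ) : 0 < lvl n d := by
  rw [lvl_eq]; positivity

theorem lvl_mono_right {n : ℕ} (h : 0 < n) : Monotone (lvl n) := by
  refine monotone_nat_of_le_succ fun d => ?_
  rw [lvl]
  exact Nat.le_mul_of_pos_left _ (lvl_pos h d)

namespace RAM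

/-- Computes the base table for the vertex in register `2` in array `5`, and the number of its
elements in register `6`. -/
def baseTabP : Prog :=
  mulP 15 0 0 ⨾ mulP 16 2 0 ⨾
  forTo 35 36 15
    (divmodP 35 0 ⨾ .load 17 0 35 ⨾ .monus 17 1 17 ⨾ .plus 18 16 32 ⨾ .load 18 0 18 ⨾
      .plus 19 16 33 ⨾ .load 19 0 19 ⨾ .plus 17 17 18 ⨾ .plus 17 17 19 ⨾ .store 5 35 17) ⨾
  .plus 6 0 12

/-- Doubling, from array `X` to array `Y`, of a table of a graph on `reg 6` elements. -/
def dblTabP (X Y : ℕ) : Prog :=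
  mulP 15 6 6 ⨾ mulP 16 15 15 ⨾
  forTo 35 36 16
    (divmodP 35 15 ⨾ .plus 20 32 12 ⨾ .plus 21 33 12 ⨾
      divmodP 20 6 ⨾ mulP 22 32 6 ⨾ mulP 23 33 6 ⨾ divmodP 21 6 ⨾
      .plus 24 22 32 ⨾ .load 24 X 24 ⨾ .plus 25 22 33 ⨾ .load 25 X 25 ⨾
      .plus 26 23 32 ⨾ .load 26 X 26 ⨾ .plus 27 23 33 ⨾ .load 27 X 27 ⨾
      .plus 24 24 25 ⨾ .plus 24 24 26 ⨾ .plus 24 24 27 ⨾ .store Y 35 24) ⨾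
  .plus 6 15 12

/-- Computes the table of level `2 * D` for the vertex in register `2` in array `5`, and the number
of its elements in register `6`. -/
def powTabP : ℕ → Prog
  | 0 => baseTabP
  | D + 1 => powTabP D ⨾ dblTabP 5 6 ⨾ dblTabP 6 5

theorem Runs.baseTabP {B : ℕ} {s : State} (h1 : s.reg 1 = 1) (h12 : s.reg 12 = 0)
    (hn : 0 < s.reg 0) (hB : s.reg 0 * s.reg 0 ≤ B) :
    RunsB B baseTabP s fun s' => s'.reg 6 = s.reg 0 ∧
      ∀ w < s.reg 0 * s.reg 0, s'.arr 5 w = baseTab (s.reg 0) (s.reg 2) (s.arr 0) w := by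
  have hB' : s.reg 0 ≤ B := (Nat.le_mul_of_pos_left _ hn).trans hB
  refine Runs.bind (Runs.mulP h1 hB' (by decide)) fun s1 e1 F1 => ?_
  have f1 := F1.1 0 rfl
  refine Runs.bind (Runs.mulP (by rw [F1.1 1 rfl, h1]) (by rwa [f1]) (by decide))
    fun s2 e2 F2 => ?_
  rw [F1.1 2 rfl, f1] at e2
  have g15 : s2.reg 15 = s.reg 0 * s.reg 0 := by rw [F2.1 15 rfl, e1]
  have g1 : s2.reg 1 = 1 := by rw [F2.1 1 rfl, F1.1 1 rfl, h1]
  have g0 : s2.reg 0 = s.reg 0 := by rw [F2.1 0 rfl, f1]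
  have g12 : s2.reg 12 = 0 := by rw [F2.1 12 rfl, F1.1 12 rfl, h12]
  have ga : s2.arr 0 = s.arr 0 := by rw [F2.2 0 rfl, F1.2 0 rfl]
  refine Runs.bind (Runs.forTo (m := s.reg 0 * s.reg 0) (fun j s' => ∀ w < j, s'.arr 5 w =
    baseTab (s.reg 0) (s.reg 2) (s.arr 0) w) g1 g15 hB (by decide) ⟨rfl, rfl, rfl⟩
    (fun j s v w h => by simpa using h) (by simp) ?_) fun s3 e3 F3 => Runs.plus ?_
  · intro j s3 hj F3 hi hI
    have k0 : s3.reg 0 = s.reg 0 := by rw [F3.1 0 rfl, g0]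
    have k1 : s3.reg 1 = 1 := by rw [F3.1 1 rfl, g1]
    refine Runs.bind (Runs.divmodP k1 (by omega) (by omega) (by decide)) fun s4 e4 F4 => ?_
    iterate 8
      refine Runs.seqB ?_
      first | refine Runs.load ?_ | refine Runs.plus ?_ |
      refine Runs.monus ?_
    refine Runs.store ?_
    have l35 : s4.reg 35 = j := by rw [F4.1 35 rfl, hi]
    have l16 : s4.reg 16 = s.reg 2 * s.reg 0 := by rw [F4.1 16 rfl, F3.1 16 rfl, e2]
    have l1 : s4.reg 1 = 1 := by rw [F4.1 1 rfl, k1]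
    have la : s4.arr 0 = s.arr 0 := by rw [F4.2 0 rfl, F3.2 0 rfl, ga]
    have l5 : s4.arr 5 = s3.arr 5 := F4.2 5 rfl
    intro w hw
    rw [hi, k0] at e4
    simp only [State.arr_setReg, State.arr_setArr, if_true, State.reg_setReg, la, l5]
    rcases Nat.lt_succ_iff_lt_or_eq.1 hw with hw | rfl
    · have : w ≠ j := by omega
      simp [l35, this, hI w hw]
    · simp [l35, l16, l1, e4, baseTab]
  · have : s3.reg 12 = 0 := by rw [F3.1 12 rfl, g12]
    have h0 : s3.reg 0 = s.reg 0 := by rw [F3.1 0 rfl, g0]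
    simpa [this, h0] using e3

theorem pair_lt {N x y : ℕ} (hx : x < N) (hy : y < N) : x * N + y < N * N := by
  have : (x + 1) * N ≤ N * N := Nat.mul_le_mul_right _ hx
  rw [add_mul] at this
  omega

theorem Runs.dblTabP {B N X Y : ℕ} {s : State} {t : ℕ → ℕ} (h1 : s.reg 1 = 1) (h12 : s.reg 12 = 0)
    (h6 : s.reg 6 = N) (hn : 0 < N) (hB : (N * N) * (N * N) ≤ B) (hXY : X ≠ Y)
    (ht : ∀ w < N * N, s.arr X w = t w) :
    RunsB B (dblTabP X Y) s fun s' => s'.reg 6 = N * N ∧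
      ∀ w < (N * N) * (N * N), s'.arr Y w = dblTab N t w := by
  have hNN : 0 < N * N := by positivity
  have hB' : N * N ≤ B := (Nat.le_mul_of_pos_left _ hNN).trans hB
  have hB'' : N ≤ B := (Nat.le_mul_of_pos_left _ hn).trans hB'
  refine Runs.bind (Runs.mulP h1 (by rwa [h6]) (by decide)) fun s1 e1 F1 => ?_
  rw [h6] at e1
  refine Runs.bind (Runs.mulP (by rw [F1.1 1 rfl, h1]) (by rwa [e1]) (by decide))
    fun s2 e2 F2 => ?_
  rw [e1] at e2
  have g15 : s2.reg 15 = N * N := by rw [F2.1 15 rfl, e1]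
  have g1 : s2.reg 1 = 1 := by rw [F2.1 1 rfl, F1.1 1 rfl, h1]
  have g6 : s2.reg 6 = N := by rw [F2.1 6 rfl, F1.1 6 rfl, h6]
  have g12 : s2.reg 12 = 0 := by rw [F2.1 12 rfl, F1.1 12 rfl, h12]
  have ga : s2.arr X = s.arr X := by rw [F2.2 X rfl, F1.2 X rfl]
  refine Runs.bind (Runs.forTo (m := (N * N) * (N * N)) (fun j s' => ∀ w < j, s'.arr Y w =
    dblTab N t w) g1 e2 hB (by decide) ⟨rfl, rfl, rfl⟩
    (fun j s v w h => by simpa using h) (by simp) ?_) fun s3 e3 F3 => Runs.plus ?_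
  · intro j s3 hj F3 hi hI
    have hFX : s3.arr X = s.arr X := by
      rw [F3.2 X (by simp [RAM.forTo, Prog.wa, RAM.divmodP, RAM.mulP, hXY]), ga]
    have k1 : s3.reg 1 = 1 := by rw [F3.1 1 rfl, g1]
    have k6 : s3.reg 6 = N := by rw [F3.1 6 rfl, g6]
    have k12 : s3.reg 12 = 0 := by rw [F3.1 12 rfl, g12]
    have k15 : s3.reg 15 = N * N := by rw [F3.1 15 rfl, g15]
    refine Runs.bind (Runs.divmodP k1 (by omega) (by omega) (by decide)) fun s4 e4 F4 => ?_
    rw [hi, k15] at e4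
    have k12 : s4.reg 12 = 0 := by rw [F4.1 12 rfl, k12]
    refine Runs.bind (Runs.plus (Q := fun s' => s'.reg 20 = j / (N * N)) (by simp [k12, e4]))
      fun s5 e5 F5 => ?_
    refine Runs.bind (Runs.plus (Q := fun s' => s'.reg 21 = j % (N * N))
      (by simp [F5.1 12 rfl, F5.1 33 rfl, k12, e4])) fun s6 e6 F6 => ?_
    have hx : j / (N * N) < N * N := Nat.div_lt_of_lt_mul hj
    have hy : j % (N * N) < N * N := Nat.mod_lt _ hNN
    have m1 : s6.reg 1 = 1 := by rw [F6.1 1 rfl, F5.1 1 rfl, F4.1 1 rfl, k1]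
    have m6 : s6.reg 6 = N := by rw [F6.1 6 rfl, F5.1 6 rfl, F4.1 6 rfl, k6]
    have m20 : s6.reg 20 = j / (N * N) := by rw [F6.1 20 rfl, e5]
    refine Runs.bind (Runs.divmodP m1 (by omega) (by omega) (by decide)) fun s7 e7 F7 => ?_
    rw [m20, m6] at e7
    have m1 : s7.reg 1 = 1 := by rw [F7.1 1 rfl, m1]
    have m6 : s7.reg 6 = N := by rw [F7.1 6 rfl, m6]
    refine Runs.bind (Runs.mulP m1 (by omega) (by decide)) fun s8 e8 F8 => ?_
    rw [m6, e7.1] at e8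
    have m1 : s8.reg 1 = 1 := by rw [F8.1 1 rfl, m1]
    have m6 : s8.reg 6 = N := by rw [F8.1 6 rfl, m6]
    refine Runs.bind (Runs.mulP m1 (by omega) (by decide)) fun s9 e9 F9 => ?_
    rw [m6, F8.1 33 rfl, e7.2] at e9
    have m1 : s9.reg 1 = 1 := by rw [F9.1 1 rfl, m1]
    have m6 : s9.reg 6 = N := by rw [F9.1 6 rfl, m6]
    have m21 : s9.reg 21 = j % (N * N) := by
      rw [F9.1 21 rfl, F8.1 21 rfl, F7.1 21 rfl, e6]
    refine Runs.bind (Runs.divmodP m1 (by omega) (by omega) (by decide)) fun s10 e10 F10 => ?_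
    rw [m21, m6] at e10
    iterate 10
      refine Runs.seqB ?_
      first | refine Runs.load ?_ | refine Runs.plus ?_
    refine Runs.seqB (Runs.plus (Runs.store ?_))
    have l35 : s10.reg 35 = j := by
      rw [F10.1 35 rfl, F9.1 35 rfl, F8.1 35 rfl, F7.1 35 rfl, F6.1 35 rfl, F5.1 35 rfl,
        F4.1 35 rfl, hi]
    have l22 : s10.reg 22 = j / (N * N) / N * N := by rw [F10.1 22 rfl, F9.1 22 rfl, e8]
    have l23 : s10.reg 23 = j / (N * N) % N * N := by rw [F10.1 23 rfl, e9]
    have la : ∀ A, s10.arr A = s3.arr A := fun A => by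
      rw [F10.2 A rfl, F9.2 A rfl, F8.2 A rfl, F7.2 A rfl, F6.2 A rfl, F5.2 A rfl, F4.2 A rfl]
    have hx1 : j / (N * N) / N < N := Nat.div_lt_of_lt_mul hx
    have hx0 : j / (N * N) % N < N := Nat.mod_lt _ hn
    have hy1 : j % (N * N) / N < N := Nat.div_lt_of_lt_mul hy
    have hy0 : j % (N * N) % N < N := Nat.mod_lt _ hn
    intro w hw
    simp only [State.arr_setReg, State.arr_setArr, if_true, State.reg_setReg, la]
    rcases Nat.lt_succ_iff_lt_or_eq.1 hw with hw | rfl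
    · have : w ≠ j := by omega
      simp [l35, this, hI w hw]
    · have b1 := ht _ (pair_lt hx1 hy0)
      have b2 := ht _ (pair_lt hx0 hy0)
      rw [Nat.mod_mul_left_mod] at b1 b2
      simp [l35, l22, l23, e10, dblTab, hFX, ht _ (pair_lt hx1 hy1),
        ht _ (pair_lt hx0 hy1), b1, b2]
  · have : s3.reg 12 = 0 := by rw [F3.1 12 rfl, g12]
    have h0 : s3.reg 15 = N * N := by rw [F3.1 15 rfl, g15]
    simpa [this, h0] using e3

/-- Writing to the registers or arrays of `powTabP` does not depend on the level. -/
theorem powTabP_wr (D a : ℕ) (h : a < 15 ∨ 60 ≤ a) (h6 : a ≠ 6) : (powTabP D).wr a = false := by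
  have h0 : (powTabP 0).wr a = false ∧ (dblTabP 5 6).wr a = false ∧
      (dblTabP 6 5).wr a = false := by
    simp only [powTabP, baseTabP, dblTabP, mulP, divmodP, forTo, Prog.wr, Bool.or_eq_false_iff,
      beq_eq_false_iff_ne]
    refine ⟨?_, ?_, ?_⟩ <;> simp <;> omega
  induction D with
  | zero => exact h0.1
  | succ D ih => simp [powTabP, Prog.wr, ih, h0]

theorem powTabP_wa (D A : ℕ) (h : A ≠ 5) (h6 : A ≠ 6) : (powTabP D).wa A = false := by
  have h0 : (powTabP 0).wa A = false ∧ (dblTabP 5 6).wa A = false ∧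
      (dblTabP 6 5).wa A = false := by
    simp [powTabP, baseTabP, dblTabP, mulP, divmodP, forTo, Prog.wa, h, h6]
  induction D with
  | zero => exact h0.1
  | succ D ih => simp [powTabP, Prog.wa, ih, h0]

theorem Runs.powTabP {B n v D : ℕ} {a : ℕ → ℕ} {s : State} (h1 : s.reg 1 = 1)
    (h12 : s.reg 12 = 0) (h0 : s.reg 0 = n) (h2 : s.reg 2 = v) (ha : s.arr 0 = a) (hn : 0 < n)
    (hB : lvl n (2 * D) * lvl n (2 * D) ≤ B) :
    RunsB B (powTabP D) s fun s' => s'.reg 6 = lvl n (2 * D) ∧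
      ∀ w < lvl n (2 * D) * lvl n (2 * D), s'.arr 5 w = powTab n v a (2 * D) w := by
  induction D generalizing B with
  | zero =>
    subst h0 h2 ha
    exact Runs.baseTabP h1 h12 hn hB
  | succ D ih =>
    have hp := lvl_pos hn (2 * D)
    have hp' : lvl n (2 * D + 1) = lvl n (2 * D) * lvl n (2 * D) := rfl
    have hp'' : lvl n (2 * (D + 1)) = lvl n (2 * D + 1) * lvl n (2 * D + 1) := rfl
    have hm := Nat.mul_le_mul (lvl_mono_right hn (show 2 * D + 1 ≤ 2 * (D + 1) by omega))
      (lvl_mono_right hn (show 2 * D + 1 ≤ 2 * (D + 1) by omega))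
    have hm' := Nat.mul_le_mul (lvl_mono_right hn (show 2 * D ≤ 2 * (D + 1) by omega))
      (lvl_mono_right hn (show 2 * D ≤ 2 * (D + 1) by omega))
    refine Runs.bind (ih (hm'.trans hB)) fun s1 ⟨e1, e1'⟩ F1 => ?_
    have f1 : s1.reg 1 = 1 := by rw [F1.1 1 (powTabP_wr _ _ (by decide) (by decide)), h1]
    have f12 : s1.reg 12 = 0 := by rw [F1.1 12 (powTabP_wr _ _ (by decide) (by decide)), h12]
    refine Runs.bind (Runs.dblTabP f1 f12 e1 hp (by rw [← hp']; exact hm.trans hB) (by decide) e1')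
      fun s2 ⟨e2, e2'⟩ F2 => ?_
    exact Runs.dblTabP (by rw [F2.1 1 rfl, f1]) (by rw [F2.1 12 rfl, f12]) e2
      (lvl_pos hn (2 * D + 1)) hB (by decide) e2'

end RAM

/-! ### The value oracle as a program -/

namespace RAM

/-- The number of nonzero cells among the first `N` cells of `X`. -/
def nzCount (N : ℕ) (X : ℕ → ℕ) : ℕ := ∑ x ∈ Finset.range N, if X x ≠ 0 then 1 else 0

/-- Among the nonzero cells of `X` there are two that are adjacent in the graph with table `t`. -/
def HasEdge (N : ℕ) (t X : ℕ → ℕ) : Prop :=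
  ∃ w < N * N, t w = 0 ∧ X (w / N) ≠ 0 ∧ X (w % N) ≠ 0

/-- The value `1 - 2⁻ᶜ`, where `c` is the number of elements of `X`, or `1` if `X` contains an edge
or at least `K` elements, as numerator and denominator. -/
def valFrac (K N : ℕ) (t X : ℕ → ℕ) (r : ℕ × ℕ) : Prop :=
  (K ≤ nzCount N X ∨ HasEdge N t X → r = (1, 1)) ∧
  (¬ (K ≤ nzCount N X ∨ HasEdge N t X) → r = (2 ^ nzCount N X - 1, 2 ^ nzCount N X))

/-- `reg 40` := the number of nonzero cells of array `X`. -/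
def countP (X : ℕ) : Prog :=
  .const 40 0 ⨾ forTo 35 36 6 (.load 17 X 35 ⨾ .cond 17 (.plus 40 40 1) .skip)

/-- Tests whether array `X` contains an edge. -/
def edgeP (X : ℕ) : Prog :=
  .const 41 0 ⨾ mulP 42 6 6 ⨾ forTo 35 36 42 (divmodP 35 6 ⨾ .load 17 5 35 ⨾
    .cond 17 .skip (.load 18 X 32 ⨾
      .cond 18 (.load 19 X 33 ⨾ .cond 19 (.const 41 1) .skip) .skip))

/-- The value of the set in array `X`, with numerator in register `44` and denominator in register
`45`. -/
def valueP (K X : ℕ) : Prog :=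
  countP X ⨾ edgeP X ⨾ .const 43 K ⨾ .monus 43 43 40 ⨾ .const 44 1 ⨾ .const 45 1 ⨾
  .cond 41 .skip (.cond 43 (forTo 30 31 40 (.plus 45 45 45) ⨾ .monus 44 45 1) .skip)

/-- The part of the state that the value oracle relies on: register `1` holds `1`, register `12`
holds `0`, register `6` holds the number `N` of elements, and array `5` holds the table `t`. -/
structure Ready (N : ℕ) (t : ℕ → ℕ) (s : State) : Prop where
  one : s.reg 1 = 1
  zero : s.reg 12 = 0
  size : s.reg 6 = N
  table : ∀ w < N * N, s.arr 5 w = t w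

theorem Ready.of_frame {N : ℕ} {t : ℕ → ℕ} {s s' : State} {P : Prog} (h : Ready N t s)
    (hF : Frame P s s') (h1 : P.wr 1 = false) (h12 : P.wr 12 = false) (h6 : P.wr 6 = false)
    (h5 : P.wa 5 = false) : Ready N t s' :=
  ⟨by rw [hF.1 1 h1, h.one], by rw [hF.1 12 h12, h.zero], by rw [hF.1 6 h6, h.size],
    fun w hw => by rw [hF.2 5 h5, h.table w hw]⟩

variable {B K N X : ℕ} {t : ℕ → ℕ} {s : State}

theorem Runs.countP (h : Ready N t s) (hB : N ≤ B) :
    RunsB B (countP X) s fun s' => s'.reg 40 = nzCount N (s.arr X) := by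
  refine Runs.seqB (Runs.const ?_)
  refine Runs.forTo (m := N) (fun j s' => s'.reg 40 = nzCount j (s.arr X)) (by simp [h.one])
    (by simp [h.size]) hB (by decide) ⟨rfl, rfl, rfl⟩ (fun j s v w h => by simpa using h)
    (by simp [nzCount]) ?_
  intro j s' hj F hi hI
  have e1 : s'.reg 1 = 1 := by rw [F.1 1 rfl]; simp [h.one]
  have eX : s'.arr X = s.arr X := by rw [F.2 X rfl]; simp
  refine Runs.seqB (Runs.load (Runs.cond (fun hc => Runs.plus ?_) fun hc => Runs.skip ?_))
  · simp [eX, hi] at hc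
    simp [hI, e1, nzCount, Finset.sum_range_succ, hc]
  · simp [eX, hi] at hc
    simp [hI, nzCount, Finset.sum_range_succ, hc]

theorem Runs.edgeP (h : Ready N t s) (hB : N * N ≤ B) :
    RunsB B (edgeP X) s fun s' => s'.reg 41 ≠ 0 ↔ HasEdge N t (s.arr X) := by
  have hBN : N ≤ B := (Nat.le_mul_self N).trans hB
  refine Runs.seqB (Runs.const ?_)
  refine Runs.bind (Runs.mulP (by simp [h.one]) (by simp [h.size, hBN]) (by decide))
    fun s1 e1 F1 => ?_
  simp only [State.reg_setReg, show (6 : ℕ) ≠ 41 by decide, if_false, h.size] at e1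
  have R1 : Ready N t s1 := ⟨by rw [F1.1 1 rfl]; simp [h.one], by rw [F1.1 12 rfl]; simp [h.zero],
    by rw [F1.1 6 rfl]; simp [h.size], fun w hw => by rw [F1.2 5 rfl]; simp [h.table w hw]⟩
  have X1 : s1.arr X = s.arr X := by rw [F1.2 X rfl]; simp
  have z1 : s1.reg 41 = 0 := by rw [F1.1 41 rfl]; simp
  refine Runs.forTo (m := N * N) (fun j s' => s'.reg 41 ≠ 0 ↔
    ∃ w < j, t w = 0 ∧ s.arr X (w / N) ≠ 0 ∧ s.arr X (w % N) ≠ 0) R1.one e1 hB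
    (by decide) ⟨rfl, rfl, rfl⟩ (fun j s v w h => by simpa using h) (by simp [z1]) ?_
  intro j s2 hj F2 hi hI
  have R2 := R1.of_frame F2 rfl rfl rfl rfl
  have hN : 0 < N := Nat.pos_of_ne_zero fun h => by simp [h] at hj
  refine Runs.bind (Runs.divmodP R2.one (by omega) (by rwa [R2.size]) (by decide))
    fun s3 e3 F3 => ?_
  have R3 := R2.of_frame F3 rfl rfl rfl rfl
  rw [R2.size, hi] at e3
  have i3 : s3.reg 35 = j := by rw [F3.1 35 rfl, hi]
  have X3 : s3.arr X = s.arr X := by rw [F3.2 X rfl, F2.2 X rfl, X1]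
  have z3 : s3.reg 41 = s2.reg 41 := F3.1 41 rfl
  have step : (∃ w < j + 1, t w = 0 ∧ s.arr X (w / N) ≠ 0 ∧ s.arr X (w % N) ≠ 0) ↔
      s2.reg 41 ≠ 0 ∨ (t j = 0 ∧ s.arr X (j / N) ≠ 0 ∧ s.arr X (j % N) ≠ 0) := by
    rw [hI]
    constructor
    · rintro ⟨w, hw, h⟩
      rcases Nat.lt_succ_iff_lt_or_eq.1 hw with hw | rfl
      · exact .inl ⟨w, hw, h⟩
      · exact .inr h
    · rintro (⟨w, hw, h⟩ | h)
      · exact ⟨w, by omega, h⟩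
      · exact ⟨j, by omega, h⟩
  refine Runs.seqB (Runs.load (Runs.cond (fun hc => Runs.skip ?_) fun hc =>
    Runs.seqB (Runs.load (Runs.cond (fun hd => Runs.seqB (Runs.load (Runs.cond
      (fun he => Runs.const ?_) fun he => Runs.skip ?_))) fun hd => Runs.skip ?_))))
  all_goals
    simp [i3, R3.table j hj] at hc
    rw [step]
    try simp [X3, e3] at hd
    try simp [X3, e3] at he
    simp [*]

theorem Runs.valueP (h : Ready N t s) (hB : N * N ≤ B) :
    RunsB B (valueP K X) s fun s' => valFrac K N t (s.arr X) (s'.reg 44, s'.reg 45) := by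
  have hBN : N ≤ B := (Nat.le_mul_self N).trans hB
  refine Runs.bind (Runs.countP h hBN) fun s1 e1 F1 => ?_
  have R1 := h.of_frame F1 rfl rfl rfl rfl
  refine Runs.bind (Runs.edgeP R1 hB) fun s2 e2 F2 => ?_
  have R2 := R1.of_frame F2 rfl rfl rfl rfl
  rw [F1.2 X rfl] at e2
  have e1' : s2.reg 40 = nzCount N (s.arr X) := by rw [F2.1 40 rfl, e1]
  have hle : nzCount N (s.arr X) ≤ N := by
    refine (Finset.sum_le_card_nsmul _ _ 1 fun x _ => ?_).trans (by simp)
    split_ifs <;> simp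
  refine Runs.seqB (Runs.const (Runs.seqB (Runs.monus (Runs.seqB (Runs.const
    (Runs.seqB (Runs.const (Runs.cond (fun hc => Runs.skip ?_) fun hc => Runs.cond
      (fun hd => ?_) fun hd => Runs.skip ?_))))))))
  · simp [e2] at hc
    simp [valFrac, hc]
  · simp [e1'] at hd
    simp at hc
    have hne : ¬ (K ≤ nzCount N (s.arr X) ∨ HasEdge N t (s.arr X)) := by
      rw [← e2]; omega
    refine Runs.bind (Runs.forTo (m := nzCount N (s.arr X)) (fun j s' => s'.reg 45 = 2 ^ j)
      (by simp [R2.one]) (by simp [e1']) (hle.trans hBN) (by decide) ⟨rfl, rfl, rfl⟩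
      (fun j s v w h => by simpa using h) (by simp) ?_) fun s3 e3 F3 => Runs.monus ?_
    · intro j s3 hj F3 hi hI
      refine Runs.plus ?_
      simp [hI, pow_succ]
      ring
    · have : s3.reg 1 = 1 := by rw [F3.1 1 rfl]; simp [R2.one]
      exact ⟨fun h => absurd h hne, fun _ => by simp [e3, this]⟩
  · simp [e1'] at hd
    have : K ≤ nzCount N (s.arr X) ∨ HasEdge N t (s.arr X) := .inl (by omega)
    exact ⟨fun _ => by simp, fun h => absurd this h⟩

/-! ### Simulation of programs with a value oracle -/

/-- A write to array `A` that is recorded, so that it can be undone: register `14` holds the number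
of recorded writes, and array `7` their addresses. -/
def lstoreP (A a b : ℕ) : Prog := .store A a b ⨾ .store 7 14 a ⨾ .plus 14 14 1

/-- The simulation of a program that queries an oracle. The registers of the program are shifted by
`100` and its arrays by `20`, its writes are recorded, and its queries are replaced by a
computation of the answer. -/
def simP (K : ℕ) : Prog → Prog
  | .skip => .skip
  | .const a c => .const (a + 100) c
  | .plus a b c => .plus (a + 100) (b + 100) (c + 100)
  | .monus a b c => .monus (a + 100) (b + 100) (c + 100)
  | .half a b => .half (a + 100) (b + 100)
  | .load a A b => .load (a + 100) (A + 20) (b + 100)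
  | .store A a b => lstoreP (A + 20) (a + 100) (b + 100)
  | .query a b A => valueP K (A + 20) ⨾ .plus (a + 100) 44 12 ⨾ .plus (b + 100) 45 12
  | .seq P Q => simP K P ⨾ simP K Q
  | .cond a P Q => .cond (a + 100) (simP K P) (simP K Q)
  | .loop a P => .loop (a + 100) (simP K P)

theorem simP_wr (P : Prog) (a : ℕ) (h : a < 14) : (simP K P).wr a = false := by
  induction P <;> simp [simP, Prog.wr, lstoreP, valueP, countP, edgeP, forTo, mulP, divmodP, *] <;>
    omega

theorem simP_wa (P : Prog) (A : ℕ) (h : A < 20) (h7 : A ≠ 7) : (simP K P).wa A = false := by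
  induction P <;> simp [simP, Prog.wa, lstoreP, valueP, countP, edgeP, forTo, mulP, divmodP, *] <;>
    omega

/-- The zone of the state `σ` in which programs are simulated holds the state `s`. -/
structure Holds (s σ : State) : Prop where
  reg : ∀ a, σ.reg (a + 100) = s.reg a
  arr : ∀ A, σ.arr (A + 20) = s.arr A

/-- All nonzero cells of the simulation zone lie in its first `M` arrays, at recorded addresses. -/
def Logged (M : ℕ) (σ : State) : Prop :=
  ∀ A x, σ.arr (A + 20) x ≠ 0 → A < M ∧ ∃ i < σ.reg 14, σ.arr 7 i = x

theorem Logged.congr {M : ℕ} {σ σ' : State} (h : Logged M σ)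
    (ha : ∀ A, σ'.arr (A + 20) = σ.arr (A + 20)) (h7 : σ'.arr 7 = σ.arr 7)
    (h14 : σ'.reg 14 = σ.reg 14) : Logged M σ' := by
  intro A x hx
  rw [ha] at hx
  rw [h7, h14]
  exact h A x hx

theorem Runs.lstoreP {M A a b : ℕ} {σ : State} (h1 : σ.reg 1 = 1) (hA : A < M)
    (hL : Logged M σ) :
    RunsB B (lstoreP (A + 20) a b) σ fun σ' => Logged M σ' ∧ σ'.reg 14 = σ.reg 14 + 1 ∧
      ∀ A', σ'.arr (A' + 20) = (σ.setArr (A + 20) (σ.reg a) (σ.reg b)).arr (A' + 20) := by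
  refine Runs.seqB (Runs.store (Runs.seqB (Runs.store (Runs.plus ⟨?_, ?_, ?_⟩))))
  · intro A' x hx
    have h7 : (7 : ℕ) ≠ A + 20 := by omega
    have h7' : A' + 20 ≠ 7 := by omega
    simp only [State.arr_setReg, State.arr_setArr, State.reg_setArr, State.reg_setReg, h7, h7',
      if_true, if_false, h1, Function.update_apply] at hx ⊢
    by_cases hc : A' = A ∧ x = σ.reg a
    · exact ⟨hc.1 ▸ hA, σ.reg 14, by omega, by simp [hc.2]⟩
    · have hx' : σ.arr (A' + 20) x ≠ 0 := by
        by_cases hA' : A' = A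
        · have : x ≠ σ.reg a := fun h => hc ⟨hA', h⟩
          simpa [hA', this] using hx
        · simpa [hA'] using hx
      obtain ⟨h1, i, hi, h2⟩ := hL A' x hx'
      exact ⟨h1, i, by omega, by rw [if_neg (by omega), h2]⟩
  · simp [h1]
  · intro A'
    have h7' : A' + 20 ≠ 7 := by omega
    simp [h7']

/-- The bound for the number of steps that simulate one step. -/
def stepCost (K B : ℕ) : ℕ := (valueP K 0).cost B + 3

/-- The simulation is correct, and slower by a factor `stepCost K B` at most. -/
theorem Exec.simulate {O : Oracle} {M : ℕ} (hB : N * N ≤ B)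
    (hO : ∀ X, valFrac K N t X ((O X).num, (O X).den)) {P : Prog} {s s' : State} {τ : ℕ}
    (h : Exec O P s τ s') : ∀ σ, (∀ A, P.wa A = true → A < M) → Ready N t σ → Holds s σ →
      Logged M σ → Runs (simP K P) σ (τ * stepCost K B) fun σ' => Ready N t σ' ∧ Holds s' σ' ∧
        Logged M σ' ∧ σ'.reg 14 ≤ σ.reg 14 + τ := by
  have hpos : 3 ≤ stepCost K B := by simp [stepCost]
  have prim : ∀ (P : Prog) (s s' σ σ' : State) (τ : ℕ), Exec noOracle (simP K P) σ 1 σ' →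
      Ready N t σ → Logged M σ → (∀ A, σ'.arr A = σ.arr A) → (∀ a < 100, σ'.reg a = σ.reg a) →
      (∀ a, σ'.reg (a + 100) = s'.reg a) → Holds s σ → (∀ A, s'.arr A = s.arr A) →
      Runs (simP K P) σ (1 * stepCost K B) fun σ' => Ready N t σ' ∧ Holds s' σ' ∧
        Logged M σ' ∧ σ'.reg 14 ≤ σ.reg 14 + 1 := by
    intro P s s' σ σ' τ he R L ha hr hr' H hs
    refine ⟨1, σ', he, by omega, ⟨by rw [hr 1 (by decide), R.one],
      by rw [hr 12 (by decide), R.zero], by rw [hr 6 (by decide), R.size],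
      fun w hw => by rw [ha, R.table w hw]⟩, ⟨hr', fun A => by rw [ha, hs, H.arr]⟩,
      L.congr (fun A => ha _) (ha 7) (hr 14 (by decide)), by rw [hr 14 (by decide)]; omega⟩
  induction h with
  | skip s =>
    intro σ _ R H L
    exact prim .skip s _ σ σ 1 (.skip σ) R L (fun _ => rfl) (fun _ _ => rfl) H.reg H fun _ => rfl
  | const s a c =>
    intro σ _ R H L
    refine prim (.const a c) s _ σ _ 1 (.const σ _ _) R L (fun _ => rfl) ?_ ?_ H fun _ => rfl
    · intro a' h; simp; omega
    · simp [H.reg]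
  | plus s a b c =>
    intro σ _ R H L
    refine prim (.plus a b c) s _ σ _ 1 (.plus σ _ _ _) R L (fun _ => rfl) ?_ ?_ H fun _ => rfl
    · intro a' h; simp; omega
    · simp [H.reg]
  | monus s a b c =>
    intro σ _ R H L
    refine prim (.monus a b c) s _ σ _ 1 (.monus σ _ _ _) R L (fun _ => rfl) ?_ ?_ H fun _ => rfl
    · intro a' h; simp; omega
    · simp [H.reg]
  | half s a b =>
    intro σ _ R H L
    refine prim (.half a b) s _ σ _ 1 (.half σ _ _) R L (fun _ => rfl) ?_ ?_ H fun _ => rfl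
    · intro a' h; simp; omega
    · simp [H.reg]
  | load s a A b =>
    intro σ _ R H L
    refine prim (.load a A b) s _ σ _ 1 (.load σ _ _ _) R L (fun _ => rfl) ?_ ?_ H fun _ => rfl
    · intro a' h; simp; omega
    · simp [H.reg, H.arr]
  | store s A a b =>
    intro σ hM R H L
    refine ((Runs.lstoreP (B := B) R.one (hM A (by simp [Prog.wa])) L).frame).mono
      (by simp only [RAM.lstoreP, Prog.cost]; omega) ?_
    rintro σ' ⟨⟨L', e14, e⟩, F⟩
    refine ⟨R.of_frame F rfl rfl rfl ?_, ⟨fun x => ?_, fun A' => ?_⟩, L', e14.le⟩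
    · simp [RAM.lstoreP, Prog.wa]
    · rw [F.1 _ (by simp [RAM.lstoreP, Prog.wr])]
      simp [H.reg]
    · rw [e]
      simp [H.reg, H.arr]
  | query s a b A =>
    intro σ hM R H L
    refine Runs.mono (Runs.bind (Runs.valueP (K := K) (X := A + 20) R hB) (P' := .seq _ _)
      fun σ' e F => Runs.seqB (Runs.plus (Runs.plus ?_))) (R := _) ?_ fun σ' h => h
    · have R' := R.of_frame F rfl rfl rfl rfl
      have ha : ∀ A, σ'.arr A = σ.arr A := fun A => F.2 A rfl
      have hr : ∀ a, σ'.reg (a + 100) = σ.reg (a + 100) := fun a => F.1 _ (by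
        simp [RAM.valueP, RAM.countP, RAM.edgeP, RAM.forTo, RAM.mulP, RAM.divmodP, Prog.wr])
      have h14 : σ'.reg 14 = σ.reg 14 := F.1 14 rfl
      have hv := hO (s.arr A)
      rw [H.arr] at e
      have hv' : ((O (s.arr A)).num, (O (s.arr A)).den) = (σ'.reg 44, σ'.reg 45) := by
        by_cases hc : K ≤ nzCount N (s.arr A) ∨ HasEdge N t (s.arr A)
        · rw [e.1 hc, hv.1 hc]
        · rw [e.2 hc, hv.2 hc]
      simp only [Prod.mk.injEq] at hv'
      refine ⟨⟨?_, ?_, ?_, ?_⟩, ⟨fun x => ?_, fun A => ?_⟩, ?_, ?_⟩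
      · rw [State.reg_setReg, if_neg (by omega), State.reg_setReg, if_neg (by omega), R'.one]
      · rw [State.reg_setReg, if_neg (by omega), State.reg_setReg, if_neg (by omega), R'.zero]
      · rw [State.reg_setReg, if_neg (by omega), State.reg_setReg, if_neg (by omega), R'.size]
      · exact R'.table
      · simp [hr, H.reg, R'.zero, hv'.1, hv'.2]
      · simp [ha, H.arr]
      · refine L.congr (fun A => by simp [ha]) (by simp [ha]) ?_
        rw [State.reg_setReg, if_neg (by omega), State.reg_setReg, if_neg (by omega), h14]
      · rw [State.reg_setReg, if_neg (by omega), State.reg_setReg, if_neg (by omega), h14]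
        omega
    · have : (RAM.valueP K (A + 20)).cost B = (RAM.valueP K 0).cost B := rfl
      simp only [stepCost, Prog.cost, this]
      omega
  | seq _ _ ih ih' =>
    intro σ hM R H L
    simp only [Prog.wa, Bool.or_eq_true] at hM
    rw [add_mul]
    refine Runs.seq ((ih σ (fun A h => hM A (.inl h)) R H L).imp fun σ' ⟨R', H', L', h'⟩ => ?_)
    refine (ih' σ' (fun A h => hM A (.inr h)) R' H' L').imp fun σ'' ⟨R'', H'', L'', h''⟩ => ?_
    exact ⟨R'', H'', L'', by omega⟩
  | cond_true Q hr _ ih =>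
    intro σ hM R H L
    simp only [Prog.wa, Bool.or_eq_true] at hM
    obtain ⟨τ', σ', e, hτ, R', H', L', h'⟩ := ih σ (fun A h => hM A (.inl h)) R H L
    exact ⟨τ' + 1, σ', .cond_true _ (by rwa [H.reg]) e, by rw [add_mul]; omega, R', H', L',
      by omega⟩
  | cond_false Q hr _ ih =>
    intro σ hM R H L
    simp only [Prog.wa, Bool.or_eq_true] at hM
    obtain ⟨τ', σ', e, hτ, R', H', L', h'⟩ := ih σ (fun A h => hM A (.inr h)) R H L
    exact ⟨τ' + 1, σ', .cond_false _ (by rwa [H.reg]) e, by rw [add_mul]; omega, R', H', L',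
      by omega⟩
  | loop_stop P hr =>
    intro σ hM R H L
    exact ⟨1, σ, Exec.loop_stop _ (by rwa [H.reg]), by omega, R, H, L, by omega⟩
  | loop_step hr _ _ ih ih' =>
    intro σ hM R H L
    obtain ⟨τ', σ', e, hτ, R', H', L', h'⟩ := ih σ hM R H L
    obtain ⟨τ'', σ'', e', hτ', R'', H'', L'', h''⟩ := ih' σ' hM R' H' L'
    exact ⟨_, σ'', .loop_step (by rwa [H.reg]) e e', by rw [add_mul, add_mul]; omega, R'', H'',
      L'', by omega⟩

end RAM

/-! ### One trial -/

namespace RAM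

/-- `reg 7 := (reg 0) ^ e`. -/
def denP : ℕ → Prog
  | 0 => .const 7 1
  | e + 1 => denP e ⨾ mulP 15 7 0 ⨾ .plus 7 15 12

/-- The size of an instance with `N` elements, all of probability `1 / den`, whose function has
values of up to `2 * K - 1` bits. -/
def instSize (K N den : ℕ) : ℕ := N + N * (1 + Nat.size den) + (2 * K - 1)

/-- `reg 28 := instSize K (reg 6) (reg 7)`. -/
def sizeP (K : ℕ) : Prog :=
  .const 26 0 ⨾ .plus 27 7 12 ⨾ forTo 35 36 7 (.cond 27 (.plus 26 26 1) .skip ⨾ .half 27 27) ⨾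
  .plus 26 26 1 ⨾ mulP 28 6 26 ⨾ .plus 28 28 6 ⨾ .const 29 (2 * K - 1) ⨾ .plus 28 28 29

/-- Evaluates the first `j` terms of `T` at the value of register `28`. -/
def polyP (T : Polynomial ℕ) : ℕ → Prog
  | 0 => .const 8 0 ⨾ .const 37 1
  | j + 1 => polyP T j ⨾ .const 38 (T.coeff j) ⨾ mulP 39 38 37 ⨾ .plus 8 8 39 ⨾
      mulP 39 37 28 ⨾ .plus 37 39 12

/-- The scale `U = N * den` in register `9`, and `kk * U` and `U * U` in registers `10`, `11`. -/
def scaleP (kk : ℕ) : Prog := mulP 9 6 7 ⨾ .const 15 kk ⨾ mulP 10 15 9 ⨾ mulP 11 9 9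

/-- Writes the start state of a program that is to be simulated: the number of elements in register
`6`, the reciprocal of the probabilities in register `7`, and a block of random bits, the number of
the block being in register `4` and its length in register `8`. -/
def setupP : Prog :=
  .plus 100 6 12 ⨾ forTo 35 36 6 (lstoreP 20 35 1 ⨾ lstoreP 21 35 7) ⨾ mulP 47 4 8 ⨾
  forTo 35 36 8 (.plus 48 47 35 ⨾ .load 48 2 48 ⨾ lstoreP 22 35 48)

/-- Rounds the output of the simulated program to multiples of `1 / U`, capped at `N / U`. -/
def quantP : Prog :=
  .const 50 0 ⨾ forTo 51 52 6
    (.load 53 23 51 ⨾ .load 54 24 51 ⨾ .const 55 0 ⨾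
      .cond 54 (mulP 56 53 9 ⨾ forTo 35 36 6
        (.plus 57 56 1 ⨾ .monus 57 57 54 ⨾ .cond 57 (.plus 55 55 1) .skip ⨾ .monus 56 56 54))
        .skip ⨾ .store 8 51 55 ⨾ .plus 50 50 55)

/-- The total weight of the adjacent pairs. -/
def totalP : Prog :=
  .const 58 0 ⨾ mulP 42 6 6 ⨾ forTo 51 52 42
    (divmodP 51 6 ⨾ .load 17 5 51 ⨾ .cond 17 .skip
      (.load 18 8 32 ⨾ .load 19 8 33 ⨾ mulP 53 18 19 ⨾ .plus 58 58 53))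

/-- Sets register `13` to `1` if the rounded output is feasible and has many edges. -/
def testP (E : ℕ) : Prog :=
  .const 59 E ⨾ mulP 60 58 59 ⨾ .plus 60 60 1 ⨾ .monus 60 60 11 ⨾ .plus 61 10 1 ⨾ .monus 61 61 50 ⨾
  .cond 60 (.cond 61 (.const 13 1) .skip) .skip

/-- Clears the cell with the address in register `17` in the first `M` arrays of the zone. -/
def clearArrsP : ℕ → Prog
  | 0 => .skip
  | M + 1 => clearArrsP M ⨾ .store (M + 20) 17 12

/-- Clears the first `R` registers of the zone. -/
def clearRegsP : ℕ → Prog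
  | 0 => .skip
  | R + 1 => clearRegsP R ⨾ .const (R + 100) 0

/-- Clears the simulation zone. -/
def clearP (M R : ℕ) : Prog :=
  forTo 35 36 14 (.load 17 7 35 ⨾ clearArrsP M) ⨾ .const 14 0 ⨾ clearRegsP R

/-- The rounded output. -/
def quant (N U num den : ℕ) : ℕ := min N (num * U / den)

/-- The vector with numerators `x` and denominators `y`, rounded to multiples of `1 / U`, where
`U = N * den`, has a sum of at most `kk`, and weight at least `1 / E` on the adjacent pairs. -/
def Passes (N den E kk : ℕ) (t x y : ℕ → ℕ) : Prop :=
  ∑ i ∈ Finset.range N, quant N (N * den) (x i) (y i) ≤ kk * (N * den) ∧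
  (N * den) * (N * den) ≤ E * ∑ w ∈ Finset.range (N * N), if t w = 0 then
    quant N (N * den) (x (w / N)) (y (w / N)) * quant N (N * den) (x (w % N)) (y (w % N)) else 0

variable {B N : ℕ} {t : ℕ → ℕ} {s : State}

theorem denP_wr (e a : ℕ) (h : a ≠ 7 ∧ a ≠ 15 ∧ a ≠ 30 ∧ a ≠ 31) : (denP e).wr a = false := by
  induction e <;> simp [denP, Prog.wr, mulP, forTo, *]

theorem denP_wa (e a : ℕ) : (denP e).wa a = false := by
  induction e <;> simp [denP, Prog.wa, mulP, forTo, *]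

theorem polyP_wr (T : Polynomial ℕ) (j a : ℕ) (h : a ≠ 8 ∧ (a < 30 ∨ 40 ≤ a)) :
    (polyP T j).wr a = false := by
  induction j <;> simp [polyP, Prog.wr, mulP, forTo, *] <;> omega

theorem polyP_wa (T : Polynomial ℕ) (j a : ℕ) : (polyP T j).wa a = false := by
  induction j <;> simp [polyP, Prog.wa, mulP, forTo, *]

theorem clearArrsP_wr (M a : ℕ) : (clearArrsP M).wr a = false := by
  induction M <;> simp [clearArrsP, Prog.wr, *]

theorem clearArrsP_wa (M A : ℕ) (h : A < 20) : (clearArrsP M).wa A = false := by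
  induction M <;> simp [clearArrsP, Prog.wa, *]; omega

theorem clearRegsP_wr (R a : ℕ) (h : a < 100) : (clearRegsP R).wr a = false := by
  induction R <;> simp [clearRegsP, Prog.wr, *]; omega

theorem clearRegsP_wa (R A : ℕ) : (clearRegsP R).wa A = false := by
  induction R <;> simp [clearRegsP, Prog.wa, *]

theorem Runs.denP {n e : ℕ} (h1 : s.reg 1 = 1) (h12 : s.reg 12 = 0) (h0 : s.reg 0 = n)
    (hB : n ≤ B) : RunsB B (denP e) s fun s' => s'.reg 7 = n ^ e := by
  induction e with
  | zero => exact Runs.const (by simp)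
  | succ e ih =>
    refine Runs.bind ih fun s1 e1 F1 => ?_
    have f0 : s1.reg 0 = n := by rw [F1.1 0 (denP_wr _ _ (by decide)), h0]
    refine Runs.bind (Runs.mulP (by rw [F1.1 1 (denP_wr _ _ (by decide)), h1]) (by rwa [f0])
      (by decide)) fun s2 e2 F2 => Runs.plus ?_
    have f12 : s2.reg 12 = 0 := by rw [F2.1 12 rfl, F1.1 12 (denP_wr _ _ (by decide)), h12]
    simp [f12, e2, e1, f0, pow_succ]

theorem size_div_two {c : ℕ} (h : c ≠ 0) : Nat.size (c / 2) + 1 = Nat.size c := by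
  rw [← Nat.div2_val]
  conv_rhs => rw [← Nat.bit_bodd_div2 c]
  rw [Nat.size_bit]
  rwa [Nat.bit_bodd_div2]

theorem Runs.sizeP {K : ℕ} (h : Ready N t s) (hB : s.reg 7 + 1 ≤ B) :
    RunsB B (sizeP K) s fun s' => s'.reg 28 = instSize K N (s.reg 7) := by
  have hsz : Nat.size (s.reg 7) ≤ s.reg 7 := Nat.size_le.2 Nat.lt_two_pow_self
  refine Runs.seqB (Runs.const (Runs.seqB (Runs.plus ?_)))
  refine Runs.bind (Runs.forTo (m := s.reg 7) (fun j s' => s'.reg 27 = s.reg 7 / 2 ^ j ∧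
    s'.reg 26 + Nat.size (s'.reg 27) = Nat.size (s.reg 7)) (by simp [h.one])
    (by simp) (by omega) (by decide) ⟨rfl, rfl, rfl⟩ (fun j s v w h => by simpa using h)
    (by simp [h.zero]) ?_) fun s1 e1 F1 => ?_
  · intro j s1 hj F1 hi ⟨hI, hI'⟩
    have e1 : s1.reg 1 = 1 := by rw [F1.1 1 rfl]; simp [h.one]
    refine Runs.seqB (Runs.cond (fun hc => Runs.plus (Runs.half ?_)) fun hc =>
      Runs.skip (Runs.half ?_))
    · have := size_div_two hc
      simp [e1, hI, pow_succ, Nat.div_div_eq_div_mul]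
      rw [hI] at this hI'
      rw [Nat.div_div_eq_div_mul] at this
      omega
    · rw [hc] at hI hI'
      simp at hI'
      simp [hc, hI', pow_succ, ← Nat.div_div_eq_div_mul, ← hI]
  · have z : s.reg 7 / 2 ^ s.reg 7 = 0 := Nat.div_eq_of_lt Nat.lt_two_pow_self
    rw [e1.1, z] at e1
    have g : s1.reg 26 = Nat.size (s.reg 7) := by simpa using e1.2
    have g1 : s1.reg 1 = 1 := by rw [F1.1 1 rfl]; simp [h.one]
    have g6 : s1.reg 6 = N := by rw [F1.1 6 rfl]; simp [h.size]
    refine Runs.seqB (Runs.plus ?_)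
    refine Runs.bind (Runs.mulP (by simp [g1]) (by simp [g, g1]; omega) (by decide))
      fun s2 e2 F2 => ?_
    have g6' : s2.reg 6 = N := by rw [F2.1 6 rfl]; simp [g6]
    refine Runs.seqB (Runs.plus (Runs.seqB (Runs.const (Runs.plus ?_))))
    simp [e2, g6, g6', g, g1, instSize]
    ring

theorem Runs.polyP {T : Polynomial ℕ} {j x : ℕ} (h1 : s.reg 1 = 1) (h12 : s.reg 12 = 0)
    (hx : s.reg 28 = x) (hB : x ≤ B) (hB' : ∀ i < j, x ^ i ≤ B) :
    RunsB B (polyP T j) s fun s' => s'.reg 37 = x ^ j ∧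
      s'.reg 8 = ∑ i ∈ Finset.range j, T.coeff i * x ^ i := by
  induction j with
  | zero => exact Runs.seqB (Runs.const (Runs.const (by simp)))
  | succ j ih =>
    refine Runs.bind (ih fun i hi => hB' i (by omega)) fun s1 e1 F1 => Runs.seqB (Runs.const ?_)
    have f1 : s1.reg 1 = 1 := by rw [F1.1 1 (polyP_wr _ _ _ (by decide)), h1]
    have f12 : s1.reg 12 = 0 := by rw [F1.1 12 (polyP_wr _ _ _ (by decide)), h12]
    have f28 : s1.reg 28 = x := by rw [F1.1 28 (polyP_wr _ _ _ (by decide)), hx]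
    refine Runs.bind (Runs.mulP (by simp [f1]) (by simpa [e1] using hB' j (by omega))
      (by decide)) fun s2 e2 F2 => Runs.seqB (Runs.plus ?_)
    simp [e1] at e2
    have g1 : s2.reg 1 = 1 := by rw [F2.1 1 rfl]; simp [f1]
    have g8 : s2.reg 8 = s1.reg 8 := by rw [F2.1 8 rfl]; simp
    have g12 : s2.reg 12 = 0 := by rw [F2.1 12 rfl]; simp [f12]
    have g28 : s2.reg 28 = x := by rw [F2.1 28 rfl]; simp [f28]
    have g37 : s2.reg 37 = x ^ j := by rw [F2.1 37 rfl]; simp [e1]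
    refine Runs.bind (Runs.mulP (by simp [g1]) (by simp [g28, hB]) (by decide))
      fun s3 e3 F3 => Runs.plus ?_
    simp [g37, g28] at e3
    have k8 : s3.reg 8 = s1.reg 8 + T.coeff j * x ^ j := by rw [F3.1 8 rfl]; simp [g8, e2]
    have k12 : s3.reg 12 = 0 := by rw [F3.1 12 rfl]; simp [g12]
    simp [k12, e3, k8, e1, Finset.sum_range_succ, pow_succ]

theorem Runs.scaleP {kk : ℕ} (h : Ready N t s) (hB : s.reg 7 ≤ B) (hB' : N * s.reg 7 ≤ B) :
    RunsB B (scaleP kk) s fun s' => s'.reg 9 = N * s.reg 7 ∧ s'.reg 10 = kk * (N * s.reg 7) ∧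
      s'.reg 11 = (N * s.reg 7) * (N * s.reg 7) := by
  refine Runs.bind (Runs.mulP h.one hB (by decide)) fun s1 e1 F1 => Runs.seqB (Runs.const ?_)
  have R1 := h.of_frame F1 rfl rfl rfl rfl
  rw [h.size] at e1
  refine Runs.bind (Runs.mulP (by simp [R1.one]) (by simp [e1, hB']) (by decide))
    fun s2 e2 F2 => ?_
  simp [e1] at e2
  have f9 : s2.reg 9 = N * s.reg 7 := by rw [F2.1 9 rfl]; simp [e1]
  have f1 : s2.reg 1 = 1 := by rw [F2.1 1 rfl]; simp [R1.one]
  refine (Runs.mulP f1 (by rwa [f9]) (by decide)).frame.imp fun s3 ⟨e3, F3⟩ => ?_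
  rw [e3, F3.1 9 rfl, F3.1 10 rfl, f9, e2]
  simp

/-- The simulation zone is clear. -/
structure Clear (s : State) : Prop where
  reg : ∀ a, s.reg (a + 100) = 0
  arr : ∀ A x, s.arr (A + 20) x = 0
  log : s.reg 14 = 0

theorem Runs.setupP {M m den : ℕ} (h : Ready N t s) (hM : 3 ≤ M) (h7 : s.reg 7 = den)
    (h8 : s.reg 8 = m) (hc : Clear s) (hB : N ≤ B) (hB' : m ≤ B) (r : Fin m → Bool)
    (hr : ∀ i : Fin m, s.arr 2 (s.reg 4 * m + i) = (r i).toNat) :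
    RunsB B setupP s fun s' => Logged M s' ∧ s'.reg 14 = 2 * N + m ∧
      Holds (start N (fun i => if i < N then 1 else 0) (fun i => if i < N then den else 0) r) s' := by
  refine Runs.seqB (Runs.plus ?_)
  set s0 := s.setReg 100 (s.reg 6 + s.reg 12) with hs0
  have e100 : ∀ a, s0.reg (a + 100) = if a = 0 then N else 0 := by
    intro a
    simp [hs0, h.size, h.zero, hc.reg]
  have R0 : Ready N t s0 := ⟨by simp [hs0, h.one], by simp [hs0, h.zero], by simp [hs0, h.size],
    h.table⟩
  have L0 : Logged M s0 := fun A x hx => absurd (hc.arr A x) hx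
  refine Runs.bind (Runs.forTo (m := N) (fun j s' => Logged M s' ∧ s'.reg 14 = 2 * j ∧
    ∀ A, s'.arr (A + 20) = fun i => if A = 0 ∧ i < j then 1 else if A = 1 ∧ i < j then den else 0)
    R0.one R0.size hB (by decide) ⟨rfl, rfl, rfl⟩
    (fun j s v w h => ⟨h.1.congr (fun _ => rfl) rfl (by simp), by simpa using h.2⟩)
    ⟨L0, by simp [hs0, hc.log], fun A => by ext x; simpa [hs0] using hc.arr A x⟩ ?_)
    fun s1 ⟨L1, e1, a1⟩ F1 => ?_
  · intro j s1 hj F1 hi ⟨L1, e1, a1⟩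
    have o1 : s1.reg 1 = 1 := by rw [F1.1 1 rfl, R0.one]
    refine Runs.bind (Runs.lstoreP (A := 0) o1 (by omega) L1) fun s2 ⟨L2, e2, a2⟩ F2 => ?_
    refine (Runs.lstoreP (A := 1) (by rw [F2.1 1 rfl, o1]) (by omega) L2).imp
      fun s3 ⟨L3, e3, a3⟩ => ⟨L3, by omega, fun A => ?_⟩
    have f35 : s2.reg 35 = j := by rw [F2.1 35 rfl, hi]
    have f7 : s2.reg 7 = den := by rw [F2.1 7 rfl, F1.1 7 rfl]; simp [hs0, h7]
    rw [a3]
    ext x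
    by_cases hA0 : A = 0
    · subst hA0
      simp [a2, hi, o1, a1, Function.update_apply]
      split_ifs <;> omega
    · by_cases hA1 : A = 1
      · subst hA1
        have := congrFun (a2 1) x
        simp [a1] at this
        simp [f35, f7, Function.update_apply, this]
        split_ifs <;> omega
      · have := congrFun (a2 A) x
        simp [a1, hA0, hA1] at this
        simp [hA0, hA1, this]
  · have R1 := R0.of_frame F1 rfl rfl rfl rfl
    have f8 : s1.reg 8 = m := by rw [F1.1 8 rfl]; simp [hs0, h8]
    refine Runs.bind (Runs.mulP R1.one (by rwa [f8]) (by decide)) fun s2 e2 F2 => ?_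
    have R2 := R1.of_frame F2 rfl rfl rfl rfl
    have g47 : s2.reg 47 = s.reg 4 * m := by rw [e2, f8, F1.1 4 rfl]; simp [hs0]
    have g8 : s2.reg 8 = m := by rw [F2.1 8 rfl, f8]
    have g2 : s2.arr 2 = s.arr 2 := by rw [F2.2 2 rfl, F1.2 2 rfl]; simp [hs0]
    have gz : ∀ a, s2.reg (a + 100) = if a = 0 then N else 0 := fun a => by
      rw [F2.1 _ (by simp [RAM.mulP, RAM.forTo, Prog.wr]),
        F1.1 _ (by simp [RAM.lstoreP, RAM.forTo, Prog.wr]), e100]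
    refine ((Runs.forTo (m := m) (fun j s' => Logged M s' ∧ s'.reg 14 = 2 * N + j ∧
      ∀ A, s'.arr (A + 20) = fun i => if A = 2 then (if i < j then s.arr 2 (s.reg 4 * m + i) else 0)
        else s1.arr (A + 20) i)
      R2.one g8 hB' (by decide) ⟨rfl, rfl, rfl⟩
      (fun j s v w h => ⟨h.1.congr (fun _ => rfl) rfl (by simp), by simpa using h.2⟩)
      ⟨L1.congr (fun A => F2.2 _ (by simp [RAM.mulP, RAM.forTo, Prog.wa])) (F2.2 7 rfl)
        (F2.1 14 rfl), by rw [F2.1 14 rfl, e1]; rfl, fun A => ?_⟩ ?_)).frame.imp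
      fun s3 ⟨⟨L3, e3, a3⟩, F3⟩ => ⟨L3, e3, ⟨fun a => ?_, fun A => ?_⟩⟩
    · rw [F2.2 _ (by simp [RAM.mulP, RAM.forTo, Prog.wa]), a1]
      ext x
      by_cases hA : A = 2 <;> simp [hA]
    · intro j s3 hj F3 hi ⟨L3, e3, a3⟩
      refine Runs.seqB (Runs.plus (Runs.seqB (Runs.load ?_)))
      have o1 : s3.reg 1 = 1 := by rw [F3.1 1 rfl, R2.one]
      have o47 : s3.reg 47 = s.reg 4 * m := by rw [F3.1 47 rfl, g47]
      have o2 : s3.arr 2 = s.arr 2 := by rw [F3.2 2 rfl, g2]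
      refine Runs.imp (Runs.lstoreP (A := 2) (M := M) ?_ (by omega) ?_) ?_
      · simp [o1]
      · exact L3.congr (fun _ => rfl) rfl (by simp)
      rintro s4 ⟨L4, e4, a4⟩
      refine ⟨L4, by simp [e3] at e4; omega, fun A => ?_⟩
      rw [a4]
      ext x
      by_cases hA : A = 2
      · subst hA
        simp [hi, o47, o2, a3, Function.update_apply]
        split_ifs <;> first | rfl | omega | (subst_vars; rfl)
      · simp [hA, a3]
    · rw [F3.1 _ (by simp [RAM.lstoreP, RAM.forTo, Prog.wr]), gz]
      rfl
    · rw [a3]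
      ext x
      rcases A with _ | _ | _ | A
      · simp [a1, RAM.start]
      · simp [a1, RAM.start]
      · simp only [RAM.start, if_true, zero_add]
        by_cases hx : x < m
        · simpa [hx] using hr ⟨x, hx⟩
        · simp [hx]
      · simp [a1, RAM.start]

theorem quant_step {A j den : ℕ} (hd : den ≠ 0) :
    (A - j * den + 1 - den ≠ 0 → min (j + 1) (A / den) = min j (A / den) + 1) ∧
    (A - j * den + 1 - den = 0 → min (j + 1) (A / den) = min j (A / den)) := by
  have hd' : 0 < den := Nat.pos_of_ne_zero hd
  have key : j + 1 ≤ A / den ↔ (j + 1) * den ≤ A := Nat.le_div_iff_mul_le hd'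
  rw [add_mul] at key
  constructor
  · intro h
    have : j + 1 ≤ A / den := key.2 (by omega)
    omega
  · intro h
    have : ¬ (j + 1 ≤ A / den) := fun h' => by have := key.1 h'; omega
    omega

theorem Runs.quantP {U : ℕ} (h : Ready N t s) (h9 : s.reg 9 = U) (hB : N ≤ B) (hB' : U ≤ B) :
    RunsB B quantP s fun s' =>
      (∀ i < N, s'.arr 8 i = quant N U (s.arr 23 i) (s.arr 24 i)) ∧
      s'.reg 50 = ∑ i ∈ Finset.range N, quant N U (s.arr 23 i) (s.arr 24 i) := by
  refine Runs.seqB (Runs.const ?_)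
  refine Runs.forTo (m := N) (fun j s' =>
      (∀ i < j, s'.arr 8 i = quant N U (s.arr 23 i) (s.arr 24 i)) ∧
      s'.reg 50 = ∑ i ∈ Finset.range j, quant N U (s.arr 23 i) (s.arr 24 i))
    (by simp [h.one]) (by simp [h.size]) hB (by decide) ⟨rfl, rfl, rfl⟩
    (fun j s v w h => by simpa using h) (by simp) ?_
  intro j s1 hj F1 hi ⟨hI, hI'⟩
  refine Runs.seqB (Runs.load (Runs.seqB (Runs.load (Runs.seqB (Runs.const ?_)))))
  have x1 : s1.arr 23 = s.arr 23 := by rw [F1.2 23 rfl]; simp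
  have y1 : s1.arr 24 = s.arr 24 := by rw [F1.2 24 rfl]; simp
  have o1 : s1.reg 1 = 1 := by rw [F1.1 1 rfl]; simp [h.one]
  have o6 : s1.reg 6 = N := by rw [F1.1 6 rfl]; simp [h.size]
  have o9 : s1.reg 9 = U := by rw [F1.1 9 rfl]; simp [h9]
  set s2 := ((s1.setReg 53 (s1.arr 23 (s1.reg 51))).setReg 54
    ((s1.setReg 53 (s1.arr 23 (s1.reg 51))).arr 24
      ((s1.setReg 53 (s1.arr 23 (s1.reg 51))).reg 51))).setReg 55 0 with hs2
  have p53 : s2.reg 53 = s.arr 23 j := by simp [hs2, hi, x1]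
  have p54 : s2.reg 54 = s.arr 24 j := by simp [hs2, hi, y1]
  have p55 : s2.reg 55 = 0 := by simp [hs2]
  have p6 : s2.reg 6 = N := by simp [hs2, o6]
  have p9 : s2.reg 9 = U := by simp [hs2, o9]
  have p1 : s2.reg 1 = 1 := by simp [hs2, o1]
  have p51 : s2.reg 51 = j := by simp [hs2, hi]
  have p50 : s2.reg 50 = s1.reg 50 := by simp [hs2]
  have p8 : s2.arr 8 = s1.arr 8 := by simp [hs2]
  refine Runs.bind (Q := fun s' => s'.reg 55 = quant N U (s.arr 23 j) (s.arr 24 j))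
    (Runs.cond (fun hd => ?_) fun hd => Runs.skip ?_) fun s3 e3 F3 => ?_
  · rw [p54] at hd
    refine Runs.bind (Runs.mulP p1 (by rwa [p9]) (by decide)) fun s3 e3 F3 => ?_
    rw [p53, p9] at e3
    refine Runs.imp (Q := fun s' => s'.reg 56 = s.arr 23 j * U - N * s.arr 24 j ∧
        s'.reg 55 = min N (s.arr 23 j * U / s.arr 24 j)) ?_ fun s' h => h.2
    refine Runs.forTo (m := N) (fun i s' =>
        s'.reg 56 = s.arr 23 j * U - i * s.arr 24 j ∧
        s'.reg 55 = min i (s.arr 23 j * U / s.arr 24 j))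
      (by rw [F3.1 1 rfl, p1]) (by rw [F3.1 6 rfl, p6]) hB (by decide) ⟨rfl, rfl, rfl⟩
      (fun j s v w h => by simpa using h) (by simp [e3, F3.1 55 rfl, p55]) ?_
    intro i s4 hi' F4 hi4 ⟨hJ, hJ'⟩
    have q1 : s4.reg 1 = 1 := by rw [F4.1 1 rfl, F3.1 1 rfl, p1]
    have q54 : s4.reg 54 = s.arr 24 j := by rw [F4.1 54 rfl, F3.1 54 rfl, p54]
    have st := quant_step (A := s.arr 23 j * U) (j := i) hd
    refine Runs.seqB (Runs.plus (Runs.seqB (Runs.monus (Runs.seqB (Runs.cond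
      (fun hc => Runs.plus (Runs.monus ?_)) fun hc => Runs.skip (Runs.monus ?_))))))
    · simp [hJ, q1, q54] at hc
      simp [hJ, q1, q54, hJ']
      exact ⟨by rw [add_mul]; omega, (st.1 (by omega)).symm⟩
    · simp [hJ, q1, q54] at hc
      simp [hJ, q54, hJ']
      exact ⟨by rw [add_mul]; omega, (st.2 (by omega)).symm⟩
  · rw [p54] at hd
    simp [quant, hd, p55]
  · refine Runs.seqB (Runs.store (Runs.plus ?_))
    have q51 : s3.reg 51 = j := by rw [F3.1 51 rfl, p51]
    have q50 : s3.reg 50 = s1.reg 50 := by rw [F3.1 50 rfl, p50]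
    have q8 : s3.arr 8 = s1.arr 8 := by rw [F3.2 8 rfl, p8]
    simp only [State.arr_setReg, State.arr_setArr, if_true, State.reg_setReg, State.reg_setArr,
      q51, q50, q8, e3, hI', Finset.sum_range_succ, and_true]
    intro i hij
    rcases Nat.lt_succ_iff_lt_or_eq.1 hij with hij | rfl
    · rw [Function.update_of_ne (by omega), hI i hij]
    · simp

theorem Runs.totalP {u : ℕ → ℕ} (h : Ready N t s) (hu : ∀ i < N, s.arr 8 i = u i)
    (hB : N * N ≤ B) (huB : ∀ i < N, u i ≤ B) :
    RunsB B totalP s fun s' => s'.reg 58 = ∑ w ∈ Finset.range (N * N),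
      if t w = 0 then u (w / N) * u (w % N) else 0 := by
  have hBN : N ≤ B := (Nat.le_mul_self N).trans hB
  refine Runs.seqB (Runs.const ?_)
  refine Runs.bind (Runs.mulP (by simp [h.one]) (by simp [h.size, hBN]) (by decide))
    fun s1 e1 F1 => ?_
  simp only [State.reg_setReg, show (6 : ℕ) ≠ 58 by decide, if_false, h.size] at e1
  have R1 : Ready N t s1 := ⟨by rw [F1.1 1 rfl]; simp [h.one], by rw [F1.1 12 rfl]; simp [h.zero],
    by rw [F1.1 6 rfl]; simp [h.size], fun w hw => by rw [F1.2 5 rfl]; simp [h.table w hw]⟩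
  have u1 : s1.arr 8 = s.arr 8 := by rw [F1.2 8 rfl]; simp
  have z1 : s1.reg 58 = 0 := by rw [F1.1 58 rfl]; simp
  refine Runs.forTo (m := N * N) (fun j s' => s'.reg 58 = ∑ w ∈ Finset.range j,
      if t w = 0 then u (w / N) * u (w % N) else 0) R1.one e1 hB
    (by decide) ⟨rfl, rfl, rfl⟩ (fun j s v w h => by simpa using h) (by simp [z1]) ?_
  intro j s2 hj F2 hi hI
  have R2 := R1.of_frame F2 rfl rfl rfl rfl
  have hN : 0 < N := Nat.pos_of_ne_zero fun h => by simp [h] at hj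
  have hjd : j / N < N := Nat.div_lt_of_lt_mul hj
  have hjm : j % N < N := Nat.mod_lt _ hN
  refine Runs.bind (Runs.divmodP R2.one (by omega) (by rwa [R2.size]) (by decide))
    fun s3 e3 F3 => ?_
  have R3 := R2.of_frame F3 rfl rfl rfl rfl
  rw [R2.size, hi] at e3
  have i3 : s3.reg 51 = j := by rw [F3.1 51 rfl, hi]
  have u3 : s3.arr 8 = s.arr 8 := by rw [F3.2 8 rfl, F2.2 8 rfl, u1]
  have z3 : s3.reg 58 = s2.reg 58 := F3.1 58 rfl
  refine Runs.seqB (Runs.load (Runs.cond (fun hc => Runs.skip ?_) fun hc =>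
    Runs.seqB (Runs.load (Runs.seqB (Runs.load (Runs.bind (Runs.mulP (by simp [R3.one])
      (by simp [e3, u3, hu _ hjm, huB _ hjm]) (by decide)) fun s4 e4 F4 => Runs.plus ?_))))))
  · simp [i3, R3.table j hj] at hc
    simp [z3, hI, Finset.sum_range_succ, hc]
  · simp [i3, R3.table j hj] at hc
    simp [e3, u3, hu _ hjm, hu _ hjd] at e4
    have z4 : s4.reg 58 = s3.reg 58 := by rw [F4.1 58 rfl]; simp
    simp [z4, z3, hI, Finset.sum_range_succ, hc, e4]

open Classical in
theorem Runs.testP {E : ℕ} (h1 : s.reg 1 = 1) (hE : E ≤ B) :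
    RunsB B (testP E) s fun s' => s'.reg 13 =
      if s.reg 50 ≤ s.reg 10 ∧ s.reg 11 ≤ E * s.reg 58 then 1 else s.reg 13 := by
  refine Runs.seqB (Runs.const ?_)
  refine Runs.bind (Runs.mulP (by simp [h1]) (by simp [hE]) (by decide)) fun s1 e1 F1 => ?_
  simp [mul_comm] at e1
  have g : ∀ a, (RAM.mulP 60 58 59).wr a = false → a ≠ 59 → s1.reg a = s.reg a := fun a h h' => by
    rw [F1.1 a h]; simp [h']
  have g1 := g 1 rfl (by decide)
  have g10 := g 10 rfl (by decide)
  have g11 := g 11 rfl (by decide)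
  have g13 := g 13 rfl (by decide)
  have g50 := g 50 rfl (by decide)
  refine Runs.seqB (Runs.plus (Runs.seqB (Runs.monus (Runs.seqB (Runs.plus (Runs.seqB (Runs.monus
    (Runs.cond (fun hc => Runs.cond (fun hd => Runs.const ?_) fun hd => Runs.skip ?_)
      fun hc => Runs.skip ?_))))))))
  · simp [g1, g10, g11, g50, h1, e1] at hc hd
    rw [if_pos ⟨by omega, by omega⟩]
    simp
  · simp [g1, g10, g11, g50, h1, e1] at hc hd
    rw [if_neg (by omega)]
    simp [g13]
  · simp [g1, g11, h1, e1] at hc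
    rw [if_neg (by omega)]
    simp [g13]

theorem Runs.clearArrsP {M : ℕ} (h12 : s.reg 12 = 0) :
    RunsB B (clearArrsP M) s fun s' => ∀ A x, s'.arr (A + 20) x =
      if A < M ∧ x = s.reg 17 then 0 else s.arr (A + 20) x := by
  induction M with
  | zero => exact Runs.skip (by simp)
  | succ M ih =>
    refine Runs.bind ih fun s1 e1 F1 => Runs.store ?_
    have f12 : s1.reg 12 = 0 := by rw [F1.1 12 (clearArrsP_wr _ _), h12]
    have f17 : s1.reg 17 = s.reg 17 := F1.1 17 (clearArrsP_wr _ _)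
    intro A x
    simp only [State.arr_setArr, f12, f17, add_left_inj]
    by_cases hA : A = M
    · subst hA
      by_cases hx : x = s.reg 17 <;> simp [hx, e1]
    · have : A < M + 1 ↔ A < M := by omega
      simp [hA, e1, this]

theorem Runs.clearRegsP {R : ℕ} :
    RunsB B (clearRegsP R) s fun s' => ∀ a, s'.reg (a + 100) =
      if a < R then 0 else s.reg (a + 100) := by
  induction R with
  | zero => exact Runs.skip (by simp)
  | succ R ih =>
    refine Runs.bind ih fun s1 e1 F1 => Runs.const fun a => ?_
    by_cases ha : a = R
    · simp [ha]
    · have : a < R + 1 ↔ a < R := by omega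
      simp [ha, e1, this]

theorem Runs.clearP {M R : ℕ} (h1 : s.reg 1 = 1) (h12 : s.reg 12 = 0) (hL : Logged M s)
    (hR : ∀ a ≥ R, s.reg (a + 100) = 0) (hB : s.reg 14 ≤ B) : RunsB B (clearP M R) s Clear := by
  refine Runs.bind (Runs.forTo (m := s.reg 14) (fun j s' => ∀ A x, s'.arr (A + 20) x ≠ 0 →
    A < M ∧ ∃ i, j ≤ i ∧ i < s.reg 14 ∧ s.arr 7 i = x) h1 rfl hB (by decide)
    ⟨by simp [Prog.wr, clearArrsP_wr], by simp [Prog.wr, clearArrsP_wr],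
      by simp [Prog.wr, clearArrsP_wr]⟩ (fun j s v w h => by simpa using h) ?_ ?_)
    fun s1 e1 F1 => ?_
  · intro A x hx
    obtain ⟨hA, i, hi, h⟩ := hL A x hx
    exact ⟨hA, i, by omega, hi, h⟩
  · intro j s1 hj F1 hi hI
    have f12 : s1.reg 12 = 0 := by
      rw [F1.1 12 (by simp [RAM.forTo, Prog.wr, clearArrsP_wr]), h12]
    have f7 : s1.arr 7 = s.arr 7 :=
      F1.2 7 (by simp [RAM.forTo, Prog.wa, clearArrsP_wa])
    refine Runs.seqB (Runs.load ((Runs.clearArrsP (by simp [f12])).imp fun s2 e2 A x hx => ?_))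
    rw [e2] at hx
    by_cases hc : A < M ∧ x = (s1.setReg 17 (s1.arr 7 (s1.reg 35))).reg 17
    · simp [hc] at hx
    · rw [if_neg hc] at hx
      obtain ⟨hA, i, hij, hi', h⟩ := hI A x hx
      refine ⟨hA, i, ?_, hi', h⟩
      have : i ≠ j := by
        rintro rfl
        exact hc ⟨hA, by simp [hi, f7, h]⟩
      omega
  · refine Runs.seqB (Runs.const ((Runs.clearRegsP).frame.imp fun s2 ⟨e2, F2⟩ =>
      ⟨fun a => ?_, fun A x => ?_, ?_⟩))
    · rw [e2]
      split_ifs with ha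
      · rfl
      · have h100 : a + 100 ≠ 14 := by omega
        simp only [State.reg_setReg, h100, if_false]
        rw [F1.1 _ (by simp [RAM.forTo, Prog.wr, clearArrsP_wr]), hR a (by omega)]
    · rw [F2.2 _ (clearRegsP_wa _ _)]
      by_contra hx
      obtain ⟨_, i, h1, h2, _⟩ := e1 A x hx
      omega
    · rw [F2.1 14 (clearRegsP_wr _ _ (by decide))]
      simp

end RAM

/-! ### The whole program -/

namespace RAM

/-- The part of a trial before the simulation. -/
def preP (D e K kk : ℕ) (T : Polynomial ℕ) : Prog :=
  powTabP D ⨾ denP e ⨾ sizeP K ⨾ polyP T (T.natDegree + 1) ⨾ scaleP kk ⨾ setupP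

/-- The part of a trial after the simulation. -/
def postP (E M R : ℕ) : Prog := quantP ⨾ totalP ⨾ testP E ⨾ clearP M R

/-- A trial: with the vertex `v` in register `2` and the number of a block of random bits in
register `4`, the program `P` is run on the instance of the vertex with the bits of the block, and
register `13` is set to `1` if the output passes the test.

Registers `1` and `12` hold the constants `1` and `0`, registers `0` and `2` to `5` belong to the
outer loops, registers `6` to `11` hold parameters of the trial, register `14` and array `7` the
record of the writes to the simulation zone, which consists of the registers from `100` and the
arrays from `20` on; other registers below `100` are scratch. Array `5` holds the table of the graph,
and array `8` the rounded output. -/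
def trialP (D e K kk E M R : ℕ) (P : Prog) (T : Polynomial ℕ) : Prog :=
  preP D e K kk T ⨾ simP K P ⨾ postP E M R

/-- The state between two trials on the adjacency matrix `a` with the random bits `b`. -/
structure Idle (n : ℕ) (a b : ℕ → ℕ) (s : State) : Prop where
  one : s.reg 1 = 1
  zero : s.reg 12 = 0
  size : s.reg 0 = n
  graph : s.arr 0 = a
  bits : s.arr 2 = b
  clear : Clear s

/-- The bound `B` for the number of rounds suffices for the loops of a trial. -/
structure Suffices (D e K E : ℕ) (T : Polynomial ℕ) (n B : ℕ) : Prop where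
  table : lvl n (2 * D) * lvl n (2 * D) ≤ B
  den : n ^ e + 1 ≤ B
  scale : lvl n (2 * D) * n ^ e ≤ B
  size : instSize K (lvl n (2 * D)) (n ^ e) ≤ B
  powers : ∀ i ≤ T.natDegree, instSize K (lvl n (2 * D)) (n ^ e) ^ i ≤ B
  writes : 2 * lvl n (2 * D) + 2 * T.eval (instSize K (lvl n (2 * D)) (n ^ e)) ≤ B
  factor : E ≤ B
  vertices : n ≤ B

theorem preP_wr (D e K kk : ℕ) (T : Polynomial ℕ) (a : ℕ) (h : a < 6 ∨ a = 12 ∨ a = 13) :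
    (preP D e K kk T).wr a = false := by
  simp only [preP, Prog.wr, powTabP_wr D a (by omega) (by omega), denP_wr e a (by omega),
    polyP_wr T _ a (by omega)]
  rcases h with h | rfl | rfl
  · interval_cases a <;> rfl
  · rfl
  · rfl

theorem preP_wa (D e K kk : ℕ) (T : Polynomial ℕ) (A : ℕ) (h : A = 0 ∨ A = 2 ∨ A = 3) :
    (preP D e K kk T).wa A = false := by
  simp only [preP, Prog.wa, powTabP_wa D A (by omega) (by omega), denP_wa e A, polyP_wa T _ A]
  rcases h with rfl | rfl | rfl <;> rfl

theorem postP_wr (E M R : ℕ) (a : ℕ) (h : a < 6 ∨ a = 12) : (postP E M R).wr a = false := by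
  simp only [postP, clearP, Prog.wr, forTo, clearArrsP_wr, clearRegsP_wr R a (by omega)]
  rcases h with h | rfl
  · interval_cases a <;> rfl
  · rfl

theorem postP_wa (E M R : ℕ) (A : ℕ) (h : A = 0 ∨ A = 2 ∨ A = 3) : (postP E M R).wa A = false := by
  simp only [postP, clearP, Prog.wa, forTo, clearArrsP_wa M A (by omega), clearRegsP_wa R A]
  rcases h with rfl | rfl | rfl <;> rfl

variable {D e K kk E M R n v B : ℕ} {P : Prog} {T : Polynomial ℕ} {a b : ℕ → ℕ} {s : State}

theorem trialP_wr (x : ℕ) (h : x < 6 ∨ x = 12) : (trialP D e K kk E M R P T).wr x = false := by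
  simp only [trialP, Prog.wr, preP_wr D e K kk T x (by omega), postP_wr E M R x (by omega),
    simP_wr P x (by omega), Bool.or_self]

theorem trialP_wa (x : ℕ) (h : x = 0 ∨ x = 2 ∨ x = 3) :
    (trialP D e K kk E M R P T).wa x = false := by
  simp only [trialP, Prog.wa, preP_wa D e K kk T x (by omega), postP_wa E M R x (by omega),
    simP_wa P x (by omega) (by omega), Bool.or_self]

/-- The start state of the simulated program. -/
abbrev simStart (D e n : ℕ) {m : ℕ} (r : Fin m → Bool) : State :=
  start (lvl n (2 * D)) (fun i => if i < lvl n (2 * D) then 1 else 0)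
    (fun i => if i < lvl n (2 * D) then n ^ e else 0) r

/-- The number of random bits for one run. -/
abbrev numBits (D e K n : ℕ) (T : Polynomial ℕ) : ℕ := T.eval (instSize K (lvl n (2 * D)) (n ^ e))

theorem Clear.of_frame {s s' : State} {P : Prog} (h : Clear s) (hF : Frame P s s')
    (hr : ∀ a, P.wr (a + 100) = false) (ha : ∀ A, P.wa (A + 20) = false) (h14 : P.wr 14 = false) :
    Clear s' :=
  ⟨fun a => by rw [hF.1 _ (hr a), h.reg], fun A x => by rw [hF.2 _ (ha A), h.arr],
    by rw [hF.1 14 h14, h.log]⟩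

theorem Runs.preP (hn : 0 < n) (hB : Suffices D e K E T n B) (hI : Idle n a b s)
    (hv : s.reg 2 = v) (hM : 3 ≤ M) (r : Fin (numBits D e K n T) → Bool)
    (hr : ∀ i : Fin (numBits D e K n T), b (s.reg 4 * numBits D e K n T + i) = (r i).toNat) :
    RunsB B (preP D e K kk T) s fun s' => Ready (lvl n (2 * D)) (powTab n v a (2 * D)) s' ∧
      Logged M s' ∧ s'.reg 14 = 2 * lvl n (2 * D) + numBits D e K n T ∧
      Holds (simStart D e n r) s' ∧ s'.reg 9 = lvl n (2 * D) * n ^ e ∧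
      s'.reg 10 = kk * (lvl n (2 * D) * n ^ e) ∧
      s'.reg 11 = (lvl n (2 * D) * n ^ e) * (lvl n (2 * D) * n ^ e) := by
  have hB1 : n ≤ B := hB.vertices
  have hBN : lvl n (2 * D) ≤ B := (Nat.le_mul_self _).trans hB.table
  refine Runs.bind (Runs.powTabP hI.one hI.zero hI.size hv hI.graph hn hB.table)
    fun s1 ⟨e1, t1⟩ F1 => ?_
  have w1 : ∀ x, (x < 15 ∨ 60 ≤ x) → x ≠ 6 → s1.reg x = s.reg x := fun x h h' =>
    F1.1 x (powTabP_wr D x h h')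
  have R1 : Ready (lvl n (2 * D)) (powTab n v a (2 * D)) s1 :=
    ⟨by rw [w1 1 (by decide) (by decide), hI.one],
      by rw [w1 12 (by decide) (by decide), hI.zero], e1, t1⟩
  have C1 := hI.clear.of_frame F1 (fun a => powTabP_wr D _ (by omega) (by omega))
    (fun A => powTabP_wa D _ (by omega) (by omega)) (powTabP_wr D _ (by omega) (by omega))
  refine Runs.bind (Runs.denP R1.one R1.zero (by rw [w1 0 (by decide) (by decide), hI.size]) hB1)
    fun s2 e2 F2 => ?_
  have w2 : ∀ x, x ≠ 7 ∧ x ≠ 15 ∧ x ≠ 30 ∧ x ≠ 31 → s2.reg x = s1.reg x := fun x h =>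
    F2.1 x (denP_wr e x h)
  have R2 := R1.of_frame F2 (denP_wr e _ (by decide)) (denP_wr e _ (by decide))
    (denP_wr e _ (by decide)) (denP_wa e _)
  have C2 := C1.of_frame F2 (fun a => denP_wr e _ (by omega)) (fun A => denP_wa e _)
    (denP_wr e _ (by omega))
  refine Runs.bind (Runs.sizeP R2 (by rw [e2]; exact hB.den)) fun s3 e3 F3 => ?_
  have R3 := R2.of_frame F3 rfl rfl rfl rfl
  have C3 := C2.of_frame F3 (fun a => by simp [RAM.sizeP, Prog.wr, RAM.forTo, RAM.mulP])
    (fun A => by simp [RAM.sizeP, Prog.wa, RAM.forTo, RAM.mulP]) rfl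
  rw [e2] at e3
  refine Runs.bind (Runs.polyP (T := T) (j := T.natDegree + 1) R3.one R3.zero e3 hB.size
    fun i hi => hB.powers i (by omega)) fun s4 ⟨_, e4⟩ F4 => ?_
  rw [← Polynomial.eval_eq_sum_range] at e4
  have R4 := R3.of_frame F4 (polyP_wr T _ _ (by decide)) (polyP_wr T _ _ (by decide))
    (polyP_wr T _ _ (by decide)) (polyP_wa T _ _)
  have C4 := C3.of_frame F4 (fun a => polyP_wr T _ _ (by omega)) (fun A => polyP_wa T _ _)
    (polyP_wr T _ _ (by omega))
  have f7 : s4.reg 7 = n ^ e := by rw [F4.1 7 (polyP_wr T _ _ (by decide)), F3.1 7 rfl, e2]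
  have hd := hB.den
  refine Runs.bind (Runs.scaleP R4 (by omega) (by rw [f7]; exact hB.scale)) fun s5 e5 F5 => ?_
  rw [f7] at e5
  have R5 := R4.of_frame F5 rfl rfl rfl rfl
  have C5 := C4.of_frame F5 (fun a => by simp [RAM.scaleP, Prog.wr, RAM.forTo, RAM.mulP])
    (fun A => by simp [RAM.scaleP, Prog.wa, RAM.forTo, RAM.mulP]) rfl
  have f4 : s5.reg 4 = s.reg 4 := by
    rw [F5.1 4 rfl, F4.1 4 (polyP_wr T _ _ (by decide)), F3.1 4 rfl, w2 4 (by decide),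
      w1 4 (by decide) (by decide)]
  have f2 : s5.arr 2 = b := by
    rw [F5.2 2 rfl, F4.2 2 (polyP_wa T _ _), F3.2 2 rfl, F2.2 2 (denP_wa e _),
      F1.2 2 (powTabP_wa D _ (by decide) (by decide)), hI.bits]
  have hw : 2 * lvl n (2 * D) + 2 * numBits D e K n T ≤ B := hB.writes
  refine (Runs.setupP (den := n ^ e) (m := numBits D e K n T) R5 hM (by rw [F5.1 7 rfl, f7]) (by rw [F5.1 8 rfl, e4]) C5 hBN (by omega) r
    (by rw [f2, f4]; exact hr)).frame.imp fun s6 ⟨⟨L6, e6, H6⟩, F6⟩ => ?_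
  exact ⟨R5.of_frame F6 rfl rfl rfl rfl, L6, e6, H6, by rw [F6.1 9 rfl, e5.1],
    by rw [F6.1 10 rfl, e5.2.1], by rw [F6.1 11 rfl, e5.2.2]⟩

open Classical in
theorem Runs.postP {t : ℕ → ℕ} {s' : State} (hB : Suffices D e K E T n B)
    (hR : Ready (lvl n (2 * D)) t s) (hL : Logged M s)
    (h14 : s.reg 14 ≤ 2 * lvl n (2 * D) + 2 * numBits D e K n T)
    (hH : Holds s' s) (h9 : s.reg 9 = lvl n (2 * D) * n ^ e)
    (h10 : s.reg 10 = kk * (lvl n (2 * D) * n ^ e))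
    (h11 : s.reg 11 = (lvl n (2 * D) * n ^ e) * (lvl n (2 * D) * n ^ e))
    (hs' : ∀ a ≥ R, s'.reg a = 0) :
    RunsB B (postP E M R) s fun σ => Clear σ ∧ σ.reg 13 =
      if Passes (lvl n (2 * D)) (n ^ e) E kk t (s'.arr 3) (s'.arr 4) then 1 else s.reg 13 := by
  have hBN : lvl n (2 * D) ≤ B := (Nat.le_mul_self _).trans hB.table
  refine Runs.bind (Runs.quantP hR h9 hBN hB.scale) fun s1 ⟨e1, q1⟩ F1 => ?_
  rw [hH.arr 3, hH.arr 4] at e1 q1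
  have R1 := hR.of_frame F1 rfl rfl rfl rfl
  refine Runs.bind (Runs.totalP R1 e1 hB.table fun i _ => (min_le_left _ _).trans hBN)
    fun s2 e2 F2 => ?_
  have R2 := R1.of_frame F2 rfl rfl rfl rfl
  refine Runs.bind (Runs.testP R2.one hB.factor) fun s3 e3 F3 => ?_
  have R3 := R2.of_frame F3 rfl rfl rfl rfl
  have f14 : s3.reg 14 = s.reg 14 := by rw [F3.1 14 rfl, F2.1 14 rfl, F1.1 14 rfl]
  have fr : ∀ x, s3.reg (x + 100) = s.reg (x + 100) := fun x => by
    rw [F3.1 _ (by simp [RAM.testP, Prog.wr, RAM.forTo, RAM.mulP]),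
      F2.1 _ (by simp [RAM.totalP, Prog.wr, RAM.forTo, RAM.mulP, RAM.divmodP]),
      F1.1 _ (by simp [RAM.quantP, Prog.wr, RAM.forTo, RAM.mulP])]
  have fa : ∀ A, A ≠ 8 → s3.arr A = s.arr A := fun A hA => by
    rw [F3.2 A rfl, F2.2 A rfl, F1.2 A (by simp [RAM.quantP, Prog.wa, RAM.forTo, RAM.mulP, hA])]
  have L3 : Logged M s3 := hL.congr (fun A => fa _ (by omega)) (fa 7 (by decide)) f14
  refine (Runs.clearP (R := R) R3.one R3.zero L3 (fun x hx => by rw [fr, hH.reg, hs' x hx])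
    (by rw [f14]; exact h14.trans hB.writes)).frame.imp fun s4 ⟨C4, F4⟩ => ⟨C4, ?_⟩
  rw [F4.1 13 (by simp [RAM.clearP, Prog.wr, RAM.forTo, clearArrsP_wr, clearRegsP_wr]), e3,
    F2.1 50 rfl, q1, F2.1 10 rfl, F1.1 10 rfl, h10, F2.1 11 rfl, F1.1 11 rfl, h11, e2,
    F2.1 13 rfl, F1.1 13 rfl]
  exact if_congr Iff.rfl rfl rfl

/-- A bound for the running time of a trial. -/
def trialTime (D e K kk E M R : ℕ) (T : Polynomial ℕ) (n B : ℕ) : ℕ :=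
  (preP D e K kk T).cost B + (numBits D e K n T * stepCost K B + (postP E M R).cost B)

open Classical in
theorem Runs.trialP {O : Oracle} {τ : ℕ} {s' : State} (hn : 0 < n) (hB : Suffices D e K E T n B)
    (hI : Idle n a b s) (hv : s.reg 2 = v) (hM : 3 ≤ M) (hPM : ∀ A, P.wa A = true → A < M)
    (hR : 1 ≤ R) (hPR : ∀ a, P.wr a = true → a < R)
    (hO : ∀ X, valFrac K (lvl n (2 * D)) (powTab n v a (2 * D)) X ((O X).num, (O X).den))
    (r : Fin (numBits D e K n T) → Bool)
    (hr : ∀ i : Fin (numBits D e K n T), b (s.reg 4 * numBits D e K n T + i) = (r i).toNat)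
    (hP : Exec O P (simStart D e n r) τ s') (hτ : τ ≤ numBits D e K n T) :
    Runs (trialP D e K kk E M R P T) s (trialTime D e K kk E M R T n B) fun σ => Idle n a b σ ∧
      σ.reg 13 = if Passes (lvl n (2 * D)) (n ^ e) E kk (powTab n v a (2 * D)) (s'.arr 3) (s'.arr 4)
        then 1 else s.reg 13 := by
  refine Runs.imp (Runs.frame (Q := fun σ => Clear σ ∧ σ.reg 13 =
      if Passes (lvl n (2 * D)) (n ^ e) E kk (powTab n v a (2 * D)) (s'.arr 3) (s'.arr 4)
        then 1 else s.reg 13) ?_) fun σ ⟨⟨C, h13⟩, F⟩ => ⟨⟨by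
    rw [F.1 1 (trialP_wr _ (by decide)), hI.one], by rw [F.1 12 (trialP_wr _ (by decide)), hI.zero],
    by rw [F.1 0 (trialP_wr _ (by decide)), hI.size],
    by rw [F.2 0 (trialP_wa _ (by decide)), hI.graph],
    by rw [F.2 2 (trialP_wa _ (by decide)), hI.bits], C⟩, h13⟩
  refine Runs.seq ((Runs.preP (kk := kk) hn hB hI hv hM r hr).frame.imp
    fun s1 ⟨⟨R1, L1, e1, H1, u1, u2, u3⟩, F1⟩ => ?_)
  have f13 : s1.reg 13 = s.reg 13 := F1.1 13 (preP_wr _ _ _ _ _ _ (by decide))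
  refine Runs.seq (((hP.simulate hB.table hO s1 hPM R1 H1 L1).mono
    (Nat.mul_le_mul_right _ hτ) fun _ h => h).frame.imp fun s2 ⟨⟨R2, H2, L2, e2⟩, F2⟩ => ?_)
  have g : ∀ x < 14, s2.reg x = s1.reg x := fun x hx => F2.1 x (simP_wr P x hx)
  rw [← f13, ← g 13 (by decide)]
  refine Runs.postP hB R2 L2 (by omega) H2 (by rw [g 9 (by decide), u1])
    (by rw [g 10 (by decide), u2]) (by rw [g 11 (by decide), u3]) fun x hx => ?_
  have hw : P.wr x = false := by
    by_contra h
    have := hPR x (by simpa using h)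
    omega
  rw [hP.frame.1 x hw]
  simp [RAM.start, show x ≠ 0 by omega]

/-- The program that finds planted cliques: it returns the vertices for which no trial passes. On
graphs with fewer than `n₀` vertices, where nothing is required, it halts at once. -/
def cliqueP (D e K kk E M R n₀ : ℕ) (P : Prog) (T : Polynomial ℕ) : Prog :=
  .const 1 1 ⨾ .const 15 n₀ ⨾ .plus 16 0 1 ⨾ .monus 15 16 15 ⨾
  .cond 15 (forTo 2 3 0 (.const 13 0 ⨾ forTo 4 5 0 (trialP D e K kk E M R P T) ⨾
    .monus 13 1 13 ⨾ .store 3 2 13)) .skip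

theorem Idle.setReg (h : Idle n a b s) {x y : ℕ} (hx : x ≠ 0 ∧ x ≠ 1 ∧ x ≠ 12 ∧ x ≠ 14 ∧ x < 100) :
    Idle n a b (s.setReg x y) := by
  obtain ⟨h1, h2, h3, h4, h5⟩ := hx
  refine ⟨?_, ?_, ?_, h.graph, h.bits, ⟨fun z => ?_, h.clear.arr, ?_⟩⟩
  · simp [Ne.symm h2, h.one]
  · simp [Ne.symm h3, h.zero]
  · simp [Ne.symm h1, h.size]
  · simp [show z + 100 ≠ x by omega, h.clear.reg]
  · simp [Ne.symm h4, h.clear.log]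

theorem Idle.setArr (h : Idle n a b s) {x y : ℕ} : Idle n a b (s.setArr 3 x y) := by
  refine ⟨h.one, h.zero, h.size, ?_, ?_, ⟨h.clear.reg, fun A z => ?_, h.clear.log⟩⟩
  · simp [h.graph]
  · simp [h.bits]
  · simp [show A + 20 ≠ 3 by omega, h.clear.arr]

/-- A bound for the running time of the whole program. -/
def cliqueTime (D e K kk E M R : ℕ) (T : Polynomial ℕ) (n B : ℕ) : ℕ :=
  n * (1 + (n * (trialTime D e K kk E M R T n B + 3) + 3 + 2) + 3) + 10

open Classical in
/-- The program returns the vertices for which no trial passes. Here `fin v j` is the state in which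
the simulated program halts on the instance of the vertex `v` with the block `j` of random bits. -/
theorem Runs.cliqueP {n₀ : ℕ} {O : ℕ → Oracle} (hn : 0 < n) (hn₀ : n₀ ≤ n)
    (hB : Suffices D e K E T n B) (hM : 3 ≤ M) (hPM : ∀ A, P.wa A = true → A < M)
    (hR : 1 ≤ R) (hPR : ∀ a, P.wr a = true → a < R)
    (hO : ∀ v < n, ∀ X,
      valFrac K (lvl n (2 * D)) (powTab n v a (2 * D)) X ((O v X).num, (O v X).den))
    (r : ℕ → Fin (numBits D e K n T) → Bool)
    (hr : ∀ j < n, ∀ i : Fin (numBits D e K n T), b (j * numBits D e K n T + i) = (r j i).toNat)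
    (fin : ℕ → ℕ → State) (hP : ∀ v < n, ∀ j < n, ∃ τ ≤ numBits D e K n T,
      Exec (O v) P (simStart D e n (r j)) τ (fin v j))
    (h0 : s.reg 0 = n) (hreg : ∀ x ≠ 0, s.reg x = 0) (harr : ∀ A x, s.arr (A + 20) x = 0)
    (ha : s.arr 0 = a) (hb : s.arr 2 = b) :
    Runs (RAM.cliqueP D e K kk E M R n₀ P T) s (cliqueTime D e K kk E M R T n B) fun σ =>
      ∀ v < n, σ.arr 3 v = if ∃ j < n, Passes (lvl n (2 * D)) (n ^ e) E kk (powTab n v a (2 * D))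
        ((fin v j).arr 3) ((fin v j).arr 4) then 0 else 1 := by
  set s1 := (((s.setReg 1 1).setReg 15 n₀).setReg 16 (n + 1)).setReg 15 (n + 1 - n₀) with hs1
  have I1 : Idle n a b s1 := by
    refine ⟨by simp [hs1], by simp [hs1, hreg], by simp [hs1, h0], ha, hb, ?_, harr, ?_⟩
    · intro x; simp [hs1, hreg]
    · simp [hs1, hreg]
  have main : Runs (RAM.forTo 2 3 0 (.const 13 0 ⨾ RAM.forTo 4 5 0 (RAM.trialP D e K kk E M R P T) ⨾
      .monus 13 1 13 ⨾ .store 3 2 13)) s1 (cliqueTime D e K kk E M R T n B - 7) fun σ =>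
      ∀ v < n, σ.arr 3 v = if ∃ j < n, Passes (lvl n (2 * D)) (n ^ e) E kk (powTab n v a (2 * D))
        ((fin v j).arr 3) ((fin v j).arr 4) then 0 else 1 := by
    have tw : ∀ x, x < 6 → (RAM.trialP D e K kk E M R P T).wr x = false := fun x hx =>
      trialP_wr x (.inl hx)
    refine Runs.imp (Q := fun σ => Idle n a b σ ∧ ∀ v < n, σ.arr 3 v =
      if ∃ j < n, Passes (lvl n (2 * D)) (n ^ e) E kk (powTab n v a (2 * D))
        ((fin v j).arr 3) ((fin v j).arr 4) then 0 else 1) ?_ fun _ h => h.2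
    refine (Runs.forTo' (m := n) (fun v' σ => Idle n a b σ ∧ ∀ v < v', σ.arr 3 v =
      if ∃ j < n, Passes (lvl n (2 * D)) (n ^ e) E kk (powTab n v a (2 * D))
        ((fin v j).arr 3) ((fin v j).arr 4) then 0 else 1)
      I1.one I1.size (by decide) ?_ ?_ ⟨I1, by simp⟩ ?_).mono le_rfl fun _ h => h
    · simp [Prog.wr, RAM.forTo, tw]
    · exact fun j s x y h => ⟨(h.1.setReg (by decide)).setReg (by decide), by simpa using h.2⟩
    intro v σ hv F hi ⟨I, hσ⟩
    refine Runs.seq (τ := 1) (Runs.const (B := B) ?_)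
    set σ1 := σ.setReg 13 0 with hσ1
    have J1 : Idle n a b σ1 := I.setReg (by decide)
    refine Runs.seq ((Runs.forTo' (m := n) (fun j σ' => Idle n a b σ' ∧ σ'.reg 13 =
      if ∃ i < j, Passes (lvl n (2 * D)) (n ^ e) E kk (powTab n v a (2 * D))
        ((fin v i).arr 3) ((fin v i).arr 4) then 1 else 0) J1.one J1.size (by decide)
      ⟨tw 4 (by decide), tw 0 (by decide), tw 1 (by decide)⟩
      (fun j s x y h => ⟨(h.1.setReg (by decide)).setReg (by decide), by simpa using h.2⟩)
      ⟨J1, by simp [hσ1]⟩ ?_).frame.imp fun σ2 ⟨⟨J2, e2⟩, F2⟩ => ?_)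
    · intro j σ2 hj F2 hj' ⟨J2, e2⟩
      obtain ⟨τ, hτ, hexec⟩ := hP v hv j hj
      have f2 : σ2.reg 2 = v := by
        rw [F2.1 2 (by simp [RAM.forTo, Prog.wr, tw])]
        simp [hσ1, hi]
      refine (Runs.trialP (kk := kk) hn hB J2 f2 hM hPM hR hPR (hO v hv) (r j)
        (by rw [hj']; exact hr j hj) hexec hτ).imp fun σ3 ⟨J3, e3⟩ => ⟨J3, ?_⟩
      rw [e3, e2]
      by_cases hp : Passes (lvl n (2 * D)) (n ^ e) E kk (powTab n v a (2 * D))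
        ((fin v j).arr 3) ((fin v j).arr 4)
      · rw [if_pos hp, if_pos ⟨j, by omega, hp⟩]
      · rw [if_neg hp]
        refine if_congr ⟨fun ⟨i, hi, h⟩ => ⟨i, by omega, h⟩, fun ⟨i, hi, h⟩ => ⟨i, ?_, h⟩⟩ rfl rfl
        rcases Nat.lt_succ_iff_lt_or_eq.1 hi with hi | rfl
        · exact hi
        · exact absurd h hp
    · have f2 : σ2.reg 2 = v := by
        rw [F2.1 2 (by simp [RAM.forTo, Prog.wr, tw])]
        simp [hσ1, hi]
      have f3 : σ2.arr 3 = σ.arr 3 := by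
        rw [F2.2 3 (by simp [RAM.forTo, Prog.wa, trialP_wa])]
        simp [hσ1]
      refine Runs.seqB (B := B) (Runs.monus (Runs.store ⟨(J2.setReg (by decide)).setArr, ?_⟩))
      intro v' hv'
      simp only [State.arr_setReg, State.arr_setArr, if_true, State.reg_setReg, f2, f3, J2.one, e2,
        show (2 : ℕ) ≠ 13 by decide, if_false]
      rcases Nat.lt_succ_iff_lt_or_eq.1 hv' with hv' | rfl
      · rw [Function.update_of_ne (by omega), hσ v' hv']
      · simp only [Function.update_self]
        split_ifs <;> rfl
  obtain ⟨t, σ, he, ht, hσ⟩ := main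
  have e1 : s1 = ((((s.setReg 1 1).setReg 15 n₀).setReg 16
      (((s.setReg 1 1).setReg 15 n₀).reg 0 + ((s.setReg 1 1).setReg 15 n₀).reg 1)).setReg 15
      ((((s.setReg 1 1).setReg 15 n₀).setReg 16 (n + 1)).reg 16 -
        (((s.setReg 1 1).setReg 15 n₀).setReg 16 (n + 1)).reg 15)) := by
    simp [hs1, h0]
  have key : Exec noOracle (RAM.cliqueP D e K kk E M R n₀ P T) s (1 + (1 + (1 + (1 + (t + 1))))) σ := by
    refine (Exec.const s 1 1).seq ((Exec.const _ 15 n₀).seq ((Exec.plus _ 16 0 1).seq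
      ((Exec.monus _ 15 16 15).seq ?_)))
    have e2 : ((s.setReg 1 1).setReg 15 n₀).reg 0 + ((s.setReg 1 1).setReg 15 n₀).reg 1 = n + 1 := by
      simp [h0]
    rw [e2]
    rw [e2] at e1
    rw [← e1]
    exact Exec.cond_true _ (by simp [hs1]; omega) he
  refine ⟨_, σ, key, ?_, hσ⟩
  have : 7 ≤ cliqueTime D e K kk E M R T n B := by simp [cliqueTime]
  omega

theorem Runs.cliqueP_of_lt {n₀ : ℕ} (hn₀ : s.reg 0 < n₀) :
    Runs (RAM.cliqueP D e K kk E M R n₀ P T) s 6 fun _ => True := by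
  refine ⟨1 + (1 + (1 + (1 + (1 + 1)))), _, (Exec.const s 1 1).seq ((Exec.const _ 15 n₀).seq
    ((Exec.plus _ 16 0 1).seq ((Exec.monus _ 15 16 15).seq
    (Exec.cond_false _ ?_ (Exec.skip _))))), by norm_num, trivial⟩
  simp
  omega

end RAM

/-! ### The submodular function of a graph -/

section SubmodularFunction

variable {ι : Type*} (K : ℕ) (adj : ι → ι → Prop)

/-- The sets on which the function of the graph is not yet `1`: they have less than `K` elements,
and no two of them are adjacent. -/
def Sparse (S : Finset ι) : Prop := S.card < K ∧ ∀ x ∈ S, ∀ y ∈ S, ¬ adj x y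

open Classical in
/-- The function of a graph: `1 - 2⁻ᶜ` on independent sets with `c < K` elements, and `1` on all
other sets. -/
noncomputable def graphFun (S : Finset ι) : ℚ≥0 :=
  if Sparse K adj S then ((2 ^ S.card - 1 : ℕ) : ℚ≥0) / (2 ^ S.card : ℕ) else 1

variable {K adj}

theorem Sparse.mono {S T : Finset ι} (h : Sparse K adj T) (hST : S ⊆ T) : Sparse K adj S :=
  ⟨(Finset.card_le_card hST).trans_lt h.1, fun x hx y hy => h.2 x (hST hx) y (hST hy)⟩

open Classical in
theorem graphFun_coe (S : Finset ι) :
    (graphFun K adj S : ℚ) = 1 - if Sparse K adj S then (1 / 2 : ℚ) ^ S.card else 0 := by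
  unfold graphFun
  split_ifs with h
  · have : 1 ≤ 2 ^ S.card := Nat.one_le_two_pow
    rw [NNRat.coe_div, NNRat.coe_natCast, NNRat.coe_natCast, Nat.cast_sub this]
    push_cast
    have h2 : (2 : ℚ) ^ S.card ≠ 0 := by positivity
    rw [one_div, inv_pow]
    field_simp
  · simp

open Classical in
theorem graphFun_coe_real (S : Finset ι) :
    (graphFun K adj S : ℝ) = 1 - if Sparse K adj S then (1 / 2 : ℝ) ^ S.card else 0 := by
  have := congrArg (fun q : ℚ => (q : ℝ)) (graphFun_coe (K := K) (adj := adj) S)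
  rw [Rat.cast_nnratCast] at this
  rw [this]
  push_cast
  split_ifs <;> simp

theorem graphFun_empty (hK : 0 < K) : graphFun K adj ∅ = 0 := by
  rw [graphFun, if_pos ⟨by simpa, by simp⟩]
  simp

theorem graphFun_mono : Monotone (graphFun K adj) := by
  classical
  intro S T hST
  rw [← NNRat.coe_le_coe, graphFun_coe, graphFun_coe]
  by_cases hT : Sparse K adj T
  · rw [if_pos hT, if_pos (hT.mono hST)]
    have := pow_le_pow_of_le_one (show (0 : ℚ) ≤ 1 / 2 by norm_num) (by norm_num)
      (Finset.card_le_card hST)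
    linarith
  · rw [if_neg hT]
    split_ifs
    · have : (0 : ℚ) ≤ (1 / 2) ^ S.card := by positivity
      linarith
    · rfl

/-- Submodularity: if none of the two sets contains the other, then adding elements to a sparse set
of `c` elements on one side gains at least `2⁻ᶜ / 2`, which is half of what is left to gain. -/
theorem graphFun_submodular [DecidableEq ι] (S T : Finset ι) :
    graphFun K adj (S ∪ T) + graphFun K adj (S ∩ T) ≤ graphFun K adj S + graphFun K adj T := by
  classical
  by_cases hST : S ⊆ T
  · rw [Finset.union_eq_right.2 hST, Finset.inter_eq_left.2 hST, add_comm]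
  by_cases hTS : T ⊆ S
  · rw [Finset.union_eq_left.2 hTS, Finset.inter_eq_right.2 hTS]
  rw [← NNRat.coe_le_coe]
  push_cast
  simp only [graphFun_coe]
  have h1 : S ∩ T ⊆ S := Finset.inter_subset_left
  have h2 : S ∩ T ⊆ T := Finset.inter_subset_right
  -- the cardinalities of `S` and of `T` exceed that of the intersection
  obtain ⟨i, hi⟩ : ∃ i, S.card = (S ∩ T).card + (i + 1) := by
    have : (S ∩ T).card < S.card := Finset.card_lt_card ⟨h1, fun h => hST fun x hx =>
      h2 (h hx)⟩
    exact ⟨S.card - (S ∩ T).card - 1, by omega⟩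
  obtain ⟨j, hj⟩ : ∃ j, T.card = (S ∩ T).card + (j + 1) := by
    have : (S ∩ T).card < T.card := Finset.card_lt_card ⟨h2, fun h => hTS fun x hx =>
      h1 (h hx)⟩
    exact ⟨T.card - (S ∩ T).card - 1, by omega⟩
  have hu : (S ∪ T).card = (S ∩ T).card + (i + 1) + (j + 1) := by
    have := Finset.card_union_add_card_inter S T
    omega
  have p0 : (0 : ℚ) < (1 / 2) ^ (S ∩ T).card := by positivity
  have pi : (1 / 2 : ℚ) ^ (i + 1) ≤ 1 / 2 := by
    simpa using pow_le_pow_of_le_one (show (0 : ℚ) ≤ 1 / 2 by norm_num) (by norm_num)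
      (show 1 ≤ i + 1 by omega)
  have pj : (1 / 2 : ℚ) ^ (j + 1) ≤ 1 / 2 := by
    simpa using pow_le_pow_of_le_one (show (0 : ℚ) ≤ 1 / 2 by norm_num) (by norm_num)
      (show 1 ≤ j + 1 by omega)
  have eu : (1 / 2 : ℚ) ^ (S ∪ T).card = (1 / 2) ^ (S ∩ T).card * (1 / 2) ^ (i + 1) *
      (1 / 2) ^ (j + 1) := by rw [hu, ← pow_add, ← pow_add]
  have es : (1 / 2 : ℚ) ^ S.card = (1 / 2) ^ (S ∩ T).card * (1 / 2) ^ (i + 1) := by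
    rw [hi, ← pow_add]
  have et : (1 / 2 : ℚ) ^ T.card = (1 / 2) ^ (S ∩ T).card * (1 / 2) ^ (j + 1) := by
    rw [hj, ← pow_add]
  rw [eu, es, et]
  generalize (1 / 2 : ℚ) ^ (S ∩ T).card = c at *
  generalize (1 / 2 : ℚ) ^ (i + 1) = x at *
  generalize (1 / 2 : ℚ) ^ (j + 1) = y at *
  have cx : c * x ≤ c * (1 / 2) := by gcongr
  have cy : c * y ≤ c * (1 / 2) := by gcongr
  by_cases hU : Sparse K adj (S ∪ T)
  · rw [if_pos hU, if_pos (hU.mono Finset.subset_union_left),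
      if_pos (hU.mono Finset.subset_union_right),
      if_pos (hU.mono (h1.trans Finset.subset_union_left))]
    have : 0 ≤ c * ((1 - x) * (1 - y)) :=
      mul_nonneg p0.le (mul_nonneg (by linarith) (by linarith))
    nlinarith
  · rw [if_neg hU]
    by_cases hS : Sparse K adj S
    · rw [if_pos hS, if_pos (hS.mono h1)]
      split_ifs <;> linarith
    · rw [if_neg hS]
      by_cases hT : Sparse K adj T
      · rw [if_pos hT, if_pos (hT.mono h2)]
        linarith
      · rw [if_neg hT]
        split_ifs <;> linarith

end SubmodularFunction

theorem NNRat.num_den_div_of_coprime {a b : ℕ} (hb : 0 < b) (h : Nat.Coprime a b) :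
    ((a : ℚ≥0) / (b : ℚ≥0)).num = a ∧ ((a : ℚ≥0) / (b : ℚ≥0)).den = b := by
  have e : ((((a : ℚ≥0) / (b : ℚ≥0) : ℚ≥0)) : ℚ) = ((a : ℤ) : ℚ) / ((b : ℤ) : ℚ) := by simp
  have h1 := Rat.num_div_eq_of_coprime (a := a) (b := b) (by exact_mod_cast hb) (by simpa)
  have h2 := Rat.den_div_eq_of_coprime (a := a) (b := b) (by exact_mod_cast hb) (by simpa)
  rw [← e] at h1 h2
  constructor
  · rw [NNRat.num, h1]; simp
  · rw [NNRat.den]; exact_mod_cast h2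

open Classical in
theorem graphFun_num_den {ι : Type*} {K : ℕ} {adj : ι → ι → Prop} (S : Finset ι) :
    ((graphFun K adj S).num, (graphFun K adj S).den) =
      if Sparse K adj S then (2 ^ S.card - 1, 2 ^ S.card) else (1, 1) := by
  unfold graphFun
  split_ifs with h
  · have hc : Nat.Coprime (2 ^ S.card - 1) (2 ^ S.card) := by
      have h1 : 2 ^ S.card = (2 ^ S.card - 1) + 1 := by
        have : 1 ≤ 2 ^ S.card := Nat.one_le_two_pow
        omega
      conv_rhs => rw [h1]
      simp
    have := NNRat.num_den_div_of_coprime (by positivity) hc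
    rw [this.1, this.2]
  · rfl

theorem bits_graphFun_le {ι : Type*} {K : ℕ} {adj : ι → ι → Prop} (hK : 2 ≤ K) (S : Finset ι) :
    SOSPInstance.bits (graphFun K adj S) ≤ 2 * K - 1 := by
  classical
  have := graphFun_num_den (K := K) (adj := adj) S
  unfold SOSPInstance.bits
  split_ifs at this with h
  · simp only [Prod.mk.injEq] at this
    rw [this.1, this.2, Nat.size_pow]
    have h1 : Nat.size (2 ^ S.card - 1) ≤ S.card := Nat.size_le.2 (by
      have : 1 ≤ 2 ^ S.card := Nat.one_le_two_pow
      omega)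
    have := h.1
    omega
  · simp only [Prod.mk.injEq] at this
    rw [this.1, this.2, Nat.size_one]
    omega

theorem bits_graphFun_eq {ι : Type*} {K : ℕ} {adj : ι → ι → Prop} {S : Finset ι}
    (h : Sparse K adj S) (hS : S.card = K - 1) (hK : 2 ≤ K) :
    SOSPInstance.bits (graphFun K adj S) = 2 * K - 1 := by
  classical
  have := graphFun_num_den (K := K) (adj := adj) S
  unfold SOSPInstance.bits
  rw [if_pos h] at this
  simp only [Prod.mk.injEq] at this
  rw [this.1, this.2, Nat.size_pow, hS]
  have h1 : K - 1 ≤ Nat.size (2 ^ (K - 1) - 1) := by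
    obtain ⟨j, rfl⟩ : ∃ j, K = j + 2 := ⟨K - 2, by omega⟩
    rw [show j + 2 - 1 = j + 1 by omega]
    refine Nat.succ_le_of_lt (Nat.lt_size.2 ?_)
    have : 1 ≤ 2 ^ j := Nat.one_le_two_pow
    rw [pow_succ]
    omega
  have h2 : Nat.size (2 ^ (K - 1) - 1) ≤ K - 1 := Nat.size_le.2 (by
    have : 1 ≤ 2 ^ (K - 1) := Nat.one_le_two_pow
    omega)
  omega

/-! ### The instance of a graph -/

/-- The graph on `N` elements that is described by the table `t`. -/
def tableAdj (N : ℕ) (t : ℕ → ℕ) (x y : Fin N) : Prop := t (x * N + y) = 0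

/-- The instance whose function is that of a graph, with all probabilities equal to `1 / den`. -/
noncomputable def graphInstance {δ : ℝ} {K den : ℕ} (N : ℕ) (adj : Fin N → Fin N → Prop)
    (hK : 0 < K) (hden : 0 < den) (hδ : 1 / (den : ℝ) ≤ δ) : SOSPInstance δ where
  n := N
  f := graphFun K adj
  f_empty := graphFun_empty hK
  f_mono := graphFun_mono
  f_submodular := graphFun_submodular
  p _ := 1 / (den : ℚ≥0)
  p_le_one _ := by
    rw [one_div]
    exact inv_le_one_of_one_le₀ (by exact_mod_cast hden)
  p_le _ := by push_cast; exact hδ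

section GraphInstance

variable {δ : ℝ} {K den N : ℕ} {adj : Fin N → Fin N → Prop} (hK : 0 < K) (hden : 0 < den)
  (hδ : 1 / (den : ℝ) ≤ δ)

/-- The reduction has to know the size of the instance exactly, since it determines the number of
random bits. It does, as the longest value is taken on an independent set of `K - 1` elements. -/
theorem graphInstance_size (hK' : 2 ≤ K)
    (hS : ∃ S : Finset (Fin N), S.card = K - 1 ∧ ∀ x ∈ S, ∀ y ∈ S, ¬ adj x y) :
    (graphInstance N adj hK hden hδ).size = RAM.instSize K N den := by
  obtain ⟨S, hS, hS'⟩ := hS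
  have h1 : SOSPInstance.bits (1 / (den : ℚ≥0)) = 1 + Nat.size den := by
    have := NNRat.num_den_div_of_coprime hden (Nat.coprime_one_left den)
    rw [Nat.cast_one] at this
    rw [SOSPInstance.bits, this.1, this.2, Nat.size_one]
  have h2 : (Finset.univ.sup fun S : Finset (Fin N) => SOSPInstance.bits (graphFun K adj S)) =
      2 * K - 1 := by
    refine le_antisymm (Finset.sup_le fun S _ => bits_graphFun_le hK' S) ?_
    rw [← bits_graphFun_eq ⟨by omega, hS'⟩ hS hK']
    exact Finset.le_sup (f := fun S : Finset (Fin N) => SOSPInstance.bits (graphFun K adj S))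
      (Finset.mem_univ S)
  change N + ∑ i : Fin N, SOSPInstance.bits (1 / (den : ℚ≥0)) + (Finset.univ.sup
    fun S : Finset (Fin N) => SOSPInstance.bits (graphFun K adj S)) = _
  unfold RAM.instSize
  rw [h2, Finset.sum_const, h1]
  simp

theorem graphInstance_start {m : ℕ} (r : Fin m → Bool) :
    (graphInstance N adj hK hden hδ).start r = RAM.start N (fun i => if i < N then 1 else 0)
      (fun i => if i < N then den else 0) r := by
  have := NNRat.num_den_div_of_coprime hden (Nat.coprime_one_left den)
  rw [Nat.cast_one] at this
  change RAM.start N (fun i => if h : i < N then (1 / (den : ℚ≥0)).num else 0)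
    (fun i => if h : i < N then (1 / (den : ℚ≥0)).den else 0) r = _
  rw [this.1, this.2]
  simp

theorem nzCount_eq (N : ℕ) (X : ℕ → ℕ) :
    RAM.nzCount N X = (Finset.univ.filter fun i : Fin N => X i ≠ 0).card := by
  rw [RAM.nzCount, Finset.card_filter, Finset.sum_range]

theorem hasEdge_iff (N : ℕ) (t X : ℕ → ℕ) : RAM.HasEdge N t X ↔
    ∃ x ∈ (Finset.univ.filter fun i : Fin N => X i ≠ 0),
      ∃ y ∈ (Finset.univ.filter fun i : Fin N => X i ≠ 0), tableAdj N t x y := by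
  constructor
  · rintro ⟨w, hw, ht, h1, h2⟩
    have hN : 0 < N := Nat.pos_of_ne_zero fun h => by simp [h] at hw
    refine ⟨⟨w / N, Nat.div_lt_of_lt_mul hw⟩, by simpa using h1, ⟨w % N, Nat.mod_lt _ hN⟩,
      by simpa using h2, ?_⟩
    rw [tableAdj]
    simp only
    rwa [mul_comm, Nat.div_add_mod]
  · rintro ⟨x, hx, y, hy, h⟩
    have hN : 0 < N := x.pos
    refine ⟨x * N + y, RAM.pair_lt x.2 y.2, h, ?_, ?_⟩
    · rw [mul_comm, Nat.mul_add_div hN, Nat.div_eq_of_lt y.2]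
      simpa using hx
    · rw [mul_comm, Nat.mul_add_mod, Nat.mod_eq_of_lt y.2]
      simpa using hy

theorem graphInstance_oracle (t X : ℕ → ℕ) : RAM.valFrac K N t X
    (((graphInstance N (tableAdj N t) hK hden hδ).oracle X).num,
      ((graphInstance N (tableAdj N t) hK hden hδ).oracle X).den) := by
  classical
  have key := graphFun_num_den (K := K) (adj := tableAdj N t)
    (Finset.univ.filter fun i : Fin N => X i ≠ 0)
  have h : (K ≤ RAM.nzCount N X ∨ RAM.HasEdge N t X) ↔
      ¬ Sparse K (tableAdj N t) (Finset.univ.filter fun i : Fin N => X i ≠ 0) := by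
    rw [nzCount_eq, hasEdge_iff, Sparse]
    push Not
    rw [imp_iff_not_or, not_lt]
  refine ⟨fun h' => ?_, fun h' => ?_⟩
  · exact key.trans (if_neg (h.1 h'))
  · rw [h, not_not] at h'
    rw [nzCount_eq]
    exact key.trans (if_pos h')

end GraphInstance

/-! ### Expected values -/

section Expectation

variable {ι : Type*} [Fintype ι] [DecidableEq ι]

/-- The probability that a random set, which contains each `i` independently with probability
`q i`, is equal to `T`. -/
noncomputable def setProb (q : ι → ℝ) (T : Finset ι) : ℝ := (∏ i ∈ T, q i) * ∏ i ∈ Tᶜ, (1 - q i)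

theorem setProb_nonneg {q : ι → ℝ} (h0 : ∀ i, 0 ≤ q i) (h1 : ∀ i, q i ≤ 1) (T : Finset ι) :
    0 ≤ setProb q T :=
  mul_nonneg (Finset.prod_nonneg fun i _ => h0 i)
    (Finset.prod_nonneg fun i _ => sub_nonneg.2 (h1 i))

theorem sum_setProb_mul_prod (q a b : ι → ℝ) :
    ∑ T, setProb q T * ((∏ i ∈ T, a i) * ∏ i ∈ Tᶜ, b i) =
      ∏ i, (q i * a i + (1 - q i) * b i) := by
  rw [Finset.prod_add, Finset.powerset_univ]
  refine Finset.sum_congr rfl fun T _ => ?_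
  rw [setProb, Finset.prod_mul_distrib, Finset.prod_mul_distrib, Finset.compl_eq_univ_sdiff]
  ring

theorem sum_setProb (q : ι → ℝ) : ∑ T, setProb q T = 1 := by
  simpa using sum_setProb_mul_prod q (fun _ => 1) (fun _ => 1)

theorem sum_setProb_mul_half_pow (q : ι → ℝ) :
    ∑ T, setProb q T * (1 / 2) ^ T.card = ∏ i, (1 - q i / 2) := by
  have := sum_setProb_mul_prod q (fun _ => 1 / 2) (fun _ => 1)
  simp only [Finset.prod_const, one_pow, mul_one] at this
  rw [this]
  exact Finset.prod_congr rfl fun i _ => by ring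

theorem sum_setProb_pair (q : ι → ℝ) {x y : ι} (h : x ≠ y) :
    ∑ T, setProb q T * (if x ∈ T ∧ y ∈ T then 1 else 0) = q x * q y := by
  have := sum_setProb_mul_prod q (fun _ => 1) (fun i => if i = x ∨ i = y then 0 else 1)
  have h1 : ∏ i, (q i * 1 + (1 - q i) * if i = x ∨ i = y then 0 else 1) =
      ∏ i, if i = x ∨ i = y then q i else 1 :=
    Finset.prod_congr rfl fun i _ => by split_ifs <;> ring
  have h2 : Finset.univ.filter (fun i => i = x ∨ i = y) = {x, y} := by ext; simp
  rw [h1, ← Finset.prod_filter, h2, Finset.prod_pair h] at this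
  rw [← this]
  refine Finset.sum_congr rfl fun T _ => ?_
  congr 1
  simp only [Finset.prod_const_one, one_mul]
  split_ifs with hT
  · refine (Finset.prod_eq_one fun i hi => if_neg ?_).symm
    rintro (rfl | rfl) <;> simp [hT] at hi
  · rw [not_and_or] at hT
    rcases hT with hT | hT
    · exact (Finset.prod_eq_zero (i := x) (by simpa using hT) (by simp)).symm
    · exact (Finset.prod_eq_zero (i := y) (by simpa using hT) (by simp)).symm

theorem sum_setProb_pairs (q : ι → ℝ) (r : ι → ι → Prop) [DecidableRel r]
    (hr : ∀ x y, r x y → x ≠ y) :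
    ∑ T, setProb q T * (∑ x, ∑ y, if r x y ∧ x ∈ T ∧ y ∈ T then (1 : ℝ) else 0) =
      ∑ x, ∑ y, if r x y then q x * q y else 0 := by
  simp_rw [Finset.mul_sum]
  rw [Finset.sum_comm]
  refine Finset.sum_congr rfl fun x _ => ?_
  rw [Finset.sum_comm]
  refine Finset.sum_congr rfl fun y _ => ?_
  by_cases h : r x y
  · simp only [h, true_and, if_true]
    exact sum_setProb_pair q (hr x y h)
  · simp [h]

variable {K : ℕ} {adj : ι → ι → Prop} [DecidableRel adj] {q : ι → ℝ}

/-- The function of a graph has at most the expected value of `1 - 2⁻ᶜ`, where `c` is the number of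
elements, except for the contribution of the edges. -/
theorem sum_setProb_graphFun_le (h0 : ∀ i, 0 ≤ q i) (h1 : ∀ i, q i ≤ 1)
    (hadj : ∀ x y, adj x y → x ≠ y) :
    ∑ T, setProb q T * (graphFun K adj T : ℝ) ≤ 1 - ∏ i, (1 - q i / 2) + (1 / 2) ^ K +
      ∑ x, ∑ y, if adj x y then q x * q y else 0 := by
  classical
  have key : ∀ T : Finset ι, (graphFun K adj T : ℝ) ≤ 1 - (1 / 2) ^ T.card + (1 / 2) ^ K +
      ∑ x, ∑ y, if adj x y ∧ x ∈ T ∧ y ∈ T then (1 : ℝ) else 0 := by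
    intro T
    rw [graphFun_coe_real]
    have hK : (0 : ℝ) < (1 / 2) ^ K := by positivity
    have hs : (0 : ℝ) ≤ ∑ x, ∑ y, if adj x y ∧ x ∈ T ∧ y ∈ T then (1 : ℝ) else 0 :=
      Finset.sum_nonneg fun x _ => Finset.sum_nonneg fun y _ => by split_ifs <;> norm_num
    split_ifs with hT
    · linarith
    · rw [Sparse, not_and_or] at hT
      rcases hT with hT | hT
      · have := pow_le_pow_of_le_one (show (0 : ℝ) ≤ 1 / 2 by norm_num) (by norm_num) (not_lt.1 hT)
        linarith
      · push Not at hT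
        obtain ⟨x, hx, y, hy, hxy⟩ := hT
        have : (1 : ℝ) ≤ ∑ x, ∑ y, if adj x y ∧ x ∈ T ∧ y ∈ T then (1 : ℝ) else 0 := by
          refine le_trans ?_ (Finset.single_le_sum (fun x _ => Finset.sum_nonneg fun y _ => by
            split_ifs <;> norm_num) (Finset.mem_univ x))
          refine le_trans ?_ (Finset.single_le_sum (fun y _ => by
            split_ifs <;> norm_num) (Finset.mem_univ y))
          rw [if_pos ⟨hxy, hx, hy⟩]
        have : (1 / 2 : ℝ) ^ T.card ≤ 1 := pow_le_one₀ (by norm_num) (by norm_num)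
        linarith
  calc _ ≤ ∑ T, setProb q T * (1 - (1 / 2) ^ T.card + (1 / 2) ^ K +
      ∑ x, ∑ y, if adj x y ∧ x ∈ T ∧ y ∈ T then (1 : ℝ) else 0) :=
        Finset.sum_le_sum fun T _ => mul_le_mul_of_nonneg_left (key T) (setProb_nonneg h0 h1 T)
    _ = _ := by
        simp_rw [mul_add, mul_sub, mul_one]
        rw [Finset.sum_add_distrib, Finset.sum_add_distrib, Finset.sum_sub_distrib,
          sum_setProb_mul_half_pow, ← Finset.sum_mul, sum_setProb, sum_setProb_pairs q adj hadj,
          one_mul]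

/-- The function of a graph has at least the expected value of `min c 2 / 2`, where `c` is the
number of elements, except for the contribution of the pairs that are not adjacent. -/
theorem le_sum_setProb_graphFun (hK : 2 ≤ K) (h0 : ∀ i, 0 ≤ q i) (h1 : ∀ i, q i ≤ 1)
    (hadj : ∀ x y, adj x y → x ≠ y) :
    1 - ∏ i, (1 - q i) - 1 / 2 * ∑ x, q x * ∏ i ∈ {x}ᶜ, (1 - q i) -
      ∑ x, ∑ y, (if x ≠ y ∧ ¬ adj x y then q x * q y else 0) ≤
    ∑ T, setProb q T * (graphFun K adj T : ℝ) := by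
  classical
  have key : ∀ T : Finset ι, 1 - (if T = ∅ then 1 else 0) -
      1 / 2 * (∑ x, if T = {x} then (1 : ℝ) else 0) -
      ∑ x, ∑ y, (if (x ≠ y ∧ ¬ adj x y) ∧ x ∈ T ∧ y ∈ T then (1 : ℝ) else 0) ≤
      (graphFun K adj T : ℝ) := by
    intro T
    have hs : (0 : ℝ) ≤ ∑ x, ∑ y, (if (x ≠ y ∧ ¬ adj x y) ∧ x ∈ T ∧ y ∈ T then (1 : ℝ) else 0) :=
      Finset.sum_nonneg fun x _ => Finset.sum_nonneg fun y _ => by split_ifs <;> norm_num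
    have hs' : (0 : ℝ) ≤ ∑ x, if T = {x} then (1 : ℝ) else 0 :=
      Finset.sum_nonneg fun x _ => by split_ifs <;> norm_num
    have hf : (0 : ℝ) ≤ (graphFun K adj T : ℝ) := by positivity
    rcases Nat.lt_or_ge T.card 2 with hc | hc
    · interval_cases h : T.card
      · rw [Finset.card_eq_zero] at h
        rw [if_pos h]
        linarith
      · obtain ⟨x, rfl⟩ := Finset.card_eq_one.1 h
        have h1 : (1 : ℝ) ≤ ∑ z, if ({x} : Finset ι) = {z} then (1 : ℝ) else 0 := by
          refine le_trans ?_ (Finset.single_le_sum (fun y _ => by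
            split_ifs <;> norm_num) (Finset.mem_univ x))
          simp
        have h2 : (graphFun K adj {x} : ℝ) = 1 / 2 := by
          rw [graphFun_coe_real, if_pos]
          · norm_num
          · refine ⟨by simp; omega, ?_⟩
            simp only [Finset.mem_singleton, forall_eq]
            exact fun h => hadj x x h rfl
        rw [h2, if_neg (by simp)]
        linarith
    · have hne : T ≠ ∅ := fun h => by simp [h] at hc
      rw [if_neg hne]
      by_cases hT : ∃ x ∈ T, ∃ y ∈ T, adj x y
      · rw [graphFun_coe_real, if_neg]
        · linarith
        · rintro ⟨_, h⟩
          obtain ⟨x, hx, y, hy, hxy⟩ := hT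
          exact h x hx y hy hxy
      · push Not at hT
        obtain ⟨x, hx, y, hy, hxy⟩ := Finset.one_lt_card.1 hc
        have : (1 : ℝ) ≤
            ∑ x, ∑ y, (if (x ≠ y ∧ ¬ adj x y) ∧ x ∈ T ∧ y ∈ T then (1 : ℝ) else 0) := by
          refine le_trans ?_ (Finset.single_le_sum (fun x _ => Finset.sum_nonneg fun y _ => by
            split_ifs <;> norm_num) (Finset.mem_univ x))
          refine le_trans ?_ (Finset.single_le_sum (fun y _ => by
            split_ifs <;> norm_num) (Finset.mem_univ y))
          rw [if_pos ⟨⟨hxy, hT x hx y hy⟩, hx, hy⟩]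
        linarith
  calc _ = ∑ T, setProb q T * (1 - (if T = ∅ then 1 else 0) -
      1 / 2 * (∑ x, if T = {x} then (1 : ℝ) else 0) -
      ∑ x, ∑ y, (if (x ≠ y ∧ ¬ adj x y) ∧ x ∈ T ∧ y ∈ T then (1 : ℝ) else 0)) := by
        simp_rw [mul_sub, mul_one]
        rw [Finset.sum_sub_distrib, Finset.sum_sub_distrib, Finset.sum_sub_distrib, sum_setProb,
          sum_setProb_pairs q (fun x y => x ≠ y ∧ ¬ adj x y) fun x y h => h.1]
        congr 2
        · congr 1
          simp [setProb]
        · simp_rw [Finset.mul_sum]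
          rw [Finset.sum_comm]
          refine Finset.sum_congr rfl fun x _ => ?_
          rw [Finset.sum_eq_single {x} (fun T _ hT => by simp [hT]) (by simp)]
          simp [setProb]
          ring
    _ ≤ _ := Finset.sum_le_sum fun T _ => mul_le_mul_of_nonneg_left (key T) (setProb_nonneg h0 h1 T)

/-- The value of the uniform vector on a set `D` of elements that are mostly adjacent. -/
theorem le_sum_setProb_graphFun_indicator {D : Finset ι} {c : ℝ} (hK : 2 ≤ K) (h0 : 0 ≤ c)
    (h1 : c ≤ 1) (hadj : ∀ x y, adj x y → x ≠ y) :
    1 - (1 - c) ^ D.card - 1 / 2 * (D.card * c * (1 - c) ^ (D.card - 1)) -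
      c ^ 2 * ((D ×ˢ D).filter fun z => ¬ adj z.1 z.2).card ≤
    ∑ T, setProb (fun i => if i ∈ D then c else 0) T * (graphFun K adj T : ℝ) := by
  refine le_trans ?_ (le_sum_setProb_graphFun hK (fun i => by split_ifs <;> simp [h0])
    (fun i => by split_ifs <;> simp [h1]) hadj)
  have e1 : ∏ i, (1 - if i ∈ D then c else 0) = (1 - c) ^ D.card := by
    rw [← Finset.prod_const, ← Finset.prod_subset (Finset.subset_univ D)
      (fun i _ hi => by simp [hi])]
    exact Finset.prod_congr rfl fun i hi => by simp [hi]
  have e2 : ∑ x, (if x ∈ D then c else 0) * ∏ i ∈ {x}ᶜ, (1 - if i ∈ D then c else 0) =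
      D.card * c * (1 - c) ^ (D.card - 1) := by
    rw [← Finset.sum_subset (Finset.subset_univ D) (fun i _ hi => by simp [hi])]
    have : ∀ x ∈ D, (if x ∈ D then c else 0) * ∏ i ∈ {x}ᶜ, (1 - if i ∈ D then c else 0) =
        c * (1 - c) ^ (D.card - 1) := by
      intro x hx
      rw [if_pos hx, ← Finset.card_erase_of_mem hx, ← Finset.prod_const]
      congr 1
      rw [← Finset.prod_subset (s₁ := D.erase x)]
      · exact Finset.prod_congr rfl fun i hi => by simp [Finset.mem_of_mem_erase hi]
      · intro i hi; simp [Finset.ne_of_mem_erase hi]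
      · intro i hi hi'
        have : i ∉ D := fun h => hi' (Finset.mem_erase.2 ⟨by simpa using hi, h⟩)
        simp [this]
    rw [Finset.sum_congr rfl this, Finset.sum_const, nsmul_eq_mul, mul_assoc]
  have e3 : ∑ x, ∑ y, (if x ≠ y ∧ ¬ adj x y then
      (if x ∈ D then c else 0) * (if y ∈ D then c else 0) else 0) ≤
      c ^ 2 * ((D ×ˢ D).filter fun z => ¬ adj z.1 z.2).card := by
    rw [Finset.card_filter, Nat.cast_sum, Finset.mul_sum, ← Finset.sum_product', Finset.univ_product_univ]
    rw [← Finset.sum_subset (Finset.subset_univ (D ×ˢ D))]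
    · refine Finset.sum_le_sum fun z hz => ?_
      rw [Finset.mem_product] at hz
      have := sq_nonneg c
      by_cases hz' : adj z.1 z.2
      · simp [hz']
      · by_cases hz'' : z.1 = z.2
        · simp only [hz'', ne_eq, not_true_eq_false, false_and, if_false]
          positivity
        · simp [hz', hz'', hz.1, hz.2, pow_two]
    · intro z _ hz
      rw [Finset.mem_product, not_and_or] at hz
      rcases hz with hz | hz <;> simp [hz]
  rw [e1, e2]
  linarith

end Expectation

/-! ### Powers of a graph -/

open Classical in
/-- The adjacency matrix of a graph, row by row. -/
noncomputable def adjRow {n : ℕ} (G : SimpleGraph (Fin n)) (x : ℕ) : ℕ :=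
  if ∃ i j : Fin n, x = i * n + j ∧ G.Adj i j then 1 else 0

theorem adjRow_apply {n : ℕ} (G : SimpleGraph (Fin n)) (i j : Fin n) [Decidable (G.Adj i j)] :
    adjRow G (i * n + j) = if G.Adj i j then 1 else 0 := by
  classical
  unfold adjRow
  have hn : 0 < n := i.pos
  refine if_congr ⟨fun ⟨i', j', h, h'⟩ => ?_, fun h => ⟨i, j, rfl, h⟩⟩ rfl rfl
  have h1 : (i : ℕ) = i' := by
    have := congrArg (· / n) h
    simpa [mul_comm _ n, Nat.mul_add_div hn, Nat.div_eq_of_lt] using this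
  have h2 : (j : ℕ) = j' := by
    rw [h1] at h
    omega
  rwa [Fin.ext h1, Fin.ext h2]

theorem tableAdj_baseTab {n : ℕ} (G : SimpleGraph (Fin n)) (v i j : Fin n) :
    tableAdj n (baseTab n v (adjRow G)) i j ↔ G.Adj i j ∧ ¬ G.Adj v i ∧ ¬ G.Adj v j := by
  classical
  have hn : 0 < n := i.pos
  have h1 : ((i : ℕ) * n + j) / n = i := by
    rw [mul_comm, Nat.mul_add_div hn, Nat.div_eq_of_lt j.2, add_zero]
  have h2 : ((i : ℕ) * n + j) % n = j := by
    rw [mul_comm, Nat.mul_add_mod, Nat.mod_eq_of_lt j.2]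
  rw [tableAdj, baseTab, h1, h2, adjRow_apply, adjRow_apply, adjRow_apply]
  by_cases h : G.Adj i j <;> by_cases h' : G.Adj v i <;> by_cases h'' : G.Adj v j <;>
    simp [h, h', h'']

theorem tableAdj_dblTab {N : ℕ} (t : ℕ → ℕ) (x y : Fin (N * N)) :
    tableAdj (N * N) (dblTab N t) x y ↔
      tableAdj N t x.divNat y.divNat ∧ tableAdj N t x.divNat y.modNat ∧
      tableAdj N t x.modNat y.divNat ∧ tableAdj N t x.modNat y.modNat := by
  have hn : 0 < N * N := x.pos
  have h1 : ((x : ℕ) * (N * N) + y) / (N * N) = x := by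
    rw [mul_comm, Nat.mul_add_div hn, Nat.div_eq_of_lt y.2, add_zero]
  have h2 : ((x : ℕ) * (N * N) + y) % (N * N) = y := by
    rw [mul_comm, Nat.mul_add_mod, Nat.mod_eq_of_lt y.2]
  simp only [tableAdj, dblTab, h1, h2, Fin.coe_divNat, Fin.coe_modNat, Nat.add_eq_zero_iff,
    and_assoc]

/-- Adjacency of elements of level `d`, for the graph with adjacency matrix `a`, restricted to the
vertices that are not adjacent to `v`. -/
def powAdj (n v : ℕ) (a : ℕ → ℕ) (d : ℕ) : Fin (lvl n d) → Fin (lvl n d) → Prop :=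
  tableAdj (lvl n d) (powTab n v a d)

/-- `adj'` is the adjacency of the pairs of elements: two pairs are adjacent if both elements of one
are adjacent to both elements of the other. -/
def IsPairAdj {N : ℕ} (adj : Fin N → Fin N → Prop) (adj' : Fin (N * N) → Fin (N * N) → Prop) :
    Prop :=
  ∀ x y : Fin (N * N), adj' x y ↔ adj x.divNat y.divNat ∧ adj x.divNat y.modNat ∧
    adj x.modNat y.divNat ∧ adj x.modNat y.modNat

theorem powAdj_succ (n v d : ℕ) (a : ℕ → ℕ) :
    IsPairAdj (powAdj n v a d) (powAdj n v a (d + 1)) := fun x y => tableAdj_dblTab _ x y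

/-- The elements have supports, which are sets of vertices: the supports of adjacent elements are
completely joined, and at most `m ^ l` elements have their support in a given set of `m`
vertices. -/
def HasSupport {V : Type*} {N : ℕ} (G : V → V → Prop) (adj : Fin N → Fin N → Prop) (l : ℕ) : Prop :=
  open Classical in
  ∃ supp : Fin N → Finset V,
    (∀ Y : Finset V, (Finset.univ.filter fun x => supp x ⊆ Y).card ≤ Y.card ^ l) ∧
    ∀ x y, adj x y → ∀ i ∈ supp x, ∀ j ∈ supp y, G i j

/-- There is a set of `m ^ l` elements in which the pairs that are not adjacent make up at most
the fraction `b / m` of all pairs. -/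
def HasCore {N : ℕ} (adj : Fin N → Fin N → Prop) (m l b : ℕ) : Prop :=
  open Classical in
  ∃ D : Finset (Fin N), D.card = m ^ l ∧
    ((D ×ˢ D).filter fun z => ¬ adj z.1 z.2).card * m ≤ b * D.card ^ 2

section Pairs

variable {N : ℕ} {adj : Fin N → Fin N → Prop} {adj' : Fin (N * N) → Fin (N * N) → Prop}

theorem IsPairAdj.irrefl (h : IsPairAdj adj adj') (hadj : ∀ x, ¬ adj x x) (x : Fin (N * N)) :
    ¬ adj' x x := fun h' => hadj _ ((h x x).1 h').1

/-- There are many elements that are pairwise not adjacent: the pairs with the same first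
element. -/
theorem IsPairAdj.exists_independent (h : IsPairAdj adj adj') (hadj : ∀ x, ¬ adj x x) {k : ℕ}
    (hk : k ≤ N) : ∃ S : Finset (Fin (N * N)), S.card = k ∧
      ∀ x ∈ S, ∀ y ∈ S, ¬ adj' x y := by
  have h2 : k ≤ N * N := hk.trans (Nat.le_mul_self N)
  refine ⟨Finset.univ.map (Fin.castLEEmb h2), by simp, ?_⟩
  intro x hx y hy h'
  have : x.divNat = y.divNat := by
    simp only [Finset.mem_map, Finset.mem_univ, true_and] at hx hy
    obtain ⟨x', rfl⟩ := hx
    obtain ⟨y', rfl⟩ := hy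
    ext
    simp [Fin.coe_divNat, Nat.div_eq_of_lt (x'.2.trans_le hk), Nat.div_eq_of_lt (y'.2.trans_le hk)]
  have h3 := ((h x y).1 h').1
  rw [this] at h3
  exact hadj _ h3

theorem IsPairAdj.hasSupport {V : Type*} {G : V → V → Prop} {l : ℕ} (h : IsPairAdj adj adj')
    (hs : HasSupport G adj l) : HasSupport G adj' (2 * l) := by
  classical
  obtain ⟨supp, h1, h2⟩ := hs
  refine ⟨fun x => supp x.divNat ∪ supp x.modNat, fun Y => ?_, fun x y h' i hi j hj => ?_⟩
  · set A := Finset.univ.filter fun x => supp x ⊆ Y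
    have : (Finset.univ.filter fun x : Fin (N * N) => supp x.divNat ∪ supp x.modNat ⊆ Y) =
        (A ×ˢ A).map finProdFinEquiv.toEmbedding := by
      ext x
      simp only [Finset.mem_filter, Finset.mem_univ, true_and, Finset.mem_map_equiv,
        Finset.mem_product, A, Finset.union_subset_iff]
      rfl
    have h3 : A.card ≤ Y.card ^ l := le_trans (le_of_eq (by congr!)) (h1 Y)
    calc _ = (Finset.univ.filter fun x : Fin (N * N) => supp x.divNat ∪ supp x.modNat ⊆ Y).card := by
            congr!
      _ = A.card * A.card := by rw [this, Finset.card_map, Finset.card_product]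
      _ ≤ Y.card ^ l * Y.card ^ l := Nat.mul_le_mul h3 h3
      _ = Y.card ^ (2 * l) := by rw [← pow_add, two_mul]
  · obtain ⟨g1, g2, g3, g4⟩ := (h x y).1 h'
    simp only [Finset.mem_union] at hi hj
    rcases hi with hi | hi <;> rcases hj with hj | hj
    · exact h2 _ _ g1 i hi j hj
    · exact h2 _ _ g2 i hi j hj
    · exact h2 _ _ g3 i hi j hj
    · exact h2 _ _ g4 i hi j hj

/-- A pair of pairs is not adjacent only if one of four pairs of elements is not, so the fraction of
pairs that are not adjacent is multiplied by at most four. -/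
theorem IsPairAdj.hasCore {m l b : ℕ} (h : IsPairAdj adj adj') (hc : HasCore adj m l b) :
    HasCore adj' m (2 * l) (4 * b) := by
  classical
  obtain ⟨D, h1, h2⟩ := hc
  set X := (D ×ˢ D).filter fun z => ¬ adj z.1 z.2 with hXdef
  have hX : X.card * m ≤ b * D.card ^ 2 := le_trans (le_of_eq (by congr!)) h2
  set D' : Finset (Fin (N * N)) := (D ×ˢ D).map finProdFinEquiv.toEmbedding with hD'def
  have hcard : D'.card = D.card * D.card := by rw [Finset.card_map, Finset.card_product]
  refine ⟨D', by rw [hcard, h1, ← pow_add, two_mul], ?_⟩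
  have hD' : ∀ x ∈ D', x.divNat ∈ D ∧ x.modNat ∈ D := fun x hx => by
    simpa [D', Finset.mem_map_equiv] using hx
  have hext : ∀ x y : Fin (N * N), x.divNat = y.divNat → x.modNat = y.modNat → x = y :=
    fun x y h h' => finProdFinEquiv.symm.injective (Prod.ext h h')
  -- the pairs `z`, `w` for which given halves of `z` and `w` are not adjacent
  have count : ∀ p p' q q' : Fin (N * N) → Fin N,
      (∀ x ∈ D', p x ∈ D ∧ p' x ∈ D ∧ q x ∈ D ∧ q' x ∈ D) →
      (∀ x y, p x = p y → p' x = p' y → x = y) → (∀ x y, q x = q y → q' x = q' y → x = y) →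
      ((D' ×ˢ D').filter fun z => ¬ adj (p z.1) (q z.2)).card ≤ X.card * (D.card * D.card) := by
    intro p p' q q' hp hinj hinj'
    rw [← Finset.card_product, ← Finset.card_product]
    refine Finset.card_le_card_of_injOn (fun z => ((p z.1, q z.2), (p' z.1, q' z.2))) ?_ ?_
    · intro z hz
      rw [Finset.mem_coe, Finset.mem_filter, Finset.mem_product] at hz
      rw [Finset.mem_coe, Finset.mem_product, Finset.mem_product, hXdef, Finset.mem_filter,
        Finset.mem_product]
      exact ⟨⟨⟨(hp _ hz.1.1).1, (hp _ hz.1.2).2.2.1⟩, hz.2⟩, (hp _ hz.1.1).2.1,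
        (hp _ hz.1.2).2.2.2⟩
    · intro z _ w _ h
      simp only [Prod.mk.injEq] at h
      exact Prod.ext (hinj _ _ h.1.1 h.2.1) (hinj' _ _ h.1.2 h.2.2)
  have i1 : ∀ x y : Fin (N * N), x.modNat = y.modNat → x.divNat = y.divNat → x = y :=
    fun x y h h' => hext x y h' h
  have c1 := count Fin.divNat Fin.modNat Fin.divNat Fin.modNat
    (fun x hx => ⟨(hD' x hx).1, (hD' x hx).2, (hD' x hx).1, (hD' x hx).2⟩) hext hext
  have c2 := count Fin.divNat Fin.modNat Fin.modNat Fin.divNat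
    (fun x hx => ⟨(hD' x hx).1, (hD' x hx).2, (hD' x hx).2, (hD' x hx).1⟩) hext i1
  have c3 := count Fin.modNat Fin.divNat Fin.divNat Fin.modNat
    (fun x hx => ⟨(hD' x hx).2, (hD' x hx).1, (hD' x hx).1, (hD' x hx).2⟩) i1 hext
  have c4 := count Fin.modNat Fin.divNat Fin.modNat Fin.divNat
    (fun x hx => ⟨(hD' x hx).2, (hD' x hx).1, (hD' x hx).2, (hD' x hx).1⟩) i1 i1
  have hle : ((D' ×ˢ D').filter fun z => ¬ adj' z.1 z.2).card ≤
      4 * (X.card * (D.card * D.card)) := by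
    have hsub : ((D' ×ˢ D').filter fun z => ¬ adj' z.1 z.2) ⊆
        (((D' ×ˢ D').filter fun z => ¬ adj z.1.divNat z.2.divNat) ∪
        ((D' ×ˢ D').filter fun z => ¬ adj z.1.divNat z.2.modNat)) ∪
        (((D' ×ˢ D').filter fun z => ¬ adj z.1.modNat z.2.divNat) ∪
        ((D' ×ˢ D').filter fun z => ¬ adj z.1.modNat z.2.modNat)) := by
      intro z hz
      rw [Finset.mem_filter, h] at hz
      simp only [Finset.mem_union, Finset.mem_filter]
      tauto
    refine (Finset.card_le_card hsub).trans ((Finset.card_union_le _ _).trans ?_)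
    have u1 := Finset.card_union_le ((D' ×ˢ D').filter fun z => ¬ adj z.1.divNat z.2.divNat)
      ((D' ×ˢ D').filter fun z => ¬ adj z.1.divNat z.2.modNat)
    have u2 := Finset.card_union_le ((D' ×ˢ D').filter fun z => ¬ adj z.1.modNat z.2.divNat)
      ((D' ×ˢ D').filter fun z => ¬ adj z.1.modNat z.2.modNat)
    omega
  calc _ ≤ 4 * (X.card * (D.card * D.card)) * m := by
        refine Nat.mul_le_mul_right _ (le_trans (le_of_eq ?_) hle)
        congr!
    _ = 4 * (X.card * m) * (D.card * D.card) := by ring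
    _ ≤ 4 * (b * D.card ^ 2) * (D.card * D.card) := by gcongr
    _ = 4 * b * D'.card ^ 2 := by rw [hcard]; ring

end Pairs

section Powers

variable {n : ℕ} {G : SimpleGraph (Fin n)} {v : Fin n}

theorem powAdj_irrefl (d : ℕ) : ∀ x : Fin (lvl n d), ¬ powAdj n v (adjRow G) d x x := by
  induction d with
  | zero => exact fun x h => G.irrefl ((tableAdj_baseTab G v x x).1 h).1
  | succ d ih => exact (powAdj_succ n v d (adjRow G)).irrefl ih

theorem powAdj_exists_independent (d : ℕ) {k : ℕ} (hk : k ≤ n) :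
    ∃ S : Finset (Fin (lvl n (d + 1))), S.card = k ∧
      ∀ x ∈ S, ∀ y ∈ S, ¬ powAdj n v (adjRow G) (d + 1) x y :=
  (powAdj_succ n v d (adjRow G)).exists_independent (powAdj_irrefl d)
    (hk.trans (lvl_mono_right v.pos (Nat.zero_le d)))

theorem powAdj_hasSupport (d : ℕ) :
    HasSupport (fun i j => G.Adj i j ∧ ¬ G.Adj v i ∧ ¬ G.Adj v j) (powAdj n v (adjRow G) d)
      (2 ^ d) := by
  classical
  induction d with
  | zero =>
    have key : HasSupport (N := n) (fun i j => G.Adj i j ∧ ¬ G.Adj v i ∧ ¬ G.Adj v j)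
        (powAdj n v (adjRow G) 0) 1 := by
      refine ⟨fun x : Fin n => {x}, fun Y => ?_, fun x y h i hi j hj => ?_⟩
      · rw [pow_one]
        refine Finset.card_le_card fun x hx => ?_
        exact Finset.singleton_subset_iff.1 ((@Finset.mem_filter _ _ (_) _ _).1 hx).2
      · rw [Finset.mem_singleton.1 hi, Finset.mem_singleton.1 hj]
        exact (tableAdj_baseTab G v x y).1 h
    exact key
  | succ d ih =>
    rw [pow_succ, mul_comm]
    exact (powAdj_succ n v d (adjRow G)).hasSupport ih

theorem powAdj_hasCore (d : ℕ) (C : Finset (Fin n))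
    (hC : ∀ i ∈ C, ∀ j ∈ C, i ≠ j → G.Adj i j ∧ ¬ G.Adj v i ∧ ¬ G.Adj v j) :
    HasCore (powAdj n v (adjRow G) d) C.card (2 ^ d) (4 ^ d) := by
  classical
  induction d with
  | zero =>
    have key : HasCore (N := n) (powAdj n v (adjRow G) 0) C.card 1 1 := by
      refine ⟨C, by rw [pow_one], ?_⟩
      rw [one_mul, pow_two]
      refine Nat.mul_le_mul_right _ ?_
      rw [← Finset.diag_card C]
      refine Finset.card_le_card fun z hz => ?_
      rw [Finset.mem_filter, Finset.mem_product] at hz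
      rw [Finset.mem_diag]
      refine ⟨hz.1.1, ?_⟩
      by_contra h
      exact hz.2 ((tableAdj_baseTab G v _ _).2 (hC _ hz.1.1 _ hz.1.2 h))
    exact key
  | succ d ih =>
    rw [pow_succ, mul_comm, pow_succ 4 d, mul_comm _ 4]
    exact (powAdj_succ n v d (adjRow G)).hasCore ih

end Powers

/-! ### Graphs without large complete bipartite subgraphs -/

open Classical in
/-- The weight of the vector `q` on the pairs of adjacent elements. -/
noncomputable def adjWeight {N : ℕ} (adj : Fin N → Fin N → Prop) (q : Fin N → ℝ) : ℝ :=
  ∑ x, ∑ y, if adj x y then q x * q y else 0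

theorem sum_range_mul_self {M : Type*} [AddCommMonoid M] (N : ℕ) (g : ℕ → ℕ → ℕ → M) :
    ∑ w ∈ Finset.range (N * N), g w (w / N) (w % N) =
      ∑ x : Fin N, ∑ y : Fin N, g (x * N + y) x y := by
  rw [Finset.sum_range, ← Fintype.sum_prod_type']
  refine (Fintype.sum_equiv finProdFinEquiv _ _ fun z => ?_).symm
  have hN : 0 < N := z.1.pos
  have h : ((finProdFinEquiv z : Fin (N * N)) : ℕ) = z.1 * N + z.2 := by
    simp [finProdFinEquiv, mul_comm, add_comm]
  have h1 : ((z.1 : ℕ) * N + z.2) / N = z.1 := by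
    rw [mul_comm, Nat.mul_add_div hN, Nat.div_eq_of_lt z.2.2, add_zero]
  have h2 : ((z.1 : ℕ) * N + z.2) % N = z.2 := by
    rw [mul_comm, Nat.mul_add_mod, Nat.mod_eq_of_lt z.2.2]
  rw [h, h1, h2]

open Classical in
/-- The test on the machine, in terms of the rounded vector. -/
theorem RAM.passes_iff {N den E kk : ℕ} {t x y : ℕ → ℕ} (hU : 0 < N * den) :
    RAM.Passes N den E kk t x y ↔
      ∑ i : Fin N, (RAM.quant N (N * den) (x i) (y i) : ℝ) / (N * den : ℕ) ≤ kk ∧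
      1 ≤ E * adjWeight (tableAdj N t)
        fun i => (RAM.quant N (N * den) (x i) (y i) : ℝ) / (N * den : ℕ) := by
  have hU' : (0 : ℝ) < (N * den : ℕ) := by exact_mod_cast hU
  unfold RAM.Passes
  generalize N * den = U at *
  refine and_congr ?_ ?_
  · rw [← Finset.sum_div, div_le_iff₀ hU', Finset.sum_range]
    norm_cast
  · rw [sum_range_mul_self N fun w i j =>
      if t w = 0 then RAM.quant N U (x i) (y i) * RAM.quant N U (x j) (y j) else 0]
    have h : adjWeight (tableAdj N t) (fun i => (RAM.quant N U (x i) (y i) : ℝ) / (U : ℕ)) =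
        ((∑ i : Fin N, ∑ j : Fin N, if t (i * N + j) = 0 then
          RAM.quant N U (x i) (y i) * RAM.quant N U (x j) (y j) else 0 : ℕ) : ℝ) / (U * U) := by
      unfold adjWeight tableAdj
      push_cast
      rw [Finset.sum_div]
      refine Finset.sum_congr rfl fun i _ => ?_
      rw [Finset.sum_div]
      refine Finset.sum_congr rfl fun j _ => ?_
      split_ifs
      · rw [div_mul_div_comm]
      · rw [zero_div]
    rw [h, ← mul_div_assoc, le_div_iff₀ (by positivity), one_mul]
    norm_cast

/-- `G` has no complete bipartite subgraph with `r` vertices on each side. -/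
def BicliqueFree {V : Type*} (G : V → V → Prop) (r : ℕ) : Prop :=
  ∀ A B : Finset V, r ≤ A.card → r ≤ B.card → ¬ ∀ i ∈ A, ∀ j ∈ B, G i j

theorem Finset.exists_subset_image_fin {V : Type*} [Nonempty V] [DecidableEq V] {Y : Finset V}
    {r : ℕ} (hY : Y.card ≤ r) : ∃ g : Fin r → V, Y ⊆ Finset.univ.image g := by
  obtain ⟨v⟩ := ‹Nonempty V›
  refine ⟨fun i => if h : (i : ℕ) < Y.card then (Y.equivFin.symm ⟨i, h⟩ : Y) else v, fun y hy => ?_⟩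
  rw [Finset.mem_image]
  have h := (Y.equivFin ⟨y, hy⟩).2
  exact ⟨⟨Y.equivFin ⟨y, hy⟩, h.trans_le hY⟩, Finset.mem_univ _, by simp⟩

/-- The power mean inequality, with weights of arbitrary sum. -/
theorem Finset.sum_mul_pow_succ_le {ι : Type*} (S : Finset ι) {q d : ι → ℝ} (h0 : ∀ i, 0 ≤ q i)
    (hd : ∀ i, 0 ≤ d i) (s : ℕ) :
    (∑ i ∈ S, q i * d i) ^ (s + 1) ≤ (∑ i ∈ S, q i) ^ s * ∑ i ∈ S, q i * d i ^ (s + 1) := by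
  set Q := ∑ i ∈ S, q i with hQ
  have hQ0 : 0 ≤ Q := Finset.sum_nonneg fun i _ => h0 i
  rcases hQ0.eq_or_lt with h | h
  · have hz : ∀ i ∈ S, q i = 0 := (Finset.sum_eq_zero_iff_of_nonneg fun i _ => h0 i).1 h.symm
    rw [Finset.sum_eq_zero fun i hi => by rw [hz i hi, zero_mul],
      Finset.sum_eq_zero (f := fun i => q i * d i ^ (s + 1)) fun i hi => by rw [hz i hi, zero_mul]]
    simp
  · have key := Real.pow_arith_mean_le_arith_mean_pow S (fun i => q i / Q) d
      (fun i _ => div_nonneg (h0 i) hQ0) (by rw [← Finset.sum_div, div_self h.ne'])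
      (fun i _ => hd i) (s + 1)
    simp only [div_mul_eq_mul_div] at key
    rw [← Finset.sum_div, ← Finset.sum_div, div_pow, div_le_iff₀ (by positivity)] at key
    refine key.trans (le_of_eq ?_)
    field_simp
    ring

/-- In a graph without large complete bipartite subgraphs, adjacent elements carry little weight:
either the supports of many elements cover `r` vertices, and then their common neighbours have their
supports among less than `r` vertices, or these supports lie in few vertices. -/
theorem adjWeight_pow_le {V : Type*} [Fintype V] [Nonempty V] {G : V → V → Prop} {N l r s : ℕ}
    {adj : Fin N → Fin N → Prop} {q : Fin N → ℝ} {p k : ℝ} (hs : HasSupport G adj l)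
    (hG : BicliqueFree G r) (h0 : ∀ i, 0 ≤ q i) (hp : ∀ i, q i ≤ p) (hp0 : 0 ≤ p)
    (hk : ∑ i, q i ≤ k) :
    adjWeight adj q ^ (s + 1) ≤ k ^ s * (k ^ (s + 1) * (r ^ l * p) +
      k * (Fintype.card V ^ r * (r ^ l * p) ^ (s + 1))) := by
  classical
  obtain ⟨supp, hcount, hjoin⟩ := hs
  have hcount' : ∀ Y : Finset V, Y.card ≤ r →
      ((Finset.univ.filter fun x => supp x ⊆ Y).card : ℝ) ≤ r ^ l := fun Y hY => by
    have h1 := hcount Y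
    have h2 : (Finset.univ.filter fun x => supp x ⊆ Y).card ≤ r ^ l :=
      (le_of_eq (by congr!)).trans (h1.trans (Nat.pow_le_pow_left hY l))
    exact_mod_cast h2
  have hk0 : 0 ≤ k := (Finset.sum_nonneg fun i _ => h0 i).trans hk
  -- `c f` is the weight of the common neighbours of the elements in `f`
  set c : (Fin (s + 1) → Fin N) → ℝ := fun f => ∑ y, if ∀ i, adj (f i) y then q y else 0 with hc
  have hc0 : ∀ f, 0 ≤ c f := fun f => Finset.sum_nonneg fun y _ => by
    split_ifs
    exacts [h0 y, le_rfl]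
  have hck : ∀ f, c f ≤ k := fun f => le_trans (Finset.sum_le_sum fun y _ => by
    split_ifs
    exacts [le_rfl, h0 y]) hk
  have hq0 : ∀ f : Fin (s + 1) → Fin N, 0 ≤ ∏ i, q (f i) := fun f =>
    Finset.prod_nonneg fun i _ => h0 _
  have expand : ∑ y, q y * (∑ x, if adj x y then q x else 0) ^ (s + 1) =
      ∑ f : Fin (s + 1) → Fin N, (∏ i, q (f i)) * c f := by
    simp_rw [Fintype.sum_pow, hc, Finset.mul_sum]
    rw [Finset.sum_comm]
    refine Finset.sum_congr rfl fun f _ => Finset.sum_congr rfl fun y _ => ?_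
    by_cases h : ∀ i, adj (f i) y
    · simp only [h, if_true, implies_true]
      ring
    · obtain ⟨i, hi⟩ := not_forall.1 h
      rw [if_neg h, Finset.prod_eq_zero (Finset.mem_univ i) (if_neg hi)]
      simp
  have hW : adjWeight adj q = ∑ y, q y * ∑ x, if adj x y then q x else 0 := by
    unfold adjWeight
    rw [Finset.sum_comm]
    refine Finset.sum_congr rfl fun y _ => ?_
    rw [Finset.mul_sum]
    refine Finset.sum_congr rfl fun x _ => ?_
    split_ifs
    · ring
    · simp
  set Y : (Fin (s + 1) → Fin N) → Finset V := fun f => Finset.univ.biUnion fun i => supp (f i)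
    with hY
  have large : ∀ f, r ≤ (Y f).card → c f ≤ r ^ l * p := by
    intro f hf
    set Z : Finset V := Finset.univ.filter fun j => ∀ i ∈ Y f, G i j with hZ
    have hZr : Z.card ≤ r := by
      by_contra h
      exact hG (Y f) Z hf (by omega) fun i hi j hj => (Finset.mem_filter.1 hj).2 i hi
    have hsub : ∀ y, (∀ i, adj (f i) y) → supp y ⊆ Z := by
      intro y hy j hj
      refine Finset.mem_filter.2 ⟨Finset.mem_univ _, fun i hi => ?_⟩
      obtain ⟨a, -, ha⟩ := Finset.mem_biUnion.1 hi
      exact hjoin _ _ (hy a) i ha j hj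
    calc c f ≤ ∑ y, if supp y ⊆ Z then p else 0 := Finset.sum_le_sum fun y _ => by
            split_ifs with h1 h2 h2
            · exact hp y
            · exact absurd (hsub y h1) h2
            · exact hp0
            · exact le_rfl
      _ = (Finset.univ.filter fun x => supp x ⊆ Z).card * p := by
            rw [← Finset.sum_filter, Finset.sum_const, nsmul_eq_mul]
      _ ≤ r ^ l * p := mul_le_mul_of_nonneg_right (hcount' Z hZr) hp0
  have small : ∑ f, (if (Y f).card < r then ∏ i, q (f i) else 0) ≤
      Fintype.card V ^ r * (r ^ l * p) ^ (s + 1) := by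
    have h1 : ∀ f, (if (Y f).card < r then ∏ i, q (f i) else 0) ≤
        ∑ g : Fin r → V, ∏ i, (if supp (f i) ⊆ Finset.univ.image g then p else 0) := by
      intro f
      have hnn : ∀ g : Fin r → V, 0 ≤ ∏ i, (if supp (f i) ⊆ Finset.univ.image g then p else 0) :=
        fun g => Finset.prod_nonneg fun i _ => by
          split_ifs
          exacts [hp0, le_rfl]
      split_ifs with h
      · obtain ⟨g, hg⟩ := Finset.exists_subset_image_fin h.le
        refine le_trans ?_ (Finset.single_le_sum (fun g _ => hnn g) (Finset.mem_univ g))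
        refine Finset.prod_le_prod (fun i _ => h0 _) fun i _ => ?_
        rw [if_pos ((Finset.subset_biUnion_of_mem (fun i => supp (f i))
          (Finset.mem_univ i)).trans hg)]
        exact hp _
      · exact Finset.sum_nonneg fun g _ => hnn g
    refine (Finset.sum_le_sum fun f _ => h1 f).trans ?_
    rw [Finset.sum_comm]
    have h2 : ∀ g : Fin r → V, ∑ f : Fin (s + 1) → Fin N,
        ∏ i, (if supp (f i) ⊆ Finset.univ.image g then p else 0) ≤ (r ^ l * p) ^ (s + 1) := by
      intro g
      rw [← Fintype.sum_pow (fun x => if supp x ⊆ Finset.univ.image g then p else 0)]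
      have h3 : ∑ x, (if supp x ⊆ Finset.univ.image g then p else 0) =
          (Finset.univ.filter fun x => supp x ⊆ Finset.univ.image g).card * p := by
        rw [← Finset.sum_filter, Finset.sum_const, nsmul_eq_mul]
      rw [h3]
      refine pow_le_pow_left₀ (by positivity) (mul_le_mul_of_nonneg_right (hcount' _ ?_) hp0) _
      exact Finset.card_image_le.trans (by simp)
    refine (Finset.sum_le_sum fun g _ => h2 g).trans (le_of_eq ?_)
    simp
  rw [hW]
  refine (Finset.sum_mul_pow_succ_le Finset.univ h0 (fun y => Finset.sum_nonneg fun x _ => by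
    split_ifs
    exacts [h0 x, le_rfl]) s).trans ?_
  refine mul_le_mul (pow_le_pow_left₀ (Finset.sum_nonneg fun i _ => h0 i) hk s) ?_
    (Finset.sum_nonneg fun y _ => mul_nonneg (h0 y) (pow_nonneg (Finset.sum_nonneg fun x _ => by
      split_ifs
      exacts [h0 x, le_rfl]) _)) (by positivity)
  rw [expand]
  have hall : ∑ f : Fin (s + 1) → Fin N, ∏ i, q (f i) ≤ k ^ (s + 1) := by
    rw [← Fintype.sum_pow]
    exact pow_le_pow_left₀ (Finset.sum_nonneg fun i _ => h0 i) hk _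
  calc ∑ f, (∏ i, q (f i)) * c f ≤
        ∑ f, ((∏ i, q (f i)) * (r ^ l * p) +
          (if (Y f).card < r then ∏ i, q (f i) else 0) * k) := Finset.sum_le_sum fun f _ => by
          split_ifs with h
          · have := mul_le_mul_of_nonneg_left (hck f) (hq0 f)
            have h' : 0 ≤ (∏ i, q (f i)) * ((r : ℝ) ^ l * p) := mul_nonneg (hq0 f) (by positivity)
            linarith
          · rw [zero_mul, add_zero]
            exact mul_le_mul_of_nonneg_left (large f (not_lt.1 h)) (hq0 f)
    _ = (∑ f : Fin (s + 1) → Fin N, ∏ i, q (f i)) * (r ^ l * p) +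
          (∑ f, if (Y f).card < r then ∏ i, q (f i) else 0) * k := by
          rw [Finset.sum_add_distrib, Finset.sum_mul, Finset.sum_mul]
    _ ≤ k ^ (s + 1) * (r ^ l * p) + (Fintype.card V ^ r * (r ^ l * p) ^ (s + 1)) * k :=
          add_le_add (mul_le_mul_of_nonneg_right hall (by positivity))
            (mul_le_mul_of_nonneg_right small hk0)
    _ = _ := by ring

theorem Nat.two_pow_size_le {n : ℕ} (hn : 0 < n) : 2 ^ n.size ≤ 2 * n := by
  have h : n.size - 1 < n.size := Nat.sub_lt (Nat.size_pos.2 hn) one_pos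
  have := Nat.lt_size.1 h
  calc 2 ^ n.size = 2 * 2 ^ (n.size - 1) := by
          rw [← pow_succ']; congr 1; omega
    _ ≤ 2 * n := by omega

/-- In a graph without large complete bipartite subgraphs no vector passes the test. -/
theorem not_passes_of_bicliqueFree {n N E kk a l : ℕ} {t x y : ℕ → ℕ}
    {G : Fin n → Fin n → Prop} (hN : 0 < N) (hn : 4 * (2 ^ a * (3 * n.size) ^ l) ≤ n)
    (hl : 0 < n) (hE : E * (kk * kk) ≤ 2 ^ a) (hkk : 0 < kk)
    (hs : HasSupport G (tableAdj N t) l) (hG : BicliqueFree G (3 * n.size)) :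
    ¬ RAM.Passes N (n ^ (a + 4)) E kk t x y := by
  classical
  have hU : 0 < N * n ^ (a + 4) := by positivity
  rw [RAM.passes_iff hU]
  rintro ⟨h1, h2⟩
  set q : Fin N → ℝ := fun i =>
    (RAM.quant N (N * n ^ (a + 4)) (x i) (y i) : ℝ) / (N * n ^ (a + 4) : ℕ) with hq
  set p : ℝ := 1 / (n : ℝ) ^ (a + 4) with hpdef
  have hn0 : (0 : ℝ) < n := by exact_mod_cast hl
  have hN0 : (0 : ℝ) < N := by exact_mod_cast hN
  have hn1 : (1 : ℝ) ≤ n := by exact_mod_cast hl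
  have hkk1 : (1 : ℝ) ≤ kk := by exact_mod_cast hkk
  have hp : ∀ i, q i ≤ p := fun i => by
    rw [hq, hpdef]
    simp only
    push_cast
    rw [div_le_div_iff₀ (by positivity) (by positivity), one_mul]
    refine mul_le_mul_of_nonneg_right ?_ (by positivity)
    exact_mod_cast Nat.min_le_left _ _
  obtain ⟨s, hsz⟩ : ∃ s, n.size = s + 1 := ⟨n.size - 1, by
    have := Nat.size_pos.2 hl
    omega⟩
  have : Nonempty (Fin n) := ⟨⟨0, hl⟩⟩
  have key := adjWeight_pow_le (s := s) hs hG (fun i => by positivity) hp (by positivity) h1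
  rw [Fintype.card_fin] at key
  set W := adjWeight (tableAdj N t) q with hWdef
  have hE1 : (1 : ℝ) ≤ (E * W) ^ (s + 1) := one_le_pow₀ h2
  set P : ℝ := ((3 * n.size : ℕ) : ℝ) ^ l * p with hP
  have hP0 : 0 ≤ P := by positivity
  have hc : (4 : ℝ) * (2 ^ a * ((3 * n.size : ℕ) : ℝ) ^ l) ≤ n := by exact_mod_cast hn
  have hA : (E : ℝ) * (kk * kk) ≤ 2 ^ a := by exact_mod_cast hE
  -- the common bound for both terms: `2 ^ a * n ^ (a + 3) * P` is at most `1 / 4`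
  have hPn : 2 ^ a * n ^ (a + 3) * P ≤ 1 / 4 := by
    have : (2 : ℝ) ^ a * n ^ (a + 3) * P =
        (2 ^ a * ((3 * n.size : ℕ) : ℝ) ^ l) / n := by
      rw [hP, hpdef, pow_add, pow_add]
      field_simp
    rw [this, div_le_iff₀ hn0]
    linarith
  have hsize : ((2 : ℝ) ^ a) ^ (s + 1) ≤ 2 ^ a * n ^ a := by
    rw [← pow_mul, mul_comm, pow_mul, ← mul_pow]
    refine pow_le_pow_left₀ (by positivity) ?_ _
    rw [← hsz]
    exact_mod_cast Nat.two_pow_size_le hl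
  have t1 : ((2 : ℝ) ^ a) ^ (s + 1) * P ≤ 1 / 4 := by
    refine le_trans ?_ hPn
    refine mul_le_mul_of_nonneg_right (hsize.trans ?_) hP0
    refine mul_le_mul_of_nonneg_left ?_ (by positivity)
    exact pow_le_pow_right₀ hn1 (by omega)
  have t2 : ((2 : ℝ) ^ a) ^ (s + 1) * (n ^ (3 * n.size) * P ^ (s + 1)) ≤ 1 / 4 := by
    have : ((2 : ℝ) ^ a) ^ (s + 1) * (n ^ (3 * n.size) * P ^ (s + 1)) =
        (2 ^ a * n ^ 3 * P) ^ (s + 1) := by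
      rw [hsz, pow_mul, ← mul_pow, ← mul_pow, mul_assoc]
    rw [this]
    have h3 : 2 ^ a * n ^ 3 * P ≤ 1 / 4 := by
      refine le_trans ?_ hPn
      refine mul_le_mul_of_nonneg_right (mul_le_mul_of_nonneg_left ?_ (by positivity)) hP0
      exact pow_le_pow_right₀ hn1 (by omega)
    calc (2 ^ a * n ^ 3 * P) ^ (s + 1) ≤ (1 / 4 : ℝ) ^ (s + 1) :=
          pow_le_pow_left₀ (by positivity) h3 _
      _ ≤ (1 / 4) ^ 1 := pow_le_pow_of_le_one (by norm_num) (by norm_num) (by omega)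
      _ = 1 / 4 := pow_one _
  have hfin : ((E : ℝ) * W) ^ (s + 1) ≤ 1 / 4 + 1 / 4 := by
    calc ((E : ℝ) * W) ^ (s + 1) = (E : ℝ) ^ (s + 1) * W ^ (s + 1) := mul_pow _ _ _
      _ ≤ (E : ℝ) ^ (s + 1) * ((kk : ℝ) ^ s * ((kk : ℝ) ^ (s + 1) * P +
          kk * (n ^ (3 * n.size) * P ^ (s + 1)))) :=
        mul_le_mul_of_nonneg_left key (by positivity)
      _ ≤ (E : ℝ) ^ (s + 1) * ((kk : ℝ) ^ (s + 1) * ((kk : ℝ) ^ (s + 1) * P +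
          (kk : ℝ) ^ (s + 1) * (n ^ (3 * n.size) * P ^ (s + 1)))) := by
        refine mul_le_mul_of_nonneg_left (mul_le_mul (pow_le_pow_right₀ hkk1 (by omega))
          (add_le_add le_rfl (mul_le_mul_of_nonneg_right (le_self_pow₀ hkk1 (by omega))
            (by positivity))) (by positivity) (by positivity)) (by positivity)
      _ = ((E : ℝ) * (kk * kk)) ^ (s + 1) * (P + n ^ (3 * n.size) * P ^ (s + 1)) := by
        rw [mul_pow, mul_pow]; ring
      _ ≤ (2 ^ a) ^ (s + 1) * (P + n ^ (3 * n.size) * P ^ (s + 1)) := by gcongr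
      _ ≤ _ := by rw [mul_add]; exact add_le_add t1 t2
  linarith

/-! ### Finite uniform probability -/

/-- The probability of an event under the uniform distribution on a finite type. -/
noncomputable def unifProb {α : Type*} (p : α → Prop) : ℝ := Nat.card {a // p a} / Nat.card α

theorem unifProb_nonneg {α : Type*} (p : α → Prop) : 0 ≤ unifProb p := by
  unfold unifProb
  positivity

theorem unifProb_mono {α : Type*} [Finite α] {p q : α → Prop} (h : ∀ a, p a → q a) : unifProb p ≤ unifProb q := by
  unfold unifProb
  gcongr
  exact Nat.card_le_card_of_injective (Subtype.map id h) (Subtype.map_injective h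
    Function.injective_id)

theorem unifProb_or_le {α : Type*} [Finite α] (p q : α → Prop) :
    unifProb (fun a => p a ∨ q a) ≤ unifProb p + unifProb q := by
  classical
  have := Fintype.ofFinite α
  unfold unifProb
  rw [← add_div]
  gcongr
  norm_cast
  simp only [Nat.card_eq_fintype_card]
  exact Fintype.card_subtype_or p q

theorem unifProb_exists_le {ι α : Type*} [Finite α] (S : Finset ι) (p : ι → α → Prop) :
    unifProb (fun a => ∃ i ∈ S, p i a) ≤ ∑ i ∈ S, unifProb (p i) := by
  classical
  induction S using Finset.induction_on with
  | empty => simp [unifProb]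
  | insert i S hi ih =>
    rw [Finset.sum_insert hi]
    refine (unifProb_mono fun a h => ?_).trans ((unifProb_or_le (p i)
      (fun a => ∃ i ∈ S, p i a)).trans (add_le_add le_rfl ih))
    simpa using h

theorem unifProb_not {α : Type*} [Finite α] [Nonempty α] (p : α → Prop) :
    unifProb (fun a => ¬ p a) = 1 - unifProb p := by
  classical
  have := Fintype.ofFinite α
  have h0 : (Nat.card α : ℝ) ≠ 0 := by exact_mod_cast Nat.card_pos.ne'
  unfold unifProb
  rw [eq_sub_iff_add_eq, ← add_div, div_eq_one_iff_eq h0]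
  norm_cast
  simp only [Nat.card_eq_fintype_card]
  rw [add_comm, ← Fintype.card_sum]
  exact Fintype.card_congr (Equiv.sumCompl p)

/-- A bound for the conditional probabilities is a bound for the probability. -/
theorem unifProb_prod_le {α β : Type*} [Finite α] [Finite β] {p : α × β → Prop} {ε : ℝ} (hε : 0 ≤ ε)
    (h : ∀ a, unifProb (fun b => p (a, b)) ≤ ε) : unifProb p ≤ ε := by
  classical
  have := Fintype.ofFinite α
  have := Fintype.ofFinite β
  unfold unifProb at *
  refine div_le_of_le_mul₀ (by positivity) hε ?_
  have e : {x // p x} ≃ Σ a, {b // p (a, b)} :=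
    { toFun := fun x => ⟨x.1.1, x.1.2, x.2⟩
      invFun := fun x => ⟨(x.1, x.2.1), x.2.2⟩
      left_inv := fun x => rfl
      right_inv := fun x => rfl }
  rw [Nat.card_congr e, Nat.card_sigma, Nat.card_prod]
  push_cast
  calc ∑ a, (Nat.card {b // p (a, b)} : ℝ) ≤ ∑ a : α, ε * Nat.card β :=
        Finset.sum_le_sum fun a _ => by
          rcases isEmpty_or_nonempty β with hβ | hβ
          · simp
          · have h0 : (0 : ℝ) < Nat.card β := by exact_mod_cast Nat.card_pos
            exact (div_le_iff₀ h0).1 (h a)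
    _ = ε * (Nat.card α * Nat.card β) := by
        rw [Finset.sum_const, Finset.card_univ, ← Nat.card_eq_fintype_card, nsmul_eq_mul]
        ring

theorem unifProb_equiv {α β : Type*} (e : α ≃ β) (p : β → Prop) : unifProb (fun a => p (e a)) = unifProb p := by
  unfold unifProb
  rw [Nat.card_congr e, Nat.card_congr (e.subtypeEquiv fun a => Iff.rfl)]

/-- Repeated independent trials. -/
theorem unifProb_forall {ι α : Type*} [Finite ι] (p : α → Prop) :
    unifProb (fun f : ι → α => ∀ i, p (f i)) = unifProb p ^ Nat.card ι := by
  have := Fintype.ofFinite ι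
  unfold unifProb
  rw [Nat.card_congr (Equiv.subtypePiEquivPi (p := fun _ : ι => p)), Nat.card_fun, Nat.card_fun]
  push_cast
  rw [div_pow]

/-- Some of many independent random bits. -/
theorem unifProb_comp_le {α β : Type*} [Finite α] [Finite β] {ι : α → β} (hι : Function.Injective ι) (p : (α → Bool) → Prop) :
    unifProb (fun r : β → Bool => p (r ∘ ι)) ≤ unifProb p := by
  classical
  have := Fintype.ofFinite α
  have := Fintype.ofFinite β
  have h1 : Nat.card {r : β → Bool // p (r ∘ ι)} ≤
      Nat.card ({s // p s} × ({b // b ∉ Set.range ι} → Bool)) := by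
    refine Nat.card_le_card_of_injective (fun r => (⟨r.1 ∘ ι, r.2⟩, fun b => r.1 b)) ?_
    intro r r' h
    simp only [Prod.mk.injEq, Subtype.mk.injEq] at h
    refine Subtype.ext (funext fun b => ?_)
    by_cases hb : b ∈ Set.range ι
    · obtain ⟨a, rfl⟩ := hb
      exact congrFun h.1 a
    · exact congrFun h.2 ⟨b, hb⟩
  have h2 : Nat.card (β → Bool) =
      Nat.card (α → Bool) * Nat.card ({b // b ∉ Set.range ι} → Bool) := by
    rw [← Nat.card_prod]
    refine Nat.card_congr ((Equiv.piEquivPiSubtypeProd (· ∈ Set.range ι) _).trans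
      (Equiv.prodCongr ((Equiv.ofInjective ι hι).arrowCongr (Equiv.refl _)).symm (Equiv.refl _)))
  have h3 : (0 : ℝ) < Nat.card (α → Bool) := by exact_mod_cast Nat.card_pos
  have h4 : (0 : ℝ) < Nat.card ({b // b ∉ Set.range ι} → Bool) := by exact_mod_cast Nat.card_pos
  unfold unifProb
  rw [h2]
  push_cast
  rw [div_le_div_iff₀ (by positivity) h3]
  rw [Nat.card_prod] at h1
  have h1' : (Nat.card {r : β → Bool // p (r ∘ ι)} : ℝ) ≤
      Nat.card {s // p s} * Nat.card ({b // b ∉ Set.range ι} → Bool) := by exact_mod_cast h1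
  nlinarith

/-! ### Random graphs -/

section RandomGraph

variable {n : ℕ}

/-- The edges of a uniformly random graph are independent, and each is present with probability
`1 / 2`. -/
theorem unifProb_edges_le {V : Type*} [Finite V] (E S : Finset (Sym2 V))
    (hE : ∀ e ∈ E, ¬ e.IsDiag) :
    unifProb (fun G : SimpleGraph V => ∀ e ∈ E, e ∈ G.edgeSet ↔ e ∈ S) ≤ (1 / 2) ^ E.card := by
  classical
  have h0 : (0 : ℝ) < Nat.card (SimpleGraph V) := by exact_mod_cast Nat.card_pos
  unfold unifProb
  rw [div_le_iff₀ h0, one_div, inv_pow, ← div_eq_inv_mul, le_div_iff₀ (by positivity)]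
  have hcard : Nat.card {X // X ∈ E.powerset} = 2 ^ E.card := by
    rw [Nat.card_eq_fintype_card, Fintype.card_coe, Finset.card_powerset]
  have : Nat.card ({G : SimpleGraph V // ∀ e ∈ E, e ∈ G.edgeSet ↔ e ∈ S} × {X // X ∈ E.powerset}) ≤
      Nat.card (SimpleGraph V) := by
    refine Nat.card_le_card_of_injective
      (fun x => SimpleGraph.fromEdgeSet ((x.1.1.edgeSet \ E) ∪ x.2.1)) ?_
    rintro ⟨⟨G, hG⟩, ⟨X, hX⟩⟩ ⟨⟨G', hG'⟩, ⟨X', hX'⟩⟩ h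
    have hX := Finset.mem_powerset.1 hX
    have hX' := Finset.mem_powerset.1 hX'
    have hd : ∀ e : Sym2 V, ¬ e.IsDiag → ((e ∈ G.edgeSet ∧ e ∉ E) ∨ e ∈ X ↔
        (e ∈ G'.edgeSet ∧ e ∉ E) ∨ e ∈ X') := by
      intro e he
      have := congrArg (fun H : SimpleGraph V => e ∈ H.edgeSet) h
      simpa [SimpleGraph.edgeSet_fromEdgeSet, he] using this
    have hXX : X = X' := by
      ext e
      constructor
      · intro he
        have := (hd e (hE e (hX he))).1 (Or.inr he)
        exact this.resolve_left fun h => h.2 (hX he)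
      · intro he
        have := (hd e (hE e (hX' he))).2 (Or.inr he)
        exact this.resolve_left fun h => h.2 (hX' he)
    have hGG : G = G' := by
      rw [← SimpleGraph.edgeSet_inj]
      ext e
      by_cases he : e ∈ E
      · rw [hG e he, hG' e he]
      by_cases hdiag : e.IsDiag
      · exact iff_of_false (fun h => G.not_isDiag_of_mem_edgeSet h hdiag)
          (fun h => G'.not_isDiag_of_mem_edgeSet h hdiag)
      · have := hd e hdiag
        have h1 : e ∉ X := fun h => he (hX h)
        have h2 : e ∉ X' := fun h => he (hX' h)
        simpa [he, h1, h2] using this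
    subst hXX hGG
    rfl
  rw [Nat.card_prod, hcard] at this
  exact_mod_cast this

/-- With `L` the number of bits of `n`, there are at most `2 ^ (6 * L ^ 2)` candidates for a complete
bipartite subgraph with `3 * L` vertices on each side, and each has `9 * L ^ 2` edges. -/
theorem unifProb_not_bicliqueFree_le (n : ℕ) (hn : 0 < n) :
    unifProb (fun G : SimpleGraph (Fin n) => ¬ BicliqueFree G.Adj (3 * n.size)) ≤
      1 / (n : ℝ) := by
  classical
  set L := n.size with hL
  set r := 3 * L with hr
  have hnL : n < 2 ^ L := Nat.lt_size_self n
  set Q := (Finset.powersetCard r (Finset.univ : Finset (Fin n)))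
  have step : unifProb (fun G : SimpleGraph (Fin n) => ¬ BicliqueFree G.Adj r) ≤
      ∑ z ∈ Q ×ˢ Q,
        unifProb (fun G : SimpleGraph (Fin n) => ∀ i ∈ z.1, ∀ j ∈ z.2, G.Adj i j) := by
    refine (unifProb_mono fun G hG => ?_).trans (unifProb_exists_le _ _)
    unfold BicliqueFree at hG
    push Not at hG
    obtain ⟨A, B, hA, hB, h⟩ := hG
    obtain ⟨A', hA', hAr⟩ := Finset.exists_subset_card_eq hA
    obtain ⟨B', hB', hBr⟩ := Finset.exists_subset_card_eq hB
    refine ⟨(A', B'), ?_, fun i hi j hj => h i (hA' hi) j (hB' hj)⟩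
    simp [Q, Finset.mem_powersetCard, hAr, hBr]
  have one : ∀ z ∈ Q ×ˢ Q, unifProb (fun G : SimpleGraph (Fin n) =>
      ∀ i ∈ z.1, ∀ j ∈ z.2, G.Adj i j) ≤ (1 / 2) ^ (r * r) := by
    rintro ⟨A, B⟩ hz
    simp only [Q, Finset.mem_product, Finset.mem_powersetCard, Finset.subset_univ,
      true_and] at hz
    by_cases hdis : Disjoint A B
    · set E : Finset (Sym2 (Fin n)) := (A ×ˢ B).image fun z => s(z.1, z.2) with hE
      have hc : E.card = r * r := by
        rw [hE, Finset.card_image_of_injOn, Finset.card_product, hz.1, hz.2]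
        rintro ⟨a, b⟩ h ⟨a', b'⟩ h' hab
        simp only [Finset.coe_product, Set.mem_prod, Finset.mem_coe] at h h'
        rcases Sym2.eq_iff.1 hab with h1 | h1
        · exact Prod.ext h1.1 h1.2
        · have h2 : a = b' := h1.1
          exact absurd (h2 ▸ h.1) (Finset.disjoint_right.1 hdis h'.2)
      rw [← hc]
      refine (unifProb_mono fun G hG => ?_).trans (unifProb_edges_le E E ?_)
      · intro e he
        refine iff_of_true ?_ he
        obtain ⟨z, hz, rfl⟩ := Finset.mem_image.1 he
        rw [Finset.mem_product] at hz
        exact hG _ hz.1 _ hz.2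
      · intro e he
        obtain ⟨z, hz, rfl⟩ := Finset.mem_image.1 he
        rw [Finset.mem_product] at hz
        rw [Sym2.mk_isDiag_iff]
        exact fun h => Finset.disjoint_left.1 hdis hz.1 (h ▸ hz.2)
    · obtain ⟨a, ha, hb⟩ := Finset.not_disjoint_iff.1 hdis
      refine (unifProb_mono (q := fun _ => False) fun G hG => G.irrefl (hG a ha a hb)).trans ?_
      simp [unifProb]
  have hcard : ((Q ×ˢ Q).card : ℝ) ≤ 2 ^ (L * r) * 2 ^ (L * r) := by
    have : Q.card ≤ 2 ^ (L * r) := by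
      rw [Finset.card_powersetCard, Finset.card_univ, Fintype.card_fin, pow_mul]
      exact (Nat.choose_le_pow n r).trans (Nat.pow_le_pow_left hnL.le r)
    rw [Finset.card_product]
    exact_mod_cast Nat.mul_le_mul this this
  refine step.trans ((Finset.sum_le_card_nsmul _ _ _ one).trans ?_)
  rw [nsmul_eq_mul]
  have hL1 : 1 ≤ L := Nat.size_pos.2 hn
  have hn0 : (0 : ℝ) < n := by exact_mod_cast hn
  calc ((Q ×ˢ Q).card : ℝ) * (1 / 2) ^ (r * r)
      ≤ (2 ^ (L * r) * 2 ^ (L * r)) * (1 / 2) ^ (r * r) := by gcongr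
    _ = 1 / 2 ^ (3 * (L * L)) := by
        have : r * r = L * r + L * r + 3 * (L * L) := by rw [hr]; ring
        rw [this, pow_add, pow_add, one_div, inv_pow, inv_pow]
        field_simp
    _ ≤ 1 / n := by
        refine one_div_le_one_div_of_le hn0 ?_
        have : n ≤ 2 ^ (3 * (L * L)) := hnL.le.trans (Nat.pow_le_pow_right two_pos (by nlinarith))
        exact_mod_cast this

/-- A vertex outside of the clique is, most probably, not adjacent to at least a quarter of its
vertices. -/
theorem unifProb_few_nonneighbours_le {C : Finset (Fin n)} {v : Fin n} (hv : v ∉ C) :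
    unifProb (fun G : SimpleGraph (Fin n) => ∃ S ⊆ C, 4 * S.card < C.card ∧
      ∀ u ∈ C, G.Adj v u ↔ u ∉ S) ≤ (9 / 10) ^ C.card := by
  classical
  have step : unifProb (fun G : SimpleGraph (Fin n) => ∃ S ⊆ C, 4 * S.card < C.card ∧
      ∀ u ∈ C, G.Adj v u ↔ u ∉ S) ≤ ∑ S ∈ C.powerset with 4 * S.card < C.card,
        unifProb (fun G : SimpleGraph (Fin n) => ∀ u ∈ C, G.Adj v u ↔ u ∉ S) := by
    refine (unifProb_mono fun G hG => ?_).trans (unifProb_exists_le _ _)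
    obtain ⟨S, h1, h2, h3⟩ := hG
    exact ⟨S, by simp [h1, h2], h3⟩
  have hinj : Function.Injective fun u : Fin n => s(v, u) := fun u u' h =>
    Sym2.congr_right.1 h
  have one : ∀ S : Finset (Fin n), unifProb (fun G : SimpleGraph (Fin n) =>
      ∀ u ∈ C, G.Adj v u ↔ u ∉ S) ≤ (1 / 2) ^ C.card := fun S => by
    rw [← Finset.card_image_of_injective C hinj]
    refine (unifProb_mono fun G hG => ?_).trans
      (unifProb_edges_le _ ((Finset.univ \ S).image fun u => s(v, u)) ?_)
    · intro e he
      obtain ⟨u, hu, rfl⟩ := Finset.mem_image.1 he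
      rw [SimpleGraph.mem_edgeSet, hG u hu, Finset.mem_image]
      constructor
      · exact fun h => ⟨u, by simpa using h, rfl⟩
      · rintro ⟨u', h, h'⟩
        rw [← hinj h']
        simpa using h
    · intro e he
      obtain ⟨u, hu, rfl⟩ := Finset.mem_image.1 he
      rw [Sym2.mk_isDiag_iff]
      rintro rfl
      exact hv hu
  -- a set with less than a quarter of the elements is counted with weight `y ^ (4 |S| - |C|) ≥ 1`,
  -- where `y = 3 / 4`
  have count : ((C.powerset.filter fun S => 4 * S.card < C.card).card : ℝ) ≤ (9 / 5) ^ C.card := by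
    rw [Finset.card_filter]
    push_cast
    calc ∑ S ∈ C.powerset, (if 4 * S.card < C.card then (1 : ℝ) else 0)
        ≤ ∑ S ∈ C.powerset, (4 / 3) ^ C.card * (81 / 256) ^ S.card :=
          Finset.sum_le_sum fun S hS => by
            split_ifs with h
            · have e : (81 / 256 : ℝ) ^ S.card = (3 / 4) ^ (4 * S.card) := by
                rw [pow_mul]; norm_num
              rw [e]
              have h1 : (3 / 4 : ℝ) ^ C.card ≤ (3 / 4) ^ (4 * S.card) :=
                pow_le_pow_of_le_one (by norm_num) (by norm_num) h.le
              calc (1 : ℝ) = (4 / 3) ^ C.card * (3 / 4) ^ C.card := by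
                    rw [← mul_pow]; norm_num
                _ ≤ _ := by gcongr
            · positivity
      _ = ((4 / 3) * (81 / 256 + 1)) ^ C.card := by
          rw [← Finset.mul_sum, mul_pow]
          congr 1
          rw [Finset.sum_pow_mul_eq_add_pow (81 / 256 : ℝ) 1 C |>.symm]
          simp
      _ ≤ (9 / 5) ^ C.card := by gcongr; norm_num
  refine step.trans ((Finset.sum_le_card_nsmul _ _ _ fun S _ => one S).trans ?_)
  rw [nsmul_eq_mul]
  calc _ ≤ (9 / 5 : ℝ) ^ C.card * (1 / 2) ^ C.card := by gcongr
    _ = (9 / 10) ^ C.card := by rw [← mul_pow]; norm_num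

end RandomGraph

/-! ### Good solutions have weight on the edges -/

theorem graphInstance_expectedValue {δ : ℝ} {K den N : ℕ} {adj : Fin N → Fin N → Prop}
    (hK : 0 < K) (hden : 0 < den) (hδ : 1 / (den : ℝ) ≤ δ) (q : Fin N → ℝ) :
    (graphInstance N adj hK hden hδ).expectedValue q =
      ∑ T, setProb q T * (graphFun K adj T : ℝ) := rfl

theorem Real.exp_neg_le_prod_one_sub {ι : Type*} (S : Finset ι) {x : ι → ℝ} {ε : ℝ}
    (h0 : ∀ i, 0 ≤ x i) (hx : ∀ i, x i ≤ 1 / 2) (hε : ∀ i, 2 * x i ≤ ε) :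
    Real.exp (-((1 + ε) * ∑ i ∈ S, x i)) ≤ ∏ i ∈ S, (1 - x i) := by
  rw [Finset.mul_sum, ← Finset.sum_neg_distrib, Real.exp_sum]
  refine Finset.prod_le_prod (fun i _ => (Real.exp_pos _).le) fun i _ => ?_
  have h1 := h0 i
  have h2 := hx i
  have h3 := hε i
  rw [Real.exp_neg, inv_le_comm₀ (Real.exp_pos _) (by linarith)]
  have h4 : (1 + ε) * x i + 1 ≤ Real.exp ((1 + ε) * x i) := Real.add_one_le_exp _
  refine le_trans ?_ h4
  rw [inv_le_iff_one_le_mul₀ (by linarith)]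
  nlinarith [mul_nonneg h1 h1, mul_nonneg h1 (sub_nonneg.2 h3),
    mul_nonneg (mul_nonneg h1 (sub_nonneg.2 h3)) (sub_nonneg.2 (h2.trans (by norm_num : (1:ℝ)/2 ≤ 1))),
    mul_nonneg (mul_nonneg h1 h1) (sub_nonneg.2 h2)]

/-- The value of a uniform solution on an almost complete subgraph with `m ^ l` elements. -/
theorem le_sum_setProb_graphFun_core {N K m l b : ℕ} {adj : Fin N → Fin N → Prop} {k : ℝ}
    (hK : 2 ≤ K) (hadj : ∀ x, ¬ adj x x) (hk : 0 < k) (hm : 0 < m) (hl : l ≠ 0)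
    (hkm : k ≤ (m : ℝ) ^ l) {D : Finset (Fin N)} (hD : D.card = m ^ l)
    [DecidableRel adj] (hD' : ((D ×ˢ D).filter fun z => ¬ adj z.1 z.2).card * m ≤ b * D.card ^ 2) :
    1 - (k / 2 + 1) * Real.exp (-k) - k / 2 * Real.exp (-k) * (Real.exp (k / m) - 1) -
      k ^ 2 * b / m ≤
    ∑ T, setProb (fun i => if i ∈ D then k / (m : ℝ) ^ l else 0) T * (graphFun K adj T : ℝ) := by
  have hm0 : (0 : ℝ) < m := by exact_mod_cast hm
  have hm1 : (1 : ℝ) ≤ m := by exact_mod_cast hm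
  have hM : (0 : ℝ) < (m : ℝ) ^ l := by positivity
  set M : ℝ := (m : ℝ) ^ l with hMdef
  have hDM : (D.card : ℝ) = M := by rw [hD]; push_cast; rfl
  have hD1 : 1 ≤ D.card := by rw [hD]; exact Nat.pos_of_ne_zero (by positivity)
  have hmM : (m : ℝ) ≤ M := le_self_pow₀ hm1 hl
  set c := k / M with hc
  have hc0 : 0 ≤ c := by positivity
  have hc1 : c ≤ 1 := (div_le_one hM).2 hkm
  refine le_trans ?_ (le_sum_setProb_graphFun_indicator hK hc0 hc1
    fun x y h hxy => hadj x (by rw [← hxy] at h; exact h))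
  have hcM : M * c = k := by rw [hc]; field_simp
  have e1 : 1 - c ≤ Real.exp (-c) := by
    have := Real.add_one_le_exp (-c)
    linarith
  have t1 : (1 - c) ^ D.card ≤ Real.exp (-k) := by
    calc (1 - c) ^ D.card ≤ Real.exp (-c) ^ D.card := pow_le_pow_left₀ (by linarith) e1 _
      _ = Real.exp (-k) := by
        rw [← Real.exp_nat_mul, hDM, mul_neg, hcM]
  have t2 : (1 - c) ^ (D.card - 1) ≤ Real.exp (-k) * Real.exp (k / m) := by
    calc (1 - c) ^ (D.card - 1) ≤ Real.exp (-c) ^ (D.card - 1) :=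
          pow_le_pow_left₀ (by linarith) e1 _
      _ = Real.exp (-k + c) := by
        rw [← Real.exp_nat_mul, Nat.cast_sub hD1, hDM, Nat.cast_one]
        congr 1
        rw [sub_mul, mul_neg, hcM]
        ring
      _ ≤ Real.exp (-k + k / m) := by
        refine Real.exp_le_exp.2 (add_le_add le_rfl ?_)
        exact div_le_div_of_nonneg_left hk.le hm0 hmM
      _ = _ := Real.exp_add _ _
  have t3 : c ^ 2 * ((D ×ˢ D).filter fun z => ¬ adj z.1 z.2).card ≤ k ^ 2 * b / m := by
    rw [le_div_iff₀ hm0]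
    have h1 : (((D ×ˢ D).filter fun z => ¬ adj z.1 z.2).card : ℝ) * m ≤ b * M ^ 2 := by
      rw [← hDM]
      exact_mod_cast hD'
    calc c ^ 2 * ((D ×ˢ D).filter fun z => ¬ adj z.1 z.2).card * m =
          c ^ 2 * (((D ×ˢ D).filter fun z => ¬ adj z.1 z.2).card * m) := by ring
      _ ≤ c ^ 2 * (b * M ^ 2) := by gcongr
      _ = (M * c) ^ 2 * b := by ring
      _ = k ^ 2 * b := by rw [hcM]
  rw [hDM, hcM]
  have t4 : k * (1 - c) ^ (D.card - 1) ≤ k * (Real.exp (-k) * Real.exp (k / m)) := by gcongr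
  nlinarith

section Rounding

variable {N U : ℕ} {x y : ℕ}

theorem RAM.quant_div_le (hU : 0 < U) : (RAM.quant N U x y : ℝ) / U ≤ (x : ℝ) / y := by
  have hU' : (0 : ℝ) < U := by exact_mod_cast hU
  rw [div_le_iff₀ hU']
  calc (RAM.quant N U x y : ℝ) ≤ ((x * U / y : ℕ) : ℝ) := by exact_mod_cast Nat.min_le_right _ _
    _ ≤ ((x * U : ℕ) : ℝ) / y := Nat.cast_div_le
    _ = (x : ℝ) / y * U := by push_cast; ring

theorem RAM.le_quant_div (hU : 0 < U) (h : (x : ℝ) / y ≤ N / U) :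
    (x : ℝ) / y ≤ (RAM.quant N U x y : ℝ) / U + 1 / U := by
  have hU' : (0 : ℝ) < U := by exact_mod_cast hU
  rw [← add_div, le_div_iff₀ hU']
  rw [le_div_iff₀ hU'] at h
  have e : (x : ℝ) / y * U = ((x * U : ℕ) : ℝ) / y := by push_cast; ring
  rw [e] at h ⊢
  have h1 : x * U / y ≤ N := by exact_mod_cast (Nat.cast_div_le (α := ℝ)).trans h
  rw [RAM.quant, min_eq_right h1, ← Nat.floor_div_eq_div (K := ℝ)]
  exact (Nat.lt_floor_add_one _).le

end Rounding

/-- An approximate solution passes the test, if the graph has an almost complete subgraph. -/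
theorem passes_of_isApprox {δ : ℝ} {K den N E kk m l b : ℕ} {t x y : ℕ → ℕ} {k c : ℝ}
    (hK : 2 ≤ K) (hK' : 0 < K) (hden : 0 < den) (hδ : 1 / (den : ℝ) ≤ δ) (hN : 0 < N)
    (hadj : ∀ x, ¬ tableAdj N t x x) (hk : 0 < k) (hc : 0 ≤ c) (hm : 0 < m) (hl : l ≠ 0)
    (hkm : k * den ≤ (m : ℝ) ^ l) (hkk : k ≤ kk) (hE : 0 < E)
    (hcore : HasCore (tableAdj N t) m l b)
    (hbound : 1 / E + 2 * k / den ≤ c * (1 - (k / 2 + 1) * Real.exp (-k) -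
      k / 2 * Real.exp (-k) * (Real.exp (k / m) - 1) - k ^ 2 * b / m) - 1 +
      Real.exp (-((1 + 1 / den) * (k / 2))) - (1 / 2) ^ K)
    (h : (graphInstance N (tableAdj N t) hK' hden hδ).IsApprox k c
      fun i => (x i : ℝ) / y i) : RAM.Passes N den E kk t x y := by
  classical
  have hd0 : (0 : ℝ) < den := by exact_mod_cast hden
  have hd1 : (1 : ℝ) ≤ den := by exact_mod_cast hden
  have hN0 : (0 : ℝ) < N := by exact_mod_cast hN
  have hE0 : (0 : ℝ) < E := by exact_mod_cast hE
  have hU : 0 < N * den := by positivity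
  have hU' : (0 : ℝ) < (N * den : ℕ) := by exact_mod_cast hU
  obtain ⟨⟨h1, h2⟩, h3⟩ := h
  set q : Fin N → ℝ := fun i => (x i : ℝ) / y i with hq
  have hsum : ∑ i, q i ≤ k := h2
  have hq0 : ∀ i, 0 ≤ q i := fun i => (h1 i).1
  have hqp : ∀ i, q i ≤ 1 / den := fun i => by
    have := (h1 i).2
    change q i ≤ (((1 / (den : ℚ≥0)) : ℚ≥0) : ℝ) at this
    simpa using this
  have hden1 : 1 / (den : ℝ) ≤ 1 := (div_le_one hd0).2 hd1
  -- the value of the optimum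
  obtain ⟨D, hD, hD'⟩ := hcore
  have hM : (0 : ℝ) < (m : ℝ) ^ l := by
    have : (0 : ℝ) < m := by exact_mod_cast hm
    positivity
  have hkm' : k ≤ (m : ℝ) ^ l := le_trans (le_mul_of_one_le_right hk.le hd1) hkm
  have opt := le_sum_setProb_graphFun_core (K := K) hK hadj hk hm hl hkm' hD
    (le_trans (le_of_eq (by congr!)) hD')
  rw [← graphInstance_expectedValue hK' hden hδ] at opt
  have hfeas : (graphInstance N (tableAdj N t) hK' hden hδ).Feasible k
      (fun i : Fin N => if i ∈ D then k / (m : ℝ) ^ l else 0) := by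
    refine ⟨fun i => ?_, ?_⟩
    · change _ ∧ _ ≤ (((1 / (den : ℚ≥0)) : ℚ≥0) : ℝ)
      push_cast
      split_ifs
      · refine ⟨by positivity, ?_⟩
        rw [div_le_div_iff₀ hM hd0, one_mul]
        exact hkm
      · exact ⟨le_rfl, by positivity⟩
    · change ∑ i : Fin N, (if i ∈ D then k / (m : ℝ) ^ l else 0) ≤ k
      rw [← Finset.sum_filter, Finset.sum_const, Finset.filter_mem_eq_inter, Finset.univ_inter, hD,
        nsmul_eq_mul]
      push_cast
      rw [mul_div_cancel₀ _ hM.ne']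
  have happ := h3 _ hfeas
  -- the value of the solution
  have val := sum_setProb_graphFun_le (K := K) (adj := tableAdj N t) hq0
    (fun i => (hqp i).trans hden1) fun x y h hxy => hadj x (by rw [← hxy] at h; exact h)
  rw [← graphInstance_expectedValue hK' hden hδ] at val
  have hprod : Real.exp (-((1 + 1 / den) * (k / 2))) ≤ ∏ i, (1 - q i / 2) := by
    refine le_trans (Real.exp_le_exp.2 (neg_le_neg ?_)) (Real.exp_neg_le_prod_one_sub Finset.univ
      (x := fun i => q i / 2) (ε := 1 / den) (fun i => by have := hq0 i; positivity)
      (fun i => ?_) fun i => ?_)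
    · rw [← Finset.sum_div]
      gcongr
    · have := hqp i
      linarith
    · have := hqp i
      linarith
  have hW : 1 / E + 2 * k / den ≤ adjWeight (tableAdj N t) q := by
    have h4 := mul_le_mul_of_nonneg_left opt hc
    have h5 : (∑ x, ∑ y, if tableAdj N t x y then q x * q y else 0) =
        adjWeight (tableAdj N t) q := by
      unfold adjWeight
      congr!
    rw [h5] at val
    have h6 := (h4.trans happ).trans val
    linarith
  -- rounding loses little
  rw [RAM.passes_iff hU]
  have hle : ∀ i : Fin N, (RAM.quant N (N * den) (x i) (y i) : ℝ) / (N * den : ℕ) ≤ q i :=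
    fun i => RAM.quant_div_le hU
  have hge : ∀ i : Fin N, q i ≤
      (RAM.quant N (N * den) (x i) (y i) : ℝ) / (N * den : ℕ) + 1 / (N * den : ℕ) :=
    fun i => RAM.le_quant_div hU ((hqp i).trans (le_of_eq (by push_cast; field_simp)))
  refine ⟨(Finset.sum_le_sum fun i _ => hle i).trans (hsum.trans hkk), ?_⟩
  set u : Fin N → ℝ := fun i => (RAM.quant N (N * den) (x i) (y i) : ℝ) / (N * den : ℕ) with hu
  have hu0 : ∀ i, 0 ≤ u i := fun i => by positivity
  have hloss : adjWeight (tableAdj N t) q ≤ adjWeight (tableAdj N t) u + 2 * k / den := by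
    have hε : (0 : ℝ) ≤ 1 / (N * den : ℕ) := by positivity
    have hpt : ∀ i j : Fin N, (if tableAdj N t i j then q i * q j else 0) ≤
        (if tableAdj N t i j then u i * u j else 0) +
          (q i * (1 / (N * den : ℕ)) + 1 / (N * den : ℕ) * q j) := by
      intro i j
      have a1 := mul_le_mul_of_nonneg_left (hge j) (hq0 i)
      have a2 := mul_le_mul_of_nonneg_right (hge i) (hu0 j)
      have a3 := mul_le_mul_of_nonneg_left (hle j) hε
      have a4 := mul_nonneg (hq0 i) hε
      have a5 := mul_nonneg hε (hq0 j)
      split_ifs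
      · simp only [hu] at *
        nlinarith
      · linarith
    calc adjWeight (tableAdj N t) q ≤ ∑ i, ∑ j, ((if tableAdj N t i j then u i * u j else 0) +
          (q i * (1 / (N * den : ℕ)) + 1 / (N * den : ℕ) * q j)) :=
          Finset.sum_le_sum fun i _ => Finset.sum_le_sum fun j _ => hpt i j
      _ = adjWeight (tableAdj N t) u + 2 * (N * (1 / (N * den : ℕ))) * ∑ i, q i := by
          simp only [Finset.sum_add_distrib, Finset.sum_const, Finset.card_univ, Fintype.card_fin,
            ← Finset.mul_sum, ← Finset.sum_mul, nsmul_eq_mul]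
          unfold adjWeight
          ring
      _ ≤ adjWeight (tableAdj N t) u + 2 * (N * (1 / (N * den : ℕ))) * k := by gcongr
      _ = _ := by
          push_cast
          field_simp
  have hfin : 1 / (E : ℝ) ≤ adjWeight (tableAdj N t) u := by linarith
  rwa [div_le_iff₀' hE0] at hfin

/-! ### Polynomial bounds -/

/-- The function is bounded by a polynomial. -/
def PolyBounded (f : ℕ → ℕ) : Prop := ∃ p : Polynomial ℕ, ∀ n, f n ≤ p.eval n

namespace PolyBounded

variable {f g : ℕ → ℕ}

theorem const (c : ℕ) : PolyBounded fun _ => c := ⟨Polynomial.C c, by simp⟩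

theorem id : PolyBounded fun n => n := ⟨Polynomial.X, by simp⟩

theorem mono (hg : PolyBounded g) (h : ∀ n, f n ≤ g n) : PolyBounded f := by
  obtain ⟨p, hp⟩ := hg
  exact ⟨p, fun n => (h n).trans (hp n)⟩

theorem add (hf : PolyBounded f) (hg : PolyBounded g) : PolyBounded fun n => f n + g n := by
  obtain ⟨p, hp⟩ := hf
  obtain ⟨q, hq⟩ := hg
  exact ⟨p + q, fun n => by rw [Polynomial.eval_add]; exact add_le_add (hp n) (hq n)⟩

theorem mul (hf : PolyBounded f) (hg : PolyBounded g) : PolyBounded fun n => f n * g n := by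
  obtain ⟨p, hp⟩ := hf
  obtain ⟨q, hq⟩ := hg
  exact ⟨p * q, fun n => by rw [Polynomial.eval_mul]; exact Nat.mul_le_mul (hp n) (hq n)⟩

theorem pow (hf : PolyBounded f) (i : ℕ) : PolyBounded fun n => f n ^ i := by
  obtain ⟨p, hp⟩ := hf
  exact ⟨p ^ i, fun n => by rw [Polynomial.eval_pow]; exact Nat.pow_le_pow_left (hp n) i⟩

theorem sum {ι : Type*} (S : Finset ι) {f : ι → ℕ → ℕ} (hf : ∀ i ∈ S, PolyBounded (f i)) :
    PolyBounded fun n => ∑ i ∈ S, f i n := by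
  classical
  induction S using Finset.induction_on with
  | empty => simpa using const 0
  | insert i S hi ih =>
    simp_rw [Finset.sum_insert hi]
    exact (hf i (Finset.mem_insert_self i S)).add
      (ih fun j hj => hf j (Finset.mem_insert_of_mem hj))

theorem eval (hf : PolyBounded f) (T : Polynomial ℕ) : PolyBounded fun n => T.eval (f n) := by
  simp_rw [Polynomial.eval_eq_sum]
  exact sum _ fun i _ => (const _).mul (hf.pow i)

theorem size (hf : PolyBounded f) : PolyBounded fun n => (f n).size :=
  hf.mono fun _ => Nat.size_le.2 Nat.lt_two_pow_self

theorem lvl (d : ℕ) : PolyBounded fun n => _root_.lvl n d := by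
  simp_rw [lvl_eq]
  exact id.pow _

theorem instSize (hf : PolyBounded f) (hg : PolyBounded g) (K : ℕ) :
    PolyBounded fun n => RAM.instSize K (f n) (g n) :=
  (hf.add (hf.mul ((const 1).add hg.size))).add (const _)

theorem cost (hf : PolyBounded f) (P : RAM.Prog) : PolyBounded fun n => P.cost (f n) := by
  induction P with
  | seq P Q ihP ihQ => exact ihP.add ihQ
  | cond a P Q ihP ihQ => exact (ihP.add ihQ).add (const 1)
  | loop a P ih => exact (hf.mul (ih.add (const 1))).add (const 1)
  | _ => exact const 1

end PolyBounded

namespace RAM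

/-- A number of rounds that suffices for the loops of a trial. -/
def rounds (D e K E : ℕ) (T : Polynomial ℕ) (n : ℕ) : ℕ :=
  lvl n (2 * D) * lvl n (2 * D) + (n ^ e + 1) + lvl n (2 * D) * n ^ e +
    instSize K (lvl n (2 * D)) (n ^ e) +
    ∑ i ∈ Finset.range (T.natDegree + 1), instSize K (lvl n (2 * D)) (n ^ e) ^ i +
    (2 * lvl n (2 * D) + 2 * T.eval (instSize K (lvl n (2 * D)) (n ^ e))) + E + n

theorem suffices_rounds (D e K E : ℕ) (T : Polynomial ℕ) (n : ℕ) :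
    Suffices D e K E T n (rounds D e K E T n) := by
  refine ⟨?_, ?_, ?_, ?_, fun i hi => ?_, ?_, ?_, ?_⟩
  pick_goal 5
  · refine (Finset.single_le_sum (f := fun i => instSize K (lvl n (2 * D)) (n ^ e) ^ i)
      (fun _ _ => Nat.zero_le _) (Finset.mem_range.2 (show i < T.natDegree + 1 by omega))).trans ?_
    unfold rounds
    omega
  all_goals unfold rounds; omega

theorem polyBounded_cliqueTime (D e K kk E M R : ℕ) (T : Polynomial ℕ) :
    PolyBounded fun n => cliqueTime D e K kk E M R T n (rounds D e K E T n) := by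
  have hl : PolyBounded fun n => lvl n (2 * D) := .lvl _
  have he : PolyBounded fun n => n ^ e := PolyBounded.id.pow e
  have hs : PolyBounded fun n => instSize K (lvl n (2 * D)) (n ^ e) := hl.instSize he K
  have hT : PolyBounded fun n => T.eval (instSize K (lvl n (2 * D)) (n ^ e)) := hs.eval T
  have hB : PolyBounded (rounds D e K E T) :=
    (((((((hl.mul hl).add (he.add (.const 1))).add (hl.mul he)).add hs).add
      (.sum _ fun i _ => hs.pow i)).add (((PolyBounded.const 2).mul hl).add
      ((PolyBounded.const 2).mul hT))).add (.const E)).add .id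
  have ht : PolyBounded fun n => trialTime D e K kk E M R T n (rounds D e K E T n) :=
    (hB.cost _).add ((hT.mul ((hB.cost _).add (.const 3))).add (hB.cost _))
  exact (PolyBounded.id.mul (((PolyBounded.const 1).add (((PolyBounded.id.mul
    (ht.add (.const 3))).add (.const 3)).add (.const 2))).add (.const 3))).add (.const 10)

/-- A program writes to finitely many arrays, so that the simulation zone can be cleared. -/
theorem Prog.exists_wa_lt (P : Prog) : ∃ M, ∀ A, P.wa A = true → A < M := by
  induction P with
  | store A a b => exact ⟨A + 1, fun x hx => by simp [Prog.wa] at hx; omega⟩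
  | seq P Q ihP ihQ =>
    obtain ⟨M, hM⟩ := ihP
    obtain ⟨M', hM'⟩ := ihQ
    refine ⟨max M M', fun x hx => ?_⟩
    simp only [Prog.wa, Bool.or_eq_true] at hx
    exact lt_max_iff.2 (hx.imp (hM x) (hM' x))
  | cond a P Q ihP ihQ =>
    obtain ⟨M, hM⟩ := ihP
    obtain ⟨M', hM'⟩ := ihQ
    refine ⟨max M M', fun x hx => ?_⟩
    simp only [Prog.wa, Bool.or_eq_true] at hx
    exact lt_max_iff.2 (hx.imp (hM x) (hM' x))
  | loop a P ih =>
    obtain ⟨M, hM⟩ := ih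
    exact ⟨M, hM⟩
  | _ => exact ⟨0, fun x hx => by simp [Prog.wa] at hx⟩

theorem Prog.exists_wr_lt (P : Prog) : ∃ R, ∀ a, P.wr a = true → a < R := by
  induction P with
  | seq P Q ihP ihQ =>
    obtain ⟨M, hM⟩ := ihP
    obtain ⟨M', hM'⟩ := ihQ
    refine ⟨max M M', fun x hx => ?_⟩
    simp only [Prog.wr, Bool.or_eq_true] at hx
    exact lt_max_iff.2 (hx.imp (hM x) (hM' x))
  | cond a P Q ihP ihQ =>
    obtain ⟨M, hM⟩ := ihP
    obtain ⟨M', hM'⟩ := ihQ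
    refine ⟨max M M', fun x hx => ?_⟩
    simp only [Prog.wr, Bool.or_eq_true] at hx
    exact lt_max_iff.2 (hx.imp (hM x) (hM' x))
  | loop a P ih =>
    obtain ⟨M, hM⟩ := ih
    exact ⟨M, hM⟩
  | query a b A => exact ⟨a + b + 1, fun x hx => by simp [Prog.wr] at hx; omega⟩
  | skip => exact ⟨0, fun x hx => by simp [Prog.wr] at hx⟩
  | store A a b => exact ⟨0, fun x hx => by simp [Prog.wr] at hx⟩
  | const a _ => exact ⟨a + 1, fun x hx => by simp [Prog.wr] at hx; omega⟩
  | plus a _ _ => exact ⟨a + 1, fun x hx => by simp [Prog.wr] at hx; omega⟩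
  | monus a _ _ => exact ⟨a + 1, fun x hx => by simp [Prog.wr] at hx; omega⟩
  | half a _ => exact ⟨a + 1, fun x hx => by simp [Prog.wr] at hx; omega⟩
  | load a _ _ => exact ⟨a + 1, fun x hx => by simp [Prog.wr] at hx; omega⟩

end RAM

/-! ### The threshold -/

theorem one_sub_mul_exp_neg_pos {k : ℝ} (hk : 0 < k) : 0 < 1 - (k / 2 + 1) * Real.exp (-k) := by
  have h := Real.add_one_le_exp k
  have h1 : Real.exp (-k) * Real.exp k = 1 := by rw [← Real.exp_add]; simp
  have h2 := Real.exp_pos (-k)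
  nlinarith [mul_pos h2 hk]

theorem abs_hardnessRatio_sub_lt : |hardnessRatio (17 / 10) - 0.865| < 0.0005 := by
  -- with `x = exp (- 17 / 20)`, the ratio is `(1 - x) / (1 - 1.85 x ^ 2)`
  have hx : |Real.exp (-(17 / 20)) - 0.427415| ≤ 0.000002 := by
    have h := Real.exp_bound (x := -(17 / 20)) (by norm_num [abs_le]) (n := 10) (by norm_num)
    norm_num [Finset.sum_range_succ, Nat.factorial] at h
    rw [abs_le] at h ⊢
    constructor <;> norm_num <;> linarith
  have e1 : Real.exp (-(17 / 10) / 2) = Real.exp (-(17 / 20)) := by congr 1; norm_num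
  have e2 : Real.exp (-(17 / 10)) = Real.exp (-(17 / 20)) ^ 2 := by
    rw [← Real.exp_nat_mul]; congr 1; norm_num
  rw [hardnessRatio, e1, e2]
  generalize Real.exp (-(17 / 20)) = x at hx
  rw [abs_le] at hx
  obtain ⟨h1, h2⟩ := hx
  have h3 : x ^ 2 ≤ 0.42742 ^ 2 := pow_le_pow_left₀ (by linarith) (by linarith) 2
  have h4 : 0.42741 ^ 2 ≤ x ^ 2 := pow_le_pow_left₀ (by norm_num) (by linarith) 2
  have hpos : 0 < 1 - (17 / 10 / 2 + 1) * x ^ 2 := by norm_num at h3 ⊢; linarith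
  rw [abs_lt, lt_sub_iff_add_lt, sub_lt_iff_lt_add, lt_div_iff₀ hpos, div_lt_iff₀ hpos]
  norm_num at h1 h2 h3 h4 ⊢
  constructor <;> linarith

/-! ### The choice of the parameters -/

/-- The number `n` of vertices is large enough for the reduction. Here `l = 2 ^ (2 * D)` is the
number of vertices in an element, all probabilities are `1 / n ^ e`, and a vertex outside of the
clique of size `κ` has `m ≥ κ / 4` vertices of the clique that are not its neighbours. -/
structure LargeEnough (k δ c : ℝ) (κ : ℕ) (K E a D n : ℕ) : Prop where
  pos : 0 < n
  cap : K - 1 ≤ n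
  prob : 1 / ((n ^ (a + 4) : ℕ) : ℝ) ≤ δ
  sparse : 4 * (2 ^ a * (3 * n.size) ^ 2 ^ (2 * D)) ≤ n
  budget : ∀ m : ℕ, κ ≤ 4 * m → k * (n ^ (a + 4) : ℕ) ≤ (m : ℝ) ^ 2 ^ (2 * D)
  dense : ∀ m : ℕ, κ ≤ 4 * m → 0 < m ∧ 1 / E + 2 * k / (n ^ (a + 4) : ℕ) ≤
    c * (1 - (k / 2 + 1) * Real.exp (-k) - k / 2 * Real.exp (-k) * (Real.exp (k / m) - 1) -
      k ^ 2 * (4 ^ (2 * D) : ℕ) / m) - 1 +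
      Real.exp (-((1 + 1 / (n ^ (a + 4) : ℕ)) * (k / 2))) - (1 / 2) ^ K

theorem tendsto_size_atTop : Tendsto Nat.size atTop atTop :=
  tendsto_atTop_mono' _ (Eventually.of_forall fun _ => le_rfl)
    (Filter.tendsto_atTop_atTop.2 fun s => ⟨2 ^ s, fun _ hn => (Nat.lt_size.2 hn).le⟩)

theorem eventually_mul_size_pow_le (A l : ℕ) :
    ∀ᶠ n : ℕ in atTop, 4 * (A * (3 * n.size) ^ l) ≤ n := by
  have h := tendsto_pow_const_div_const_pow_of_one_lt l (show (1 : ℝ) < 2 by norm_num)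
  have h' : ∀ᶠ s : ℕ in atTop, (s : ℝ) ^ l / 2 ^ s < 1 / (8 * (A + 1) * 3 ^ l) :=
    h.eventually (gt_mem_nhds (by positivity))
  filter_upwards [tendsto_size_atTop.eventually h', eventually_gt_atTop 0] with n hn h0
  rw [div_lt_div_iff₀ (by positivity) (by positivity), one_mul] at hn
  have h2 : (2 : ℝ) ^ n.size ≤ 2 * n := by exact_mod_cast Nat.two_pow_size_le h0
  have h3 : (4 * (A * (3 * n.size) ^ l) : ℝ) ≤ n := by
    rw [mul_pow]
    have : (0 : ℝ) ≤ (n.size : ℝ) ^ l * 3 ^ l := by positivity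
    nlinarith
  exact_mod_cast h3

theorem tendsto_floor_rpow_atTop {β : ℝ} (hβ : 0 < β) :
    Tendsto (fun n : ℕ => ⌊(n : ℝ) ^ β⌋₊) atTop atTop :=
  tendsto_nat_floor_atTop.comp ((tendsto_rpow_atTop hβ).comp tendsto_natCast_atTop_atTop)

/-- The probability that some vertex has too many neighbours in the clique tends to `0`. -/
theorem tendsto_mul_pow_floor_rpow {β : ℝ} (hβ : 0 < β) :
    Tendsto (fun n : ℕ => (n : ℝ) * (9 / 10) ^ ⌊(n : ℝ) ^ β⌋₊) atTop (𝓝 0) := by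
  obtain ⟨j, hj⟩ := exists_nat_ge (1 / β)
  rw [div_le_iff₀ hβ] at hj
  have h1 : Tendsto (fun x : ℕ => ((x + 1 : ℕ) : ℝ) ^ j * (9 / 10) ^ (x + 1)) atTop (𝓝 0) :=
    (tendsto_pow_const_mul_const_pow_of_abs_lt_one j (r := 9 / 10)
      (by norm_num [abs_lt])).comp (tendsto_add_atTop_nat 1)
  have h2 := (h1.comp (tendsto_floor_rpow_atTop hβ)).const_mul (10 / 9)
  rw [mul_zero] at h2
  refine tendsto_of_tendsto_of_tendsto_of_le_of_le' tendsto_const_nhds h2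
    (Eventually.of_forall fun n => by positivity) ?_
  filter_upwards [eventually_ge_atTop 1] with n hn
  have hn1 : (1 : ℝ) ≤ n := by exact_mod_cast hn
  set κ := ⌊(n : ℝ) ^ β⌋₊ with hκ
  have h3 : (n : ℝ) ^ β ≤ ((κ + 1 : ℕ) : ℝ) := by
    push_cast
    exact (Nat.lt_floor_add_one _).le
  have h4 : (n : ℝ) ≤ ((κ + 1 : ℕ) : ℝ) ^ j := by
    calc (n : ℝ) = (n : ℝ) ^ (1 : ℝ) := (Real.rpow_one _).symm
      _ ≤ (n : ℝ) ^ (β * j) := Real.rpow_le_rpow_of_exponent_le hn1 (by linarith)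
      _ = ((n : ℝ) ^ β) ^ j := by rw [Real.rpow_mul (by linarith), Real.rpow_natCast]
      _ ≤ _ := pow_le_pow_left₀ (by positivity) h3 j
  simp only [Function.comp]
  calc (n : ℝ) * (9 / 10) ^ κ ≤ ((κ + 1 : ℕ) : ℝ) ^ j * (9 / 10) ^ κ := by gcongr
    _ = 10 / 9 * (((κ + 1 : ℕ) : ℝ) ^ j * (9 / 10) ^ (κ + 1)) := by
      rw [pow_succ (9 / 10 : ℝ) κ]; ring

/-- The uniform vector on the tuples of length `l` is feasible, if `l` is large in terms of the
exponent `e` of the probabilities. -/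
theorem eventually_mul_pow_le_pow {β : ℝ} (hβ : 0 < β) (k : ℝ) {e l : ℕ}
    (hl : (e : ℝ) + 1 ≤ β * l) :
    ∀ᶠ n : ℕ in atTop, ∀ m : ℕ, ⌊(n : ℝ) ^ β⌋₊ ≤ 4 * m → k * (n ^ e : ℕ) ≤ (m : ℝ) ^ l := by
  filter_upwards [eventually_ge_atTop 1, (tendsto_floor_rpow_atTop hβ).eventually_ge_atTop 1,
    tendsto_natCast_atTop_atTop.eventually_ge_atTop (k * 5 ^ l)] with n hn hκ hk m hm
  have hn1 : (1 : ℝ) ≤ n := by exact_mod_cast hn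
  have hm1 : (1 : ℝ) ≤ m := by
    have : 1 ≤ m := by omega
    exact_mod_cast this
  have h3 : (n : ℝ) ^ β ≤ 5 * m := by
    have h4 : (⌊(n : ℝ) ^ β⌋₊ : ℝ) ≤ 4 * m := by exact_mod_cast hm
    have := (Nat.lt_floor_add_one ((n : ℝ) ^ β)).le
    linarith
  have h5 : (n : ℝ) * n ^ e ≤ 5 ^ l * (m : ℝ) ^ l := by
    calc (n : ℝ) * n ^ e = (n : ℝ) ^ ((e : ℝ) + 1) := by
          rw [Real.rpow_add (by linarith), Real.rpow_one, Real.rpow_natCast, mul_comm]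
      _ ≤ (n : ℝ) ^ (β * l) := Real.rpow_le_rpow_of_exponent_le hn1 hl
      _ = ((n : ℝ) ^ β) ^ l := by rw [Real.rpow_mul (by linarith), Real.rpow_natCast]
      _ ≤ (5 * (m : ℝ)) ^ l := pow_le_pow_left₀ (by positivity) h3 l
      _ = _ := mul_pow _ _ _
  have h6 : k * 5 ^ l * (n : ℝ) ^ e ≤ n * n ^ e := by gcongr
  have h7 : (5 : ℝ) ^ l * (k * (n : ℝ) ^ e) ≤ 5 ^ l * (m : ℝ) ^ l := by linarith
  push_cast
  exact le_of_mul_le_mul_left h7 (by positivity)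

/-- The gap `η = c * (1 - (k / 2 + 1) * exp (-k)) - (1 - exp (-k / 2))` is positive by the choice of
`c`. The parameters `K` and `E` depend on `η`, the exponent `e = a + 4` of the probabilities on `E`,
and the level `2 * D` of the power on `e`; each of the errors is at most `η / 8` for large `n`. -/
theorem exists_parameters {k δ c β : ℝ} (hk : 0 < k) (hδ : 0 < δ) (hc : hardnessRatio k < c)
    (hβ : 0 < β) : ∃ K E kk a D : ℕ, 2 ≤ K ∧ 0 < E ∧ 0 < kk ∧ k ≤ kk ∧ E * (kk * kk) ≤ 2 ^ a ∧
      0 < D ∧ ∀ᶠ n : ℕ in atTop, LargeEnough k δ c ⌊(n : ℝ) ^ β⌋₊ K E a D n := by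
  set A := 1 - (k / 2 + 1) * Real.exp (-k) with hA
  have hA0 : 0 < A := one_sub_mul_exp_neg_pos hk
  rw [hardnessRatio, div_lt_iff₀ hA0, neg_div] at hc
  obtain ⟨η, hη, hηe⟩ : ∃ η, 0 < η ∧ η = c * A - (1 - Real.exp (-(k / 2))) :=
    ⟨_, by linarith, rfl⟩
  obtain ⟨K, hK⟩ := exists_pow_lt_of_lt_one (show 0 < η / 8 by positivity)
    (show (1 / 2 : ℝ) < 1 by norm_num)
  obtain ⟨E, hE⟩ := exists_nat_gt (8 / η)
  have hE0 : 0 < (E : ℝ) := lt_trans (by positivity) hE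
  have hE' : 1 / (E : ℝ) ≤ η / 8 := by
    rw [div_lt_iff₀ hη] at hE
    rw [div_le_iff₀ hE0]
    linarith
  obtain ⟨D, hD⟩ := exists_nat_ge (((E * (⌈k⌉₊ * ⌈k⌉₊) + 4 : ℕ) + 1) / β)
  refine ⟨K + 2, E, ⌈k⌉₊, E * (⌈k⌉₊ * ⌈k⌉₊), D + 1, by omega, by exact_mod_cast hE0,
    Nat.ceil_pos.2 hk, Nat.le_ceil k, Nat.lt_two_pow_self.le, by omega, ?_⟩
  set a := E * (⌈k⌉₊ * ⌈k⌉₊) with ha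
  have hl : ((a + 4 : ℕ) : ℝ) + 1 ≤ β * (2 ^ (2 * (D + 1)) : ℕ) := by
    rw [div_le_iff₀ hβ] at hD
    have h1 : (D : ℝ) ≤ (2 ^ (2 * (D + 1)) : ℕ) := by
      have : D ≤ 2 ^ (2 * (D + 1)) := by
        have : 2 * (D + 1) < 2 ^ (2 * (D + 1)) := Nat.lt_two_pow_self
        omega
      exact_mod_cast this
    nlinarith
  -- the limits as `n` tends to infinity
  have hpow : Tendsto (fun n : ℕ => ((n ^ (a + 4) : ℕ) : ℝ)) atTop atTop :=
    tendsto_natCast_atTop_atTop.comp (tendsto_pow_atTop (by omega))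
  have hinv : Tendsto (fun n : ℕ => 1 / ((n ^ (a + 4) : ℕ) : ℝ)) atTop (𝓝 0) :=
    hpow.const_div_atTop 1
  have e1 : ∀ᶠ n : ℕ in atTop, 1 / ((n ^ (a + 4) : ℕ) : ℝ) ≤ δ :=
    (hinv.eventually (gt_mem_nhds hδ)).mono fun _ h => h.le
  have e2 : ∀ᶠ n : ℕ in atTop, 2 * k / ((n ^ (a + 4) : ℕ) : ℝ) ≤ η / 8 := by
    have : Tendsto (fun n : ℕ => 2 * k / ((n ^ (a + 4) : ℕ) : ℝ)) atTop (𝓝 0) :=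
      hpow.const_div_atTop _
    exact (this.eventually (gt_mem_nhds (by positivity))).mono fun _ h => h.le
  have e3 : ∀ᶠ n : ℕ in atTop, Real.exp (-(k / 2)) - η / 8 ≤
      Real.exp (-((1 + 1 / ((n ^ (a + 4) : ℕ) : ℝ)) * (k / 2))) := by
    have : Tendsto (fun n : ℕ => Real.exp (-((1 + 1 / ((n ^ (a + 4) : ℕ) : ℝ)) * (k / 2)))) atTop
        (𝓝 (Real.exp (-((1 + 0) * (k / 2))))) :=
      (Real.continuous_exp.tendsto _).comp ((hinv.const_add 1).mul_const _).neg
    rw [add_zero, one_mul] at this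
    exact (this.eventually (lt_mem_nhds (by linarith))).mono fun _ h => h.le
  have e4 : ∀ᶠ m : ℕ in atTop, c * A - η / 8 ≤ c * (A -
      k / 2 * Real.exp (-k) * (Real.exp (k / m) - 1) - k ^ 2 * (4 ^ (2 * (D + 1)) : ℕ) / m) := by
    have t1 : Tendsto (fun m : ℕ => k / (m : ℝ)) atTop (𝓝 0) :=
      tendsto_natCast_atTop_atTop.const_div_atTop _
    have t2 : Tendsto (fun m : ℕ => k ^ 2 * (4 ^ (2 * (D + 1)) : ℕ) / (m : ℝ)) atTop (𝓝 0) :=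
      tendsto_natCast_atTop_atTop.const_div_atTop _
    have t3 : Tendsto (fun m : ℕ => Real.exp (k / (m : ℝ))) atTop (𝓝 (Real.exp 0)) :=
      (Real.continuous_exp.tendsto _).comp t1
    have := (((t3.sub_const 1).const_mul (k / 2 * Real.exp (-k))).const_sub A).sub t2 |>.const_mul c
    rw [Real.exp_zero, sub_self, mul_zero, sub_zero, sub_zero] at this
    exact (this.eventually (lt_mem_nhds (by linarith))).mono fun _ h => h.le
  obtain ⟨m₀, hm₀⟩ := eventually_atTop.1 e4
  filter_upwards [eventually_gt_atTop 0, eventually_ge_atTop (K + 2 - 1), e1, e2, e3,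
    eventually_mul_size_pow_le (2 ^ a) (2 ^ (2 * (D + 1))), eventually_mul_pow_le_pow hβ k hl,
    (tendsto_floor_rpow_atTop hβ).eventually_ge_atTop (4 * m₀ + 4)] with n h1 h2 h3 h4 h5 h6 h7 h8
  refine ⟨h1, h2, h3, h6, h7, fun m hm => ⟨by omega, ?_⟩⟩
  have h9 := hm₀ m (by omega)
  have h10 : (1 / 2 : ℝ) ^ (K + 2) ≤ (1 / 2) ^ K :=
    pow_le_pow_of_le_one (by norm_num) (by norm_num) (by omega)
  rw [← hA]
  linarith

/-! ### The reduction -/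

/-- The program `P`, with the random bits `r`, solves the instance `I` approximately. -/
def SOSPInstance.Solves {δ : ℝ} (I : SOSPInstance δ) (k c : ℝ) (P : RAM.Prog) {m : ℕ}
    (r : Fin m → Bool) : Prop :=
  ∃ (t : ℕ) (s : RAM.State), RAM.Exec I.oracle P (I.start r) t s ∧ I.IsApprox k c (I.output s)

/-- The `j`-th block of `m` bits. -/
def bitBlock {M : ℕ} (r : Fin M → Bool) (m j : ℕ) : Fin m → Bool :=
  fun i => if h : j * m + i < M then r ⟨j * m + i, h⟩ else false

/-- Independent trials with disjoint blocks of bits rarely all fail. -/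
theorem unifProb_bitBlock_le {M m n : ℕ} (hM : n * m ≤ M) (p : (Fin m → Bool) → Prop) :
    unifProb (fun r : Fin M → Bool => ∀ j : Fin n, p (bitBlock r m j)) ≤ unifProb p ^ n := by
  have hlt : ∀ z : Fin n × Fin m, (z.1 : ℕ) * m + z.2 < M := fun z =>
    calc (z.1 : ℕ) * m + z.2 < z.1 * m + m := by have := z.2.2; omega
      _ = (z.1 + 1) * m := by ring
      _ ≤ n * m := Nat.mul_le_mul_right m z.1.2
      _ ≤ M := hM
  have hinj : Function.Injective fun z : Fin n × Fin m => (⟨z.1 * m + z.2, hlt z⟩ : Fin M) := by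
    intro z w h
    simp only [Fin.mk.injEq] at h
    have hm : 0 < m := z.2.pos
    have h1 : (z.1 : ℕ) = w.1 := by
      have := congrArg (· / m) h
      simpa [mul_comm _ m, Nat.mul_add_div hm, Nat.div_eq_of_lt] using this
    refine Prod.ext (Fin.ext h1) (Fin.ext ?_)
    rw [h1] at h
    omega
  have h1 := unifProb_comp_le hinj fun w => ∀ j : Fin n, p fun i => w (j, i)
  have h2 := unifProb_equiv (Equiv.curry (Fin n) (Fin m) Bool) fun w => ∀ j : Fin n, p (w j)
  have h3 := unifProb_forall (ι := Fin n) p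
  rw [Nat.card_fin] at h3
  rw [← h3, ← h2]
  refine le_trans (unifProb_mono fun r hr j => ?_) h1
  have := hr j
  unfold bitBlock at this
  simpa [hlt (j, _)] using this

section

variable {k δ c : ℝ} {P : RAM.Prog} {T : Polynomial ℕ} {K E kk a D n : ℕ}

/-- The instance of a vertex: the function is that of the power of the graph, restricted to the
vertices that are not adjacent to `v`. -/
noncomputable def vertexInstance (K e D : ℕ) (H : SimpleGraph (Fin n)) (v : ℕ) (hK : 0 < K)
    (hden : 0 < n ^ e) (hδ : 1 / ((n ^ e : ℕ) : ℝ) ≤ δ) : SOSPInstance δ :=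
  graphInstance (lvl n (2 * D)) (powAdj n v (adjRow H) (2 * D)) hK hden hδ

theorem vertexInstance_size {e : ℕ} (H : SimpleGraph (Fin n)) (v : Fin n) (hK : 2 ≤ K)
    (hK' : 0 < K) (hD : 0 < D) (hKn : K - 1 ≤ n) (hden : 0 < n ^ e)
    (hδ : 1 / ((n ^ e : ℕ) : ℝ) ≤ δ) :
    T.eval (vertexInstance K e D H v hK' hden hδ).size = RAM.numBits D e K n T := by
  obtain ⟨d, hd⟩ : ∃ d, 2 * D = d + 1 := ⟨2 * D - 1, by omega⟩
  rw [vertexInstance, graphInstance_size hK' hden hδ hK]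
  rw [hd]
  exact powAdj_exists_independent d hKn

theorem SOSPInstance.unifProb_not_solves_le (I : SOSPInstance δ) {m : ℕ} (hm : T.eval I.size = m)
    (h : (2 / 3 : ℝ) * 2 ^ (T.eval I.size) ≤ Nat.card {r : Fin (T.eval I.size) → Bool //
      ∃ (t : ℕ) (s : RAM.State),
        RAM.Exec I.oracle P (I.start r) t s ∧ I.IsApprox k c (I.output s)}) :
    unifProb (fun r : Fin m → Bool => ¬ I.Solves k c P r) ≤ 1 / 3 := by
  subst hm
  have h1 : 2 / 3 ≤ unifProb (fun r : Fin (T.eval I.size) → Bool => I.Solves k c P r) := by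
    unfold unifProb
    rw [Nat.card_fun, Nat.card_fin, Nat.card_eq_fintype_card (α := Bool), Fintype.card_bool]
    push_cast
    rw [le_div_iff₀ (by positivity)]
    exact h
  rw [unifProb_not]
  linarith

/-- What the program computes on the graph `H`: it accepts the vertices for which the restricted
graph has no large complete bipartite subgraph, and rejects those which have many non-neighbours
in a clique, provided that one of the trials solves the instance. -/
theorem runs_cliqueP {M R n₀ κ : ℕ} (hP : ∀ I : SOSPInstance δ,
      ∀ r : Fin (T.eval I.size) → Bool, ∃ (t : ℕ) (s : RAM.State),
        RAM.Exec I.oracle P (I.start r) t s ∧ t ≤ T.eval I.size)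
    (hk : 0 < k) (hc : 0 ≤ c) (hK : 2 ≤ K) (hK' : 0 < K) (hE : 0 < E) (hkk : 0 < kk)
    (hkkk : k ≤ kk) (hEa : E * (kk * kk) ≤ 2 ^ a) (hD : 0 < D)
    (hL : LargeEnough k δ c κ K E a D n) (hn₀ : n₀ ≤ n) (hden : 0 < n ^ (a + 4))
    (hM : 3 ≤ M) (hPM : ∀ A, P.wa A = true → A < M)
    (hR : 1 ≤ R) (hPR : ∀ a, P.wr a = true → a < R) (H : SimpleGraph (Fin n)) {B : ℕ}
    (r : Fin B → Bool) :
    RAM.Runs (RAM.cliqueP D (a + 4) K kk E M R n₀ P T) (PlantedClique.start H r)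
      (RAM.cliqueTime D (a + 4) K kk E M R T n (RAM.rounds D (a + 4) K E T n)) fun σ =>
      ∀ v : Fin n,
        (BicliqueFree (fun i j => H.Adj i j ∧ ¬ H.Adj v i ∧ ¬ H.Adj v j) (3 * n.size) →
          σ.arr 3 v ≠ 0) ∧
        ∀ C : Finset (Fin n), κ ≤ 4 * C.card →
          (∀ i ∈ C, ∀ j ∈ C, i ≠ j → H.Adj i j ∧ ¬ H.Adj v i ∧ ¬ H.Adj v j) →
          (∃ j : Fin n, (vertexInstance K (a + 4) D H v hK' hden hL.prob).Solves k c P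
            (bitBlock r (RAM.numBits D (a + 4) K n T) j)) → σ.arr 3 v = 0 := by
  classical
  set m := RAM.numBits D (a + 4) K n T with hm
  have hstart : ∀ (v : ℕ) (ρ : Fin m → Bool),
      (vertexInstance K (a + 4) D H v hK' hden hL.prob).start ρ =
        RAM.simStart D (a + 4) n ρ := fun v ρ => graphInstance_start hK' hden hL.prob ρ
  have hfin : ∀ v j : ℕ, ∃ s : RAM.State, v < n → j < n → ∃ τ ≤ m,
      RAM.Exec (vertexInstance K (a + 4) D H v hK' hden hL.prob).oracle P
        (RAM.simStart D (a + 4) n (bitBlock r m j)) τ s := by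
    intro v j
    by_cases hv : v < n
    · have h1 := hP (vertexInstance K (a + 4) D H v hK' hden hL.prob)
      rw [vertexInstance_size H ⟨v, hv⟩ hK hK' hD hL.cap hden hL.prob] at h1
      obtain ⟨τ, s, h2, h3⟩ := h1 (bitBlock r m j)
      rw [hstart] at h2
      exact ⟨s, fun _ _ => ⟨τ, h3, h2⟩⟩
    · exact ⟨PlantedClique.start H r, fun h => absurd h hv⟩
  choose fin hfin using hfin
  have run := RAM.Runs.cliqueP (P := P) (T := T) (s := PlantedClique.start H r) (a := adjRow H)
    (b := fun i => if h : i < B then (r ⟨i, h⟩).toNat else 0) (kk := kk) (E := E) (M := M) (R := R)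
    hL.pos hn₀ (RAM.suffices_rounds D (a + 4) K E T n) hM hPM hR hPR
    (O := fun v => (vertexInstance K (a + 4) D H v hK' hden hL.prob).oracle)
    (fun v _ X => graphInstance_oracle hK' hden hL.prob (powTab n v (adjRow H) (2 * D)) X)
    (fun j => bitBlock r m j) (fun j hj i => ?_) fin (fun v hv j hj => hfin v j hv hj)
    rfl (fun x hx => if_neg hx) (fun A x => rfl) rfl rfl
  swap
  · unfold bitBlock
    split_ifs <;> rfl
  obtain ⟨τ, σ, hx, hτ, hσ⟩ := run
  refine ⟨τ, σ, hx, hτ, fun v => ⟨fun hfree => ?_, fun C hC hclique ⟨j, t, s, hs, happ⟩ => ?_⟩⟩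
  · rw [hσ v v.2, if_neg]
    · exact one_ne_zero
    · rintro ⟨j, -, hpass⟩
      exact not_passes_of_bicliqueFree (lvl_pos hL.pos _) hL.sparse hL.pos hEa hkk
        (powAdj_hasSupport (G := H) (v := v) (2 * D)) hfree hpass
  · rw [hσ v v.2, if_pos]
    refine ⟨j, j.2, ?_⟩
    obtain ⟨τ', -, hx'⟩ := hfin v j v.2 j.2
    rw [hstart] at hs
    obtain ⟨-, rfl⟩ := hx'.unique hs
    exact passes_of_isApprox hK hK' hden hL.prob (lvl_pos hL.pos _)
      (powAdj_irrefl (G := H) (v := v) (2 * D)) hk hc (hL.dense _ hC).1 (by positivity)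
      (hL.budget _ hC) hkkk hE (powAdj_hasCore (2 * D) C hclique) (hL.dense _ hC).2 happ

/-- The program finds the planted clique, unless the random graph has a large complete bipartite
subgraph, or a vertex has too many neighbours in the clique, or all trials for a vertex fail. -/
theorem output_eq_of_good {κ : ℕ} {G : SimpleGraph (Fin n)} {C : Finset (Fin n)} (hC : C.card = κ)
    {σ : RAM.State} {S : Fin n → Prop} (h1 : BicliqueFree G.Adj (3 * n.size))
    (h2 : ∀ v ∉ C, ¬ ∃ S ⊆ C, 4 * S.card < C.card ∧ ∀ u ∈ C, G.Adj v u ↔ u ∉ S)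
    (h3 : ∀ v, S v)
    (hσ : ∀ v : Fin n,
      (BicliqueFree (fun i j => (PlantedClique.plant G C).Adj i j ∧
        ¬ (PlantedClique.plant G C).Adj v i ∧ ¬ (PlantedClique.plant G C).Adj v j)
        (3 * n.size) → σ.arr 3 v ≠ 0) ∧
      ∀ C' : Finset (Fin n), κ ≤ 4 * C'.card →
        (∀ i ∈ C', ∀ j ∈ C', i ≠ j → (PlantedClique.plant G C).Adj i j ∧
          ¬ (PlantedClique.plant G C).Adj v i ∧ ¬ (PlantedClique.plant G C).Adj v j) →
        S v → σ.arr 3 v = 0) :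
    PlantedClique.output n σ = C := by
  classical
  ext v
  rw [PlantedClique.output, Finset.mem_filter]
  simp only [Finset.mem_univ, true_and]
  constructor
  · intro hv
    by_contra hvC
    have hadj : ∀ u, (PlantedClique.plant G C).Adj v u ↔ G.Adj v u := fun u =>
      ⟨fun h => h.resolve_right fun h' => hvC h'.2.1, Or.inl⟩
    refine hv ((hσ v).2 (C.filter fun u => ¬ G.Adj v u) ?_ ?_ (h3 v))
    · by_contra h
      refine h2 v hvC ⟨C.filter fun u => ¬ G.Adj v u, Finset.filter_subset _ _, by omega, ?_⟩
      intro u hu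
      simp [hu]
    · intro i hi j hj hij
      rw [Finset.mem_filter] at hi hj
      rw [hadj, hadj]
      exact ⟨Or.inr ⟨hij, hi.1, hj.1⟩, hi.2, hj.2⟩
  · intro hv
    refine (hσ v).1 fun A B hA hB h => h1 A B hA hB fun i hi j hj => ?_
    obtain ⟨h4, h5, h6⟩ := h i hi j hj
    refine h4.resolve_right fun h7 => h7.1 ?_
    -- a non-neighbour of `v` in the clique is equal to `v`
    have h8 : ∀ u ∈ C, ¬ (PlantedClique.plant G C).Adj v u → u = v := fun u hu h' => by
      by_contra hne
      exact h' (Or.inr ⟨Ne.symm hne, hv, hu⟩)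
    rw [h8 i h7.2.1 h5, h8 j h7.2.2 h6]

end

theorem solvable_of_sospApproximable {k δ c β : ℝ} (hk : 0 < k) (hδ : 0 < δ)
    (hc : hardnessRatio k < c) (h : SOSPApproximable k δ c) (hβ : 0 < β) (hβ1 : β < 1 / 2) :
    PlantedClique.Solvable (fun n : ℕ => ⌊(n : ℝ) ^ β⌋₊) := by
  classical
  obtain ⟨P, T, hP⟩ := h
  have hc0 : 0 ≤ c := by
    refine le_trans (div_nonneg ?_ (one_sub_mul_exp_neg_pos hk).le) hc.le
    rw [sub_nonneg, Real.exp_le_one_iff]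
    linarith
  obtain ⟨K, E, kk, a, D, hK, hE, hkk, hkkk, hEa, hD, hlarge⟩ := exists_parameters hk hδ hc hβ
  obtain ⟨n₀, hn₀⟩ := eventually_atTop.1 hlarge
  obtain ⟨M, hM⟩ := P.exists_wa_lt
  obtain ⟨R, hR⟩ := P.exists_wr_lt
  have hM' : ∀ A, P.wa A = true → A < M + 3 := fun A hA => (hM A hA).trans (by omega)
  have hR' : ∀ A, P.wr A = true → A < R + 1 := fun A hA => (hR A hA).trans (by omega)
  obtain ⟨T₁, hT₁⟩ := RAM.polyBounded_cliqueTime D (a + 4) K kk E (M + 3) (R + 1) T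
  obtain ⟨T₂, hT₂⟩ : PolyBounded fun n => n * RAM.numBits D (a + 4) K n T :=
    PolyBounded.id.mul (((PolyBounded.lvl _).instSize (PolyBounded.id.pow _) K).eval T)
  have hK' : 0 < K := by omega
  -- `6` steps suffice for small graphs, and `T₂` bounds the number of random bits that are used
  set T' : Polynomial ℕ := T₁ + T₂ + Polynomial.C 6 with hT'
  have hT'e : ∀ n, T'.eval n = T₁.eval n + T₂.eval n + 6 := fun n => by simp [hT']
  set Q := RAM.cliqueP D (a + 4) K kk E (M + 3) (R + 1) n₀ P T with hQ
  have run := fun n (hn : n₀ ≤ n) (hden : 0 < n ^ (a + 4)) (H : SimpleGraph (Fin n))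
      (r : Fin (T'.eval n) → Bool) =>
    runs_cliqueP (M := M + 3) (R := R + 1) (fun I => (hP I).1) hk hc0 hK hK' hE hkk hkkk hEa hD
      (hn₀ n hn) hn hden (by omega) hM' (by omega) hR' H r
  refine ⟨Q, T', fun n G r => ?_, ?_⟩
  · by_cases hn : n₀ ≤ n
    · have hden : 0 < n ^ (a + 4) := pow_pos (hn₀ n hn).pos _
      obtain ⟨t, s, h1, h2, -⟩ := run n hn hden G r
      refine ⟨t, s, h1, h2.trans ((hT₁ n).trans ?_)⟩
      rw [hT'e]
      omega
    · obtain ⟨t, s, h1, h2, -⟩ := RAM.Runs.cliqueP_of_lt (D := D) (e := a + 4) (K := K) (kk := kk)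
        (E := E) (M := M + 3) (R := R + 1) (P := P) (T := T) (s := PlantedClique.start G r)
        (not_le.1 hn)
      refine ⟨t, s, h1, h2.trans ?_⟩
      rw [hT'e]
      omega
  -- the probability of failure
  have fail : ∀ n, n₀ ≤ n → 1 - (1 / (n : ℝ) + n * (9 / 10) ^ ⌊(n : ℝ) ^ β⌋₊ + n * (1 / 3) ^ n) ≤
      PlantedClique.successProb Q n ⌊(n : ℝ) ^ β⌋₊ (T'.eval n) := by
    intro n hn
    have hL := hn₀ n hn
    have hden : 0 < n ^ (a + 4) := pow_pos hL.pos _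
    set κ := ⌊(n : ℝ) ^ β⌋₊ with hκ
    have hn1 : (1 : ℝ) ≤ n := by exact_mod_cast hL.pos
    have hκn : κ ≤ n := by
      refine Nat.floor_le_of_le ?_
      calc (n : ℝ) ^ β ≤ (n : ℝ) ^ (1 : ℝ) :=
            Real.rpow_le_rpow_of_exponent_le hn1 (by linarith)
        _ = n := Real.rpow_one _
    have hne : Nonempty ({C : Finset (Fin n) // C.card = κ} × SimpleGraph (Fin n) ×
        (Fin (T'.eval n) → Bool)) := by
      obtain ⟨C, -, hC⟩ := Finset.exists_subset_card_eq
        (s := (Finset.univ : Finset (Fin n))) (n := κ) (by simpa using hκn)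
      exact ⟨⟨C, hC⟩, ⊥, fun _ => false⟩
    change _ ≤ unifProb fun x : {C : Finset (Fin n) // C.card = κ} × SimpleGraph (Fin n) ×
      (Fin (T'.eval n) → Bool) => ∃ (t : ℕ) (s : RAM.State), RAM.Exec RAM.noOracle Q
        (PlantedClique.start (PlantedClique.plant x.2.1 x.1) x.2.2) t s ∧
          PlantedClique.output n s = x.1
    rw [sub_le_comm, ← unifProb_not]
    set m := RAM.numBits D (a + 4) K n T with hm
    set S : SimpleGraph (Fin n) → (Fin (T'.eval n) → Bool) → Fin n → Prop := fun H r v =>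
      ∃ j : Fin n, (vertexInstance K (a + 4) D H v hK' hden hL.prob).Solves k c P
        (bitBlock r m j) with hS
    have b1 : unifProb (fun x : {C : Finset (Fin n) // C.card = κ} × SimpleGraph (Fin n) ×
        (Fin (T'.eval n) → Bool) => ¬ BicliqueFree x.2.1.Adj (3 * n.size)) ≤ 1 / (n : ℝ) := by
      refine unifProb_prod_le (by positivity) fun C => ?_
      have := unifProb_not_bicliqueFree_le n hL.pos
      rw [← unifProb_equiv (Equiv.prodComm (Fin (T'.eval n) → Bool) (SimpleGraph (Fin n)))]
      exact unifProb_prod_le (by positivity) fun r => this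
    have b2 : unifProb (fun x : {C : Finset (Fin n) // C.card = κ} × SimpleGraph (Fin n) ×
        (Fin (T'.eval n) → Bool) => ∃ v ∈ (x.1.1)ᶜ, ∃ S ⊆ x.1.1, 4 * S.card < x.1.1.card ∧
          ∀ u ∈ x.1.1, x.2.1.Adj v u ↔ u ∉ S) ≤ n * (9 / 10) ^ κ := by
      refine unifProb_prod_le (by positivity) fun C => ?_
      rw [← unifProb_equiv (Equiv.prodComm (Fin (T'.eval n) → Bool) (SimpleGraph (Fin n)))]
      refine unifProb_prod_le (by positivity) fun r => ?_
      refine (unifProb_exists_le (C.1)ᶜ (fun v (G : SimpleGraph (Fin n)) => ∃ S ⊆ C.1,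
        4 * S.card < C.1.card ∧ ∀ u ∈ C.1, G.Adj v u ↔ u ∉ S)).trans ?_
      refine (Finset.sum_le_card_nsmul _ _ ((9 / 10) ^ κ) fun v hv => ?_).trans ?_
      · exact (unifProb_few_nonneighbours_le (Finset.mem_compl.1 hv)).trans (by rw [C.2])
      · rw [nsmul_eq_mul]
        gcongr
        exact (Finset.card_le_univ _).trans (by simp)
    have b3 : unifProb (fun x : {C : Finset (Fin n) // C.card = κ} × SimpleGraph (Fin n) ×
        (Fin (T'.eval n) → Bool) => ∃ v ∈ (Finset.univ : Finset (Fin n)),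
          ¬ S (PlantedClique.plant x.2.1 x.1) x.2.2 v) ≤ n * (1 / 3) ^ n := by
      refine unifProb_prod_le (by positivity) fun C => ?_
      refine unifProb_prod_le (by positivity) fun G => ?_
      refine (unifProb_exists_le Finset.univ (fun v (r : Fin (T'.eval n) → Bool) =>
        ¬ S (PlantedClique.plant G C) r v)).trans ?_
      refine (Finset.sum_le_card_nsmul _ _ ((1 / 3) ^ n) fun v _ => ?_).trans (by simp)
      have h1 := (vertexInstance K (a + 4) D (PlantedClique.plant G C) v hK' hden
        hL.prob).unifProb_not_solves_le
        (vertexInstance_size _ v hK hK' hD hL.cap hden hL.prob) (hP _).2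
      refine le_trans (unifProb_mono fun r hr j => ?_) ((unifProb_bitBlock_le (M := T'.eval n)
        ((hT₂ n).trans (by rw [hT'e]; omega)) _).trans (pow_le_pow_left₀ (unifProb_nonneg _) h1 n))
      exact fun h' => hr ⟨j, h'⟩
    refine le_trans (unifProb_mono fun x hx => ?_) ((unifProb_or_le _ _).trans
      (add_le_add ((unifProb_or_le _ _).trans (add_le_add b1 b2)) b3))
    by_contra hgood
    push Not at hgood
    obtain ⟨⟨g1, g2⟩, g3⟩ := hgood
    obtain ⟨t, s, r1, -, r2⟩ := run n hn hden (PlantedClique.plant x.2.1 x.1) x.2.2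
    refine hx ⟨t, s, r1, output_eq_of_good x.1.2 g1 (fun v hv ⟨S', s1, s2, s3⟩ => ?_)
      (fun v => g3 v (Finset.mem_univ v)) r2⟩
    obtain ⟨u, hu, hu'⟩ := g2 v (Finset.mem_compl.2 hv) S' s1 s2
    have := s3 u hu
    tauto
  have lim : Tendsto (fun n : ℕ => 1 - (1 / (n : ℝ) + n * (9 / 10) ^ ⌊(n : ℝ) ^ β⌋₊ +
      n * (1 / 3) ^ n)) atTop (𝓝 1) := by
    have l1 : Tendsto (fun n : ℕ => 1 / (n : ℝ)) atTop (𝓝 0) := tendsto_one_div_atTop_nhds_zero_nat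
    have l3 : Tendsto (fun n : ℕ => (n : ℝ) * (1 / 3) ^ n) atTop (𝓝 0) :=
      tendsto_self_mul_const_pow_of_abs_lt_one (by norm_num [abs_lt])
    simpa using ((l1.add (tendsto_mul_pow_floor_rpow hβ)).add l3).const_sub 1
  refine tendsto_of_tendsto_of_tendsto_of_le_of_le' lim tendsto_const_nhds
    (eventually_atTop.2 ⟨n₀, fail⟩) (Eventually.of_forall fun n => ?_)
  unfold PlantedClique.successProb
  refine div_le_one_of_le₀ ?_ (by positivity)
  exact_mod_cast Nat.card_le_card_of_injective _ Subtype.val_injective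

theorem mainTheorem4 :
    (∀ k : ℝ, 0 < k → ∀ δ : ℝ, 0 < δ → ∀ c : ℝ, hardnessRatio k < c →
      SOSPApproximable k δ c →
        ∀ β : ℝ, 0 < β → β < 1 / 2 → PlantedClique.Solvable (fun n : ℕ => ⌊(n : ℝ) ^ β⌋₊)) ∧
    |hardnessRatio (17 / 10) - 0.865| < 0.0005 :=
  ⟨fun _ hk _ hδ _ hc h _ hβ hβ1 => solvable_of_sospApproximable hk hδ hc h hβ hβ1,
    abs_hardnessRatio_sub_lt⟩
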